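/- \textbf{Setting.} Let $\mathbb R^N$ carry the Euclidean norm $|\cdot|$, and let $B_j$ be the closed ball of radius $j$ about $0$. A \emph{b-measure} is a real-valued set function on the ring $\mathcal B$ of bounded Borel subsets of $\mathbb R$ that is countably additive on $\mathcal B$ and vanishes on $\emptyset$ and on points; $|\mu|(A)=\sup\sum_i|\mu(A_i)|$ (over finite Borel partitions $\{A_i\}$ of $A$) is its total variation. Let $\mathcal M_c^+$ be the set of locally finite positive Borel measures on $\mathbb R$ without atoms. A \emph{parametric b-measure} on $\mathbb R^N$ is a family $\nu=\{\nu_y\}_{y\in\mathbb R^N}$ of b-measures such that for every integer $j\ge1$ there are $m_j,l_j\in\mathcal M_c^+$ with $|\nu_y|(A)\le m_j(A)$ and $|\nu_{y_1}-\nu_{y_2}|(A)\le l_j(A)\,|y_1-y_2|$ for all $A\in\mathcal B$ and $y,y_1,y_2\in B_j$; $m_j$ and $l_j$ are called $m$-bounds and $l$-bounds. Let $\mathfrak M_p$ be the space of parametric b-measures; an element $\bar\nu=(\nu^1,\dots,\nu^N)$ of $\mathfrak M_p^N$ is an $N$-dim parametric b-measure, with $m$-bounds $m_j$ (resp. $l$-bounds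 $l_j$) if these are $m$-bounds ($l$-bounds) of every component. Translations are $(\mu\cdot t)(A)=\mu(A+t)$, $(\nu\cdot t)_y=\nu_y\cdot t$, and componentwise on $\mathfrak M_p^N$. For a continuous curve $y$, $\int_a^b d\nu_{y(s)}$ is the limit of the Riemann sums $\sum_i\nu_{y(\tau_i)}[t_i,t_{i+1}]$ over tagged partitions of $[a,b]$ as the mesh tends to $0$, with $\int_b^a=-\int_a^b$. A continuous $y:[a,b]\to\mathbb R^N$ solves $y'=\bar\nu_{y(t)}$, $y(t_0)=y_0$ $(t_0\in[a,b])$ if $y_i(t)=y_{0,i}+\int_{t_0}^t d\nu^i_{y(s)}$ for all $t\in[a,b]$ and $i=1,\dots,N$. Denote by $y(\cdot,\bar\nu,y_0)$ the solution with $y(0)=y_0$, on its maximal interval $I_{\bar\nu,y_0}$. \textbf{Topologies.} Let $I$ range over the intervals $[q_1,q_2]$ with rational $q_1<q_2$. Given functions $\Theta=\{\theta_j^I\}$, let $\mathcal K_j^I$ be the set of $y\in C(I,B_j)$ with $|y(t_1)-y(t_2)|\le\theta_j^I(|t_1-t_2|)$ on $I$; $\sigma_\Theta$ is the topology on $\mathfrak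 M_p$ generated by the seminorms $\sup_{y\in\mathcal K_j^I}|\int_I d\nu_{y(s)}|$, $j\ge1$. Given a countable dense $D\subset\mathbb R^N$, $\sigma_D$ is generated by the seminorms $|\nu_y(I)|$, $y\in D$. Let $\bar\sigma_\Theta$ and $\bar\sigma_D$ be the corresponding product topologies on $\mathfrak M_p^N$. \textbf{Theorem.} Let $\bar\nu_0\in\mathfrak M_p^N$ have equicontinuous $m$-bounds, that is, $m$-bounds $\{m_j\}_{j\ge1}$ with $m_j\le m_k$ for $j\le k$ such that for every $j\ge1$ and $\varepsilon>0$ there is $\delta>0$ with $(m_j\cdot\tau)[s,t]<\varepsilon$ for all $\tau\in\mathbb R$ and $0\le t-s<\delta$. Put $$\theta_j^I(s)=\sqrt N\,\sup_{t\in I,\ \tau\in\mathbb R}(m_j\cdot\tau)[t,t+s],\qquad s\ge0,$$ and let $\mathrm{Hull}(\bar\nu_0)$ be the $\bar\sigma_\Theta$-closure of $\{\bar\nu_0\cdot t\mid t\in\mathbb R\}$ in $\mathfrak M_p^N$, with the topology induced by $\bar\sigma_\Theta$. Then, for $\bar\nu\in\mathrm{Hull}(\bar\nu_0)$ and $y_0\in\mathbb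 R^N$, $I_{\bar\nu,y_0}$ is an open interval containing $0$ and $y(\cdot,\bar\nu,y_0)$ is the unique solution with $y(0)=y_0$; translation $(t,\bar\nu)\mapsto\bar\nu\cdot t$ is a continuous flow on $\mathrm{Hull}(\bar\nu_0)$; the set $$\mathcal U_1=\{(t,\bar\nu,y_0)\mid \bar\nu\in\mathrm{Hull}(\bar\nu_0),\ y_0\in\mathbb R^N,\ t\in I_{\bar\nu,y_0}\}$$ is open in $\mathbb R\times\mathrm{Hull}(\bar\nu_0)\times\mathbb R^N$; and $$\Pi:\mathcal U_1\to\mathrm{Hull}(\bar\nu_0)\times\mathbb R^N,\qquad \Pi(t,\bar\nu,y_0)=(\bar\nu\cdot t,\;y(t,\bar\nu,y_0))$$ is a local continuous skew-product flow: it is continuous, $\Pi(0,\cdot)$ is the identity, and if $(s,x)\in\mathcal U_1$, then $(t+s,x)\in\mathcal U_1$ if and only if $(t,\Pi(s,x))\in\mathcal U_1$, in which case $\Pi(t+s,x)=\Pi(t,\Pi(s,x))$. If in addition $\bar\nu_0$ has bounded $l$-bounds, that is, $l$-bounds $\{l_j\}_{j\ge1}$ such that for every $j\ge1$ there is $c>0$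 with $(l_j\cdot\tau)[t,t+1]\le c$ for all $\tau,t\in\mathbb R$, then $\mathrm{Hull}(\bar\nu_0)$ is compact and, for every countable dense $D\subset\mathbb R^N$, it equals the $\bar\sigma_D$-closure of $\{\bar\nu_0\cdot t\mid t\in\mathbb R\}$, and the topologies induced on it by $\bar\sigma_\Theta$ and $\bar\sigma_D$ coincide. -/

import Mathlib

open MeasureTheory Set
open scoped ENNReal

/-- The Euclidean space `ℝ^N`. -/
abbrev Euc (N : ℕ) : Type := EuclideanSpace ℝ (Fin N)

/-! ### b-measures -/

/-- The ring of bounded Borel subsets of `ℝ`. -/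
def boundedBorel : Set (Set ℝ) := {A | MeasurableSet A ∧ Bornology.IsBounded A}

/-- Continuous real b-measures: real set functions on the ring of bounded Borel sets, countably
additive there and vanishing on points. As for Mathlib's vector measures, the value on a set
outside the ring is `0` by convention, so that two b-measures are equal as soon as they agree on
bounded Borel sets. -/
@[ext]
structure BMeasure where
  toFun : Set ℝ → ℝ
  map_empty : toFun ∅ = 0
  hasSum_iUnion : ∀ A : ℕ → Set ℝ, (∀ n, A n ∈ boundedBorel) →
    Pairwise (fun m n => Disjoint (A m) (A n)) → (⋃ n, A n) ∈ boundedBorel →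
    HasSum (fun n => toFun (A n)) (toFun (⋃ n, A n))
  map_singleton : ∀ t : ℝ, toFun {t} = 0
  map_of_notMem : ∀ A, A ∉ boundedBorel → toFun A = 0

instance : CoeFun BMeasure (fun _ => Set ℝ → ℝ) := ⟨BMeasure.toFun⟩

instance : Sub BMeasure where
  sub μ ν :=
    { toFun := fun A => μ A - ν A
      map_empty := by simp [μ.map_empty, ν.map_empty]
      hasSum_iUnion := fun A h₁ h₂ h₃ =>
        (μ.hasSum_iUnion A h₁ h₂ h₃).sub (ν.hasSum_iUnion A h₁ h₂ h₃)
      map_singleton := fun t => by simp [μ.map_singleton, ν.map_singleton]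
      map_of_notMem := fun A h => by simp [μ.map_of_notMem A h, ν.map_of_notMem A h] }

theorem BMeasure.sub_apply (μ ν : BMeasure) (A : Set ℝ) : (μ - ν) A = μ A - ν A := rfl

/-- The total variation `|μ|(A)`: the supremum of `∑ |μ(A_i)|` over finite Borel partitions
`{A_1, …, A_n}` of `A`. -/
noncomputable def BMeasure.variation (μ : BMeasure) (A : Set ℝ) : ℝ≥0∞ :=
  ⨆ (n : ℕ) (P : Fin n → Set ℝ) (_ : (∀ i, MeasurableSet (P i)) ∧
    Pairwise (fun i k => Disjoint (P i) (P k)) ∧ (⋃ i, P i) = A), ∑ i, ‖μ (P i)‖ₑ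

theorem BMeasure.variation_sub_le (μ ν : BMeasure) (A : Set ℝ) :
    (μ - ν).variation A ≤ μ.variation A + ν.variation A := by
  refine iSup_le fun n => iSup_le fun P => iSup_le fun hP => ?_
  calc ∑ i, ‖(μ - ν) (P i)‖ₑ ≤ ∑ i, (‖μ (P i)‖ₑ + ‖ν (P i)‖ₑ) :=
        Finset.sum_le_sum fun i _ => enorm_sub_le
    _ = ∑ i, ‖μ (P i)‖ₑ + ∑ i, ‖ν (P i)‖ₑ := Finset.sum_add_distrib
    _ ≤ μ.variation A + ν.variation A := by
        refine add_le_add ?_ ?_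
        · exact le_iSup_of_le n (le_iSup_of_le P (le_iSup_of_le hP le_rfl))
        · exact le_iSup_of_le n (le_iSup_of_le P (le_iSup_of_le hP le_rfl))

/-- The translate `A + t` of a set. -/
def shiftSet (t : ℝ) (A : Set ℝ) : Set ℝ := (fun x => x - t) ⁻¹' A

theorem shiftSet_singleton (t s : ℝ) : shiftSet t {s} = {s + t} := by
  ext x
  simp [shiftSet, sub_eq_iff_eq_add]

theorem shiftSet_neg_shiftSet (t : ℝ) (A : Set ℝ) : shiftSet (-t) (shiftSet t A) = A := by
  ext x
  simp [shiftSet]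

theorem shiftSet_mem_boundedBorel {t : ℝ} {A : Set ℝ} (hA : A ∈ boundedBorel) :
    shiftSet t A ∈ boundedBorel := by
  refine ⟨(measurable_id.sub_const t) hA.1, ?_⟩
  obtain ⟨r, hr⟩ := isBounded_iff_forall_norm_le.1 hA.2
  refine isBounded_iff_forall_norm_le.2 ⟨r + ‖t‖, fun x hx => ?_⟩
  have h := norm_add_le (x - t) t
  rw [sub_add_cancel] at h
  linarith [hr _ hx]

theorem shiftSet_mem_boundedBorel_iff {t : ℝ} {A : Set ℝ} :
    shiftSet t A ∈ boundedBorel ↔ A ∈ boundedBorel := by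
  refine ⟨fun h => ?_, shiftSet_mem_boundedBorel⟩
  have := shiftSet_mem_boundedBorel (t := -t) h
  rwa [shiftSet_neg_shiftSet] at this

/-- The translated b-measure `(μ·t)(A) = μ(A + t)`. -/
def BMeasure.translate (μ : BMeasure) (t : ℝ) : BMeasure where
  toFun A := μ (shiftSet t A)
  map_empty := by simp [shiftSet, μ.map_empty]
  hasSum_iUnion A h₁ h₂ h₃ := by
    have e : shiftSet t (⋃ n, A n) = ⋃ n, shiftSet t (A n) := preimage_iUnion
    have h₃' := shiftSet_mem_boundedBorel (t := t) h₃
    rw [e] at h₃' ⊢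
    exact μ.hasSum_iUnion _ (fun n => shiftSet_mem_boundedBorel (h₁ n))
      (fun m n hmn => (h₂ hmn).preimage _) h₃'
  map_singleton s := by rw [shiftSet_singleton]; exact μ.map_singleton _
  map_of_notMem A h := μ.map_of_notMem _ fun h' => h (shiftSet_mem_boundedBorel_iff.1 h')

theorem BMeasure.variation_translate_le (μ : BMeasure) (t : ℝ) (A : Set ℝ) :
    (μ.translate t).variation A ≤ μ.variation (shiftSet t A) := by
  refine iSup_le fun n => iSup_le fun P => iSup_le fun hP => ?_
  refine le_iSup_of_le n (le_iSup_of_le (fun i => shiftSet t (P i)) (le_iSup_of_le ?_ le_rfl))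
  refine ⟨fun i => (measurable_id.sub_const t) (hP.1 i), fun i k h => (hP.2.1 h).preimage _, ?_⟩
  rw [← hP.2.2]
  exact preimage_iUnion.symm

/-! ### Positive measures -/

/-- The class of locally finite positive Borel measures on `ℝ` without purely discontinuous part
(regularity is automatic on `ℝ`). -/
def IsContinuousMeasure (μ : Measure ℝ) : Prop := IsLocallyFiniteMeasure μ ∧ ∀ t : ℝ, μ {t} = 0

/-- The translated measure `(μ·t)(A) = μ(A + t)`. -/
noncomputable def translateMeasure (μ : Measure ℝ) (t : ℝ) : Measure ℝ :=
  μ.map (fun x => x - t)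

theorem translateMeasure_apply (μ : Measure ℝ) (t : ℝ) (A : Set ℝ) :
    translateMeasure μ t A = μ (shiftSet t A) :=
  (MeasurableEquiv.subRight t).map_apply A

theorem IsContinuousMeasure.add {μ ν : Measure ℝ} (hμ : IsContinuousMeasure μ)
    (hν : IsContinuousMeasure ν) : IsContinuousMeasure (μ + ν) := by
  obtain ⟨h₁, h₂⟩ := hμ
  obtain ⟨h₃, h₄⟩ := hν
  refine ⟨⟨fun x => ?_⟩, fun x => by simp [h₂ x, h₄ x]⟩
  obtain ⟨s, hs, hs'⟩ := μ.finiteAt_nhds x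
  obtain ⟨u, hu, hu'⟩ := ν.finiteAt_nhds x
  refine ⟨s ∩ u, Filter.inter_mem hs hu, ?_⟩
  rw [Measure.add_apply]
  exact ENNReal.add_lt_top.2 ⟨(measure_mono inter_subset_left).trans_lt hs',
    (measure_mono inter_subset_right).trans_lt hu'⟩

theorem IsContinuousMeasure.translate {μ : Measure ℝ} (hμ : IsContinuousMeasure μ) (t : ℝ) :
    IsContinuousMeasure (translateMeasure μ t) := by
  obtain ⟨h₁, h₂⟩ := hμ
  refine ⟨⟨fun x => ?_⟩, fun x => ?_⟩
  · obtain ⟨s, hs, hs'⟩ := μ.finiteAt_nhds (x + t)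
    refine ⟨(fun x => x + t) ⁻¹' s, (continuous_add_const t).continuousAt hs, ?_⟩
    rw [translateMeasure_apply]
    simpa [shiftSet, preimage_preimage] using hs'
  · rw [translateMeasure_apply, shiftSet_singleton]
    exact h₂ _

/-- A bounded family of positive measures. -/
def BoundedFamily {Γ : Type*} (μ : Γ → Measure ℝ) : Prop :=
  ∃ c : ℝ, 0 < c ∧ ∀ (α : Γ) (t : ℝ), μ α (Icc t (t + 1)) ≤ ENNReal.ofReal c

/-- An equicontinuous family of positive measures. -/
def EquicontinuousFamily {Γ : Type*} (μ : Γ → Measure ℝ) : Prop :=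
  ∀ ε : ℝ, 0 < ε → ∃ δ : ℝ, 0 < δ ∧ ∀ (α : Γ) (s t : ℝ), 0 ≤ t - s → t - s < δ →
    μ α (Icc s t) < ENNReal.ofReal ε

/-! ### Parametric b-measures (with the moduli of continuity `ω_j = id`) -/

/-- `m` dominates `|ν_y|` for all `y` in the closed ball of radius `j`. -/
def IsMBound {N : ℕ} (ν : Euc N → BMeasure) (j : ℕ) (m : Measure ℝ) : Prop :=
  ∀ A ∈ boundedBorel, ∀ y : Euc N, ‖y‖ ≤ j → (ν y).variation A ≤ m A

/-- `|ν_{y₁} - ν_{y₂}|(A) ≤ l(A) |y₁ - y₂|` for all `y₁, y₂` in the closed ball of radius `j`. -/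
def IsLBound {N : ℕ} (ν : Euc N → BMeasure) (j : ℕ) (l : Measure ℝ) : Prop :=
  ∀ A ∈ boundedBorel, ∀ y₁ y₂ : Euc N, ‖y₁‖ ≤ j → ‖y₂‖ ≤ j →
    (ν y₁ - ν y₂).variation A ≤ l A * ENNReal.ofReal ‖y₁ - y₂‖

/-- Parametric b-measures on `ℝ^N`. -/
@[ext]
structure ParamBMeasure (N : ℕ) where
  toFun : Euc N → BMeasure
  exists_mBound : ∀ j : ℕ, 1 ≤ j → ∃ m, IsContinuousMeasure m ∧ IsMBound toFun j m
  exists_lBound : ∀ j : ℕ, 1 ≤ j → ∃ l, IsContinuousMeasure l ∧ IsLBound toFun j l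

instance (N : ℕ) : CoeFun (ParamBMeasure N) (fun _ => Euc N → BMeasure) := ⟨ParamBMeasure.toFun⟩

theorem BMeasure.sub_sub_sub_comm' (a b c d : BMeasure) : a - b - (c - d) = a - c - (b - d) := by
  ext A
  simp only [BMeasure.sub_apply]
  ring

instance (N : ℕ) : Sub (ParamBMeasure N) where
  sub ν μ :=
    { toFun := fun y => ν y - μ y
      exists_mBound := fun j hj => by
        obtain ⟨m₁, h₁, h₁'⟩ := ν.exists_mBound j hj
        obtain ⟨m₂, h₂, h₂'⟩ := μ.exists_mBound j hj
        refine ⟨m₁ + m₂, h₁.add h₂, fun A hA y hy => ?_⟩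
        rw [Measure.add_apply]
        exact (BMeasure.variation_sub_le _ _ _).trans (add_le_add (h₁' A hA y hy) (h₂' A hA y hy))
      exists_lBound := fun j hj => by
        obtain ⟨l₁, h₁, h₁'⟩ := ν.exists_lBound j hj
        obtain ⟨l₂, h₂, h₂'⟩ := μ.exists_lBound j hj
        refine ⟨l₁ + l₂, h₁.add h₂, fun A hA x y hx hy => ?_⟩
        rw [Measure.add_apply, add_mul, BMeasure.sub_sub_sub_comm']
        exact (BMeasure.variation_sub_le _ _ _).trans
          (add_le_add (h₁' A hA x y hx hy) (h₂' A hA x y hx hy)) }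

/-- The translated parametric b-measure `(ν·t)_y = ν_y·t`. -/
def ParamBMeasure.translate {N : ℕ} (ν : ParamBMeasure N) (t : ℝ) : ParamBMeasure N where
  toFun y := (ν y).translate t
  exists_mBound j hj := by
    obtain ⟨m, h, h'⟩ := ν.exists_mBound j hj
    refine ⟨translateMeasure m t, h.translate t, fun A hA y hy => ?_⟩
    rw [translateMeasure_apply]
    exact (BMeasure.variation_translate_le _ _ _).trans
      (h' _ (shiftSet_mem_boundedBorel hA) y hy)
  exists_lBound j hj := by
    obtain ⟨l, h, h'⟩ := ν.exists_lBound j hj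
    refine ⟨translateMeasure l t, h.translate t, fun A hA x y hx hy => ?_⟩
    rw [translateMeasure_apply]
    exact (BMeasure.variation_translate_le (ν x - ν y) t A).trans
      (h' _ (shiftSet_mem_boundedBorel hA) x y hx hy)

/-- `N`-dim parametric b-measures on `ℝ^N`. -/
abbrev VecParamBMeasure (N : ℕ) : Type := Fin N → ParamBMeasure N

/-- Componentwise translation. -/
def VecParamBMeasure.translate {N : ℕ} (ν : VecParamBMeasure N) (t : ℝ) : VecParamBMeasure N :=
  fun i => (ν i).translate t

/-! ### Integration along curves -/

/-- `L` is the integral `∫_a^b dν_{y(s)}` (for `a ≤ b`), the limit of the Riemann sums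
`∑ ν_{y(τ_i)}[t_i, t_{i+1}]` over tagged `δ`-partitions of `[a, b]`. -/
def HasCurveIntegral {N : ℕ} (ν : ParamBMeasure N) (y : ℝ → Euc N) (a b L : ℝ) : Prop :=
  ∀ ε : ℝ, 0 < ε → ∃ δ : ℝ, 0 < δ ∧ ∀ (k : ℕ) (t : Fin (k + 1) → ℝ) (τ : Fin k → ℝ),
    StrictMono t → t 0 = a → t (Fin.last k) = b →
    (∀ i : Fin k, τ i ∈ Icc (t i.castSucc) (t i.succ)) →
    (∀ i : Fin k, t i.succ - t i.castSucc < δ) →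
    |L - ∑ i : Fin k, ν (y (τ i)) (Icc (t i.castSucc) (t i.succ))| < ε

open Classical in
/-- The integral `∫_a^b dν_{y(s)}` for `a ≤ b`. It exists for every continuous curve; the
value is `0` if it does not exist. -/
noncomputable def riemannIntegral {N : ℕ} (ν : ParamBMeasure N) (y : ℝ → Euc N) (a b : ℝ) : ℝ :=
  if h : ∃ L, HasCurveIntegral ν y a b L then h.choose else 0

/-- The oriented integral: `∫_b^a dν_{y(s)} = -∫_a^b dν_{y(s)}` for `a < b`. -/
noncomputable def paramIntegral {N : ℕ} (ν : ParamBMeasure N) (y : ℝ → Euc N) (a b : ℝ) : ℝ :=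
  if a ≤ b then riemannIntegral ν y a b else -riemannIntegral ν y b a

/-! ### Topologies -/

/-- The topology generated by the open balls of a family of seminorms. -/
@[reducible] def seminormTopology {V ι : Type*} [Sub V] (p : ι → V → ℝ≥0∞) : TopologicalSpace V :=
  TopologicalSpace.generateFrom
    {U | ∃ (i : ι) (ν₀ : V) (ε : ℝ≥0∞), 0 < ε ∧ U = {ν | p i (ν - ν₀) < ε}}

/-- Compact intervals `[q₁, q₂]` with rational endpoints `q₁ < q₂`. -/
abbrev RatInterval : Type := {q : ℚ × ℚ // q.1 < q.2}

/-- The underlying real interval. -/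
def RatInterval.toSet (I : RatInterval) : Set ℝ := Icc (I.1.1 : ℝ) (I.1.2 : ℝ)

/-- The curves in `C(I, B_j)` with modulus of continuity `θ`. -/
def admissibleCurves (N : ℕ) (θ : ℝ → ℝ) (j : ℕ) (I : RatInterval) : Set (ℝ → Euc N) :=
  {y | ContinuousOn y I.toSet ∧ (∀ t ∈ I.toSet, ‖y t‖ ≤ j) ∧
    ∀ t₁ ∈ I.toSet, ∀ t₂ ∈ I.toSet, ‖y t₁ - y t₂‖ ≤ θ |t₁ - t₂|}

/-- The topology `σ_Θ`, for `Θ = {θ_j^I}`, generated by the seminorms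
`p_{I,j}(ν) = sup {|∫_I dν_{y(s)}| : y ∈ K_j^I}`, `j ≥ 1`. -/
@[reducible] noncomputable def sigmaTheta (N : ℕ) (θ : ℕ → RatInterval → ℝ → ℝ) :
    TopologicalSpace (ParamBMeasure N) :=
  seminormTopology (fun (p : RatInterval × {j : ℕ // 1 ≤ j}) (ν : ParamBMeasure N) =>
    ⨆ y ∈ admissibleCurves N (θ p.2 p.1) p.2 p.1, ‖paramIntegral ν y p.1.1.1 p.1.1.2‖ₑ)

/-- The topology `σ_D`, generated by the seminorms `p_{I,y}(ν) = |ν_y(I)|`, `y ∈ D`. -/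
@[reducible] noncomputable def sigmaD (N : ℕ) (D : Set (Euc N)) : TopologicalSpace (ParamBMeasure N) :=
  seminormTopology (fun (p : RatInterval × D) (ν : ParamBMeasure N) => ‖ν p.2 p.1.toSet‖ₑ)

/-- The product topology on `N`-tuples of parametric b-measures. -/
@[reducible] def productTopology {N : ℕ} (T : TopologicalSpace (ParamBMeasure N)) :
    TopologicalSpace (VecParamBMeasure N) :=
  @Pi.topologicalSpace (Fin N) (fun _ => ParamBMeasure N) (fun _ => T)

/-- The moduli of continuity
`θ_j^I(s) = √N · sup {(m_j·τ)[t, t + s] : t ∈ I, τ ∈ ℝ}` associated with the translates of the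
`m`-bounds. As `m_j` bounds each of the `N` components separately, the factor `√N` makes `θ_j^I`
a modulus of continuity, for the Euclidean norm, of the solutions with values in `B_j`. -/
noncomputable def moduliOf (N : ℕ) (m : ℕ → Measure ℝ) (j : ℕ) (I : RatInterval) (s : ℝ) : ℝ :=
  √(N : ℝ) * (⨆ t ∈ I.toSet, ⨆ τ : ℝ, translateMeasure (m j) τ (Icc t (t + s))).toReal

/-- The topology `σ̄_Θ` on `N`-tuples, for the moduli associated with the `m`-bounds `m_j`. -/
@[reducible] noncomputable def thetaTopology (N : ℕ) (m : ℕ → Measure ℝ) :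
    TopologicalSpace (VecParamBMeasure N) :=
  productTopology (sigmaTheta N (moduliOf N m))

/-- The product topology `σ̄_D` on `N`-tuples. -/
@[reducible] noncomputable def denseTopology (N : ℕ) (D : Set (Euc N)) :
    TopologicalSpace (VecParamBMeasure N) :=
  productTopology (sigmaD N D)

/-- The closure of the set of translates of `ν` in the topology `T`. -/
def hull {N : ℕ} (T : TopologicalSpace (VecParamBMeasure N)) (ν : VecParamBMeasure N) :
    Set (VecParamBMeasure N) :=
  @closure _ T (range fun t : ℝ => ν.translate t)

/-- The hull as a topological space, with the topology induced by `T`. -/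
def HullSpace {N : ℕ} (T : TopologicalSpace (VecParamBMeasure N)) (ν : VecParamBMeasure N) :
    Type :=
  {μ : VecParamBMeasure N // μ ∈ hull T ν}

instance {N : ℕ} (T : TopologicalSpace (VecParamBMeasure N)) (ν : VecParamBMeasure N) :
    TopologicalSpace (HullSpace T ν) :=
  @instTopologicalSpaceSubtype _ (fun μ => μ ∈ hull T ν) T

/-! ### Generalized ODEs -/

/-- `y` is a solution on `[a, b]` of `y' = ν_{y(t)}`, `y(t₀) = y₀`. -/
def IsSolution {N : ℕ} (ν : VecParamBMeasure N) (t₀ : ℝ) (y₀ : Euc N) (a b : ℝ)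
    (y : ℝ → Euc N) : Prop :=
  t₀ ∈ Icc a b ∧ ContinuousOn y (Icc a b) ∧
    ∀ t ∈ Icc a b, ∀ i : Fin N, y t i = y₀ i + paramIntegral (ν i) y t₀ t

/-- The maximal interval of existence `I_{ν,y₀}` for the initial condition `y(0) = y₀`: the union
of all compact intervals that carry a solution. -/
def maximalInterval {N : ℕ} (ν : VecParamBMeasure N) (y₀ : Euc N) : Set ℝ :=
  {t | ∃ (a b : ℝ) (y : ℝ → Euc N), IsSolution ν 0 y₀ a b y ∧ t ∈ Icc a b}

open Classical in
/-- The value `y(t, ν, y₀)` at time `t` of the solution with `y(0) = y₀` (`0` outside of the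
maximal interval). -/
noncomputable def solution {N : ℕ} (ν : VecParamBMeasure N) (y₀ : Euc N) (t : ℝ) : Euc N :=
  if h : ∃ y : ℝ → Euc N, ∃ a b : ℝ, IsSolution ν 0 y₀ a b y ∧ t ∈ Icc a b then h.choose t else 0

/-- The solution `y(·, ν, y₀)` is well defined: the maximal interval is an open interval around
`0`, `y(·, ν, y₀)` is a solution on it, and it extends every other solution. -/
def IsWellPosed {N : ℕ} (ν : VecParamBMeasure N) (y₀ : Euc N) : Prop :=
  IsOpen (maximalInterval ν y₀) ∧ (maximalInterval ν y₀).OrdConnected ∧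
    0 ∈ maximalInterval ν y₀ ∧
    (∀ a b : ℝ, 0 ∈ Icc a b → Icc a b ⊆ maximalInterval ν y₀ →
      IsSolution ν 0 y₀ a b (solution ν y₀)) ∧
    ∀ (a b : ℝ) (z : ℝ → Euc N), IsSolution ν 0 y₀ a b z →
      EqOn z (solution ν y₀) (Icc a b)

/-- The set `𝒰₁ = {(t, ν, y) : ν ∈ Hull, t ∈ I_{ν,y}}`. -/
def flowDomain {N : ℕ} (T : TopologicalSpace (VecParamBMeasure N)) (ν₀ : VecParamBMeasure N) :
    Set (ℝ × HullSpace T ν₀ × Euc N) :=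
  {p | p.1 ∈ maximalInterval p.2.1.1 p.2.2}

/-! ### Local flows -/

/-- A local continuous flow `Φ` on `X` with open domain `U ⊆ ℝ × X` (the values of `Φ` outside of
`U` are irrelevant). -/
structure IsLocalContinuousFlow {X : Type*} [TopologicalSpace X] (U : Set (ℝ × X))
    (Φ : ℝ × X → X) : Prop where
  isOpen_domain : IsOpen U
  ordConnected : ∀ x : X, {t : ℝ | (t, x) ∈ U}.OrdConnected
  zero_mem : ∀ x : X, ((0 : ℝ), x) ∈ U
  map_zero : ∀ x : X, Φ (0, x) = x
  add_mem_iff : ∀ (s t : ℝ) (x : X), (s, x) ∈ U → ((t + s, x) ∈ U ↔ (t, Φ (s, x)) ∈ U)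
  map_add : ∀ (s t : ℝ) (x : X), (s, x) ∈ U → (t + s, x) ∈ U → Φ (t + s, x) = Φ (t, Φ (s, x))
  continuousOn : ContinuousOn Φ U

/-- A local continuous skew-product flow on `B × F`, over the (global) continuous flow `φ` on the
base `B`. -/
structure IsLocalContinuousSkewProductFlow {B F : Type*} [TopologicalSpace B]
    [TopologicalSpace F] (φ : Flow ℝ B) (U : Set (ℝ × B × F)) (Φ : ℝ × B × F → B × F) : Prop
    extends IsLocalContinuousFlow U Φ where
  fst_eq : ∀ p ∈ U, (Φ p).1 = φ p.1 p.2.1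

open Filter Topology

variable {N : ℕ}

/-! ### Bounded Borel sets and distribution functions -/

/-! Integrals along curves only involve the values of `ν_y` on compact intervals. Most of the
analysis therefore replaces measures by distribution functions: `MDom` and `LDom` say that the
increments of a monotone function dominate the values, respectively the Lipschitz constants in `y`,
of a parametric b-measure on intervals.

The equation is truncated by `Euc.clamp`, which makes it globally Lipschitz. A contraction on
intervals where the Lipschitz function grows by at most `1/2`, followed by gluing, gives existence
on any compact interval; `gronwall`, proved by the same subdivision, gives uniqueness and the
estimate `exists_clamp_estimate`. As long as a solution stays below the truncation level it solves
the original equation, whence well-posedness for every parametric b-measure, and the cocycle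
identity follows from uniqueness.

For the topology, the decisive object is the modulus `translateModulus (m j)`. It is invariant under
translation and survives limits, so every element of the hull has bounds with this same modulus
(`HasModulusBounds`). Truncated solutions of all equations in the hull are thus, for large `j`,
equicontinuous with the modulus used in the definition of `σ_Θ`, and convergence in `σ_Θ` is uniform
along such curves (`eventually_abs_paramIntegral_sub_le`). In the Gronwall comparison only the limit
equation needs a Lipschitz bound, while the integrals of the two equations are compared along the
solution of the perturbed one. So continuous dependence needs no uniform `l`-bounds. The same
uniformity gives continuity of translation.

With bounded `l`-bounds the Lipschitz functions are uniformly controlled as well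
(`HasUniformBounds`). Distribution functions then converge along every ultrafilter, the limits are
again those of a parametric b-measure (`HasUniformBounds.exists_limit`), and a finite-net argument
upgrades pointwise convergence to `σ_Θ` (`tendsto_theta_of_tendsto_apply`). Hence the hull is
compact. Since `σ_D` is coarser and Hausdorff, it yields the same closure and the same topology on
it. -/

theorem mem_boundedBorel_of_subset_Icc {A : Set ℝ} {a b : ℝ} (hA : MeasurableSet A)
    (h : A ⊆ Icc a b) : A ∈ boundedBorel :=
  ⟨hA, (Metric.isBounded_Icc a b).subset h⟩

theorem Icc_mem_boundedBorel (a b : ℝ) : Icc a b ∈ boundedBorel :=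
  mem_boundedBorel_of_subset_Icc measurableSet_Icc subset_rfl

theorem Ioc_mem_boundedBorel (a b : ℝ) : Ioc a b ∈ boundedBorel :=
  mem_boundedBorel_of_subset_Icc measurableSet_Ioc Ioc_subset_Icc_self

theorem boundedBorel.inter {A B : Set ℝ} (hA : MeasurableSet A) (hB : B ∈ boundedBorel) :
    A ∩ B ∈ boundedBorel :=
  ⟨hA.inter hB.1, hB.2.subset inter_subset_right⟩

theorem boundedBorel.exists_subset_Ioc {A : Set ℝ} (hA : A ∈ boundedBorel) :
    ∃ n : ℕ, A ⊆ Ioc (-(n : ℝ)) n := by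
  obtain ⟨r, hr⟩ := isBounded_iff_forall_norm_le.1 hA.2
  obtain ⟨n, hn⟩ := exists_nat_gt r
  exact ⟨n, fun x hx => ⟨by linarith [(abs_le.1 (hr x hx)).1], by linarith [(abs_le.1 (hr x hx)).2]⟩⟩

open Classical in
/-- The restriction of a b-measure to a bounded Borel set, as a signed measure. -/
noncomputable def BMeasure.restrictSigned (μ : BMeasure) (I : Set ℝ) (hI : I ∈ boundedBorel) :
    SignedMeasure ℝ where
  measureOf' A := if MeasurableSet A then μ (A ∩ I) else 0
  empty' := by simp [μ.map_empty]
  not_measurable' A hA := by simp [hA]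
  m_iUnion' A h₁ h₂ := by
    simp only [h₁, MeasurableSet.iUnion h₁, if_true, iUnion_inter]
    refine μ.hasSum_iUnion _ (fun n => boundedBorel.inter (h₁ n) hI)
      (fun m n hmn => (h₂ hmn).mono inter_subset_left inter_subset_left) ?_
    rw [← iUnion_inter]
    exact boundedBorel.inter (.iUnion h₁) hI

theorem BMeasure.restrictSigned_apply (μ : BMeasure) {I : Set ℝ} (hI : I ∈ boundedBorel) {A : Set ℝ}
    (hA : MeasurableSet A) : μ.restrictSigned I hI A = μ (A ∩ I) := if_pos hA

theorem BMeasure.union (μ : BMeasure) {A B : Set ℝ} (hA : A ∈ boundedBorel) (hB : B ∈ boundedBorel)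
    (h : Disjoint A B) : μ (A ∪ B) = μ A + μ B := by
  have hAB : A ∪ B ∈ boundedBorel := ⟨hA.1.union hB.1, hA.2.union hB.2⟩
  have := (μ.restrictSigned _ hAB).of_union h hA.1 hB.1
  rwa [μ.restrictSigned_apply _ hA.1, μ.restrictSigned_apply _ hB.1,
    μ.restrictSigned_apply _ (hA.1.union hB.1), inter_self,
    inter_eq_left.2 subset_union_left, inter_eq_left.2 subset_union_right] at this

theorem BMeasure.Icc_eq_Ioc (μ : BMeasure) {a b : ℝ} (h : a ≤ b) : μ (Icc a b) = μ (Ioc a b) := by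
  rw [← Icc_union_Ioc_eq_Icc le_rfl h, Icc_self,
    μ.union (by simpa using Icc_mem_boundedBorel a a) (Ioc_mem_boundedBorel a b) (by simp),
    μ.map_singleton, zero_add]

theorem BMeasure.Icc_self (μ : BMeasure) (a : ℝ) : μ (Icc a a) = 0 := by
  rw [Set.Icc_self, μ.map_singleton]

theorem BMeasure.Icc_add_Icc (μ : BMeasure) {a b c : ℝ} (h : a ≤ b) (h' : b ≤ c) :
    μ (Icc a b) + μ (Icc b c) = μ (Icc a c) := by
  rw [μ.Icc_eq_Ioc h', ← Icc_union_Ioc_eq_Icc h h',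
    μ.union (Icc_mem_boundedBorel a b) (Ioc_mem_boundedBorel b c)]
  exact Set.disjoint_left.2 fun x hx hx' => not_lt.2 hx.2 hx'.1

/-- The distribution function of a b-measure, normalized at `0`. -/
def BMeasure.cdf (μ : BMeasure) (t : ℝ) : ℝ := μ (Icc 0 t) - μ (Icc t 0)

/-- Of the two intervals in `cdf`, one is always empty or a point, hence null; the signs reduce
everything to additivity on adjacent intervals. -/
theorem BMeasure.Icc_eq_cdf (μ : BMeasure) {a b : ℝ} (h : a ≤ b) :
    μ (Icc a b) = μ.cdf b - μ.cdf a := by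
  have e : ∀ x y : ℝ, x < y → μ (Icc y x) = 0 := fun x y h => by
    rw [Icc_eq_empty (not_le.2 h), μ.map_empty]
  have key : ∀ x y : ℝ, x ≤ y → μ (Icc y x) = 0 := fun x y h => by
    rcases h.eq_or_lt with rfl | h
    · exact μ.Icc_self _
    · exact e _ _ h
  unfold BMeasure.cdf
  rcases le_total 0 a with ha | ha
  · rw [← μ.Icc_add_Icc ha h, key _ _ ha, key _ _ (ha.trans h)]
    ring
  · rcases le_total 0 b with hb | hb
    · rw [← μ.Icc_add_Icc ha hb, key _ _ ha, key _ _ hb]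
      ring
    · rw [← μ.Icc_add_Icc h hb, key _ _ ha, key _ _ hb]
      ring

theorem BMeasure.cdf_zero (μ : BMeasure) : μ.cdf 0 = 0 := by simp [BMeasure.cdf]

theorem BMeasure.cdf_sub (μ ν : BMeasure) (t : ℝ) : (μ - ν).cdf t = μ.cdf t - ν.cdf t := by
  simp only [BMeasure.cdf, BMeasure.sub_apply]
  ring

theorem shiftSet_Icc (t a b : ℝ) : shiftSet t (Icc a b) = Icc (a + t) (b + t) := by
  ext x
  simp [shiftSet]

theorem BMeasure.translate_Icc (μ : BMeasure) (t a b : ℝ) :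
    μ.translate t (Icc a b) = μ (Icc (a + t) (b + t)) := by
  rw [← shiftSet_Icc]
  rfl

/-- A b-measure is determined by its values on compact intervals. -/
theorem BMeasure.ext_of_Icc {μ ν : BMeasure} (h : ∀ a b : ℝ, a ≤ b → μ (Icc a b) = ν (Icc a b)) :
    μ = ν := by
  have hIoc : ∀ a b : ℝ, μ (Ioc a b) = ν (Ioc a b) := fun a b => by
    rcases le_or_gt a b with hab | hab
    · rw [← μ.Icc_eq_Ioc hab, ← ν.Icc_eq_Ioc hab, h a b hab]
    · rw [Ioc_eq_empty (not_lt.2 hab.le), μ.map_empty, ν.map_empty]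
  ext A
  by_cases hA : A ∈ boundedBorel
  · obtain ⟨n, hn⟩ := boundedBorel.exists_subset_Ioc hA
    have hI := Ioc_mem_boundedBorel (-(n : ℝ)) n
    -- A b-measure need not extend to unbounded sets, so the uniqueness theorem for signed measures
    -- on a π-system is applied after restriction to an interval containing `A`.
    have : μ.restrictSigned _ hI = ν.restrictSigned _ hI := by
      refine VectorMeasure.ext_of_generateFrom _ ?_
        ((BorelSpace.measurable_eq (α := ℝ)).trans (borel_eq_generateFrom_Ioc ℝ))
        (isPiSystem_Ioc id id) ?_
      · rintro _ ⟨l, u, -, rfl⟩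
        rw [μ.restrictSigned_apply _ measurableSet_Ioc, ν.restrictSigned_apply _ measurableSet_Ioc,
          Ioc_inter_Ioc, hIoc]
      · rw [μ.restrictSigned_apply _ .univ, ν.restrictSigned_apply _ .univ, univ_inter, hIoc]
    have h' := congrArg (fun v : SignedMeasure ℝ => v A) this
    simp only [μ.restrictSigned_apply _ hA.1, ν.restrictSigned_apply _ hA.1,
      inter_eq_left.2 hn] at h'
    exact h'
  · rw [μ.map_of_notMem A hA, ν.map_of_notMem A hA]

/-! ### Differences of positive measures, and distribution functions of continuous measures -/

open Classical in
/-- The b-measure `μ₁ - μ₂`, for two locally finite measures with the same atoms. -/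
noncomputable def BMeasure.ofMeasures (μ₁ μ₂ : Measure ℝ) [IsLocallyFiniteMeasure μ₁]
    [IsLocallyFiniteMeasure μ₂] (h : ∀ t, μ₁ {t} = μ₂ {t}) : BMeasure where
  toFun A := if A ∈ boundedBorel then μ₁.real A - μ₂.real A else 0
  map_empty := by simp
  hasSum_iUnion A h₁ h₂ h₃ := by
    have key : ∀ (μ : Measure ℝ) [IsLocallyFiniteMeasure μ],
        HasSum (fun n => μ.real (A n)) (μ.real (⋃ n, A n)) := fun μ _ => by
      have hfin : μ (⋃ n, A n) ≠ ∞ := h₃.2.measure_lt_top.ne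
      rw [Measure.real, measure_iUnion h₂ fun n => (h₁ n).1]
      rw [measure_iUnion h₂ fun n => (h₁ n).1] at hfin
      rw [ENNReal.tsum_toReal_eq fun n => (h₁ n).2.measure_lt_top.ne]
      exact ENNReal.hasSum_toReal hfin
    simp only [h₁, h₃, if_true]
    exact (key μ₁).sub (key μ₂)
  map_singleton t := by simp [Measure.real, h t]
  map_of_notMem A hA := if_neg hA

theorem BMeasure.ofMeasures_apply {μ₁ μ₂ : Measure ℝ} [IsLocallyFiniteMeasure μ₁]
    [IsLocallyFiniteMeasure μ₂] (h : ∀ t, μ₁ {t} = μ₂ {t}) {A : Set ℝ} (hA : A ∈ boundedBorel) :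
    BMeasure.ofMeasures μ₁ μ₂ h A = μ₁.real A - μ₂.real A := if_pos hA

theorem BMeasure.enorm_le_variation (μ : BMeasure) {A : Set ℝ} (hA : MeasurableSet A) :
    ‖μ A‖ₑ ≤ μ.variation A := by
  refine le_iSup_of_le 1 (le_iSup_of_le (fun _ => A) (le_iSup_of_le ⟨fun _ => hA, ?_, ?_⟩ (by simp)))
  · exact fun i k h => (h (Subsingleton.elim i k)).elim
  · exact iUnion_const A

/-- A bound on single sets already bounds the variation, because `m` is additive over the pieces of
a partition. -/
theorem BMeasure.variation_le {μ : BMeasure} {m : Measure ℝ}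
    (h : ∀ A ∈ boundedBorel, ‖μ A‖ₑ ≤ m A) : ∀ A ∈ boundedBorel, μ.variation A ≤ m A := by
  intro A hA
  refine iSup_le fun n => iSup_le fun P => iSup_le fun ⟨h₁, h₂, h₃⟩ => ?_
  have hP : ∀ i, P i ∈ boundedBorel := fun i =>
    ⟨h₁ i, hA.2.subset (h₃ ▸ subset_iUnion P i)⟩
  calc ∑ i, ‖μ (P i)‖ₑ ≤ ∑ i, m (P i) := Finset.sum_le_sum fun i _ => h _ (hP i)
    _ = m A := by rw [← h₃, measure_iUnion h₂ h₁, tsum_fintype]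

/-- The distribution function of a continuous measure. -/
theorem IsContinuousMeasure.exists_cdf {m : Measure ℝ} (hm : IsContinuousMeasure m) :
    ∃ M : ℝ → ℝ, Monotone M ∧ Continuous M ∧ M 0 = 0 ∧
      ∀ a b : ℝ, a ≤ b → m (Icc a b) = ENNReal.ofReal (M b - M a) := by
  obtain ⟨h₁, h₂⟩ := hm
  let μ := BMeasure.ofMeasures m 0 (by simp [h₂])
  have hμ : ∀ a b : ℝ, a ≤ b → m.real (Icc a b) = μ.cdf b - μ.cdf a := fun a b hab => by
    rw [← μ.Icc_eq_cdf hab, BMeasure.ofMeasures_apply _ (Icc_mem_boundedBorel a b)]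
    simp
  have hmono : Monotone μ.cdf := fun a b hab => by
    have := hμ a b hab
    linarith [measureReal_nonneg (μ := m) (s := Icc a b)]
  have hIcc : ∀ a b : ℝ, a ≤ b → m (Icc a b) = ENNReal.ofReal (μ.cdf b - μ.cdf a) :=
    fun a b hab => by rw [← hμ a b hab, ofReal_measureReal (isCompact_Icc.measure_lt_top.ne)]
  refine ⟨μ.cdf, hmono, ?_, μ.cdf_zero, hIcc⟩
  rw [Metric.continuous_iff']
  intro x ε hε
  -- Continuity at `x` is the absence of an atom: closed intervals shrinking to `{x}` have finite
  -- measure, so their measures tend to `m {x} = 0`.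
  have hlim : Tendsto (fun n : ℕ => m (Icc (x - 1 / ((n : ℝ) + 1)) (x + 1 / ((n : ℝ) + 1)))) atTop (𝓝 (m {x})) := by
    have hinter : (⋂ n : ℕ, Icc (x - 1 / ((n : ℝ) + 1)) (x + 1 / ((n : ℝ) + 1))) = {x} := by
      ext z
      simp only [mem_iInter, mem_Icc, mem_singleton_iff]
      constructor
      · intro h
        have l := tendsto_one_div_add_atTop_nhds_zero_nat (𝕜 := ℝ)
        refine le_antisymm (le_of_tendsto_of_tendsto' tendsto_const_nhds (l.const_add x |>.trans (by simp)) fun n => (h n).2)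
          (le_of_tendsto_of_tendsto' (l.const_sub x |>.trans (by simp)) tendsto_const_nhds fun n => (h n).1)
      · rintro rfl n
        have : (0 : ℝ) ≤ 1 / ((n : ℝ) + 1) := by positivity
        constructor <;> linarith
    rw [← hinter]
    refine tendsto_measure_iInter_atTop (fun n => measurableSet_Icc.nullMeasurableSet) ?_
      ⟨0, isCompact_Icc.measure_lt_top.ne⟩
    intro n k hnk
    have : 1 / ((k : ℝ) + 1) ≤ 1 / ((n : ℝ) + 1) := by
      have : (n : ℝ) ≤ k := by exact_mod_cast hnk
      gcongr
    exact Icc_subset_Icc (by linarith) (by linarith)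
  rw [h₂] at hlim
  obtain ⟨n, hn⟩ := (hlim.eventually (gt_mem_nhds (ENNReal.ofReal_pos.2 hε))).exists
  have hpos : (0 : ℝ) < 1 / ((n : ℝ) + 1) := by positivity
  rw [hIcc _ _ (by linarith), ENNReal.ofReal_lt_ofReal_iff hε] at hn
  filter_upwards [Icc_mem_nhds (show x - 1 / ((n : ℝ) + 1) < x by linarith)
    (show x < x + 1 / ((n : ℝ) + 1) by linarith)] with z hz
  have a₁ := hmono hz.1
  have a₂ := hmono hz.2
  have a₃ : μ.cdf (x - 1 / ((n : ℝ) + 1)) ≤ μ.cdf x := hmono (by linarith)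
  have a₄ : μ.cdf x ≤ μ.cdf (x + 1 / ((n : ℝ) + 1)) := hmono (by linarith)
  rw [Real.dist_eq, abs_lt]
  constructor <;> linarith

/-! ### Bounds on intervals -/

/-- `M` is a monotone function whose increments dominate `ν_y` on intervals, for `‖y‖ ≤ r`. -/
def ParamBMeasure.MDom (ν : ParamBMeasure N) (r : ℝ) (M : ℝ → ℝ) : Prop :=
  Monotone M ∧ ∀ y : Euc N, ‖y‖ ≤ r → ∀ s t : ℝ, s ≤ t → |ν y (Icc s t)| ≤ M t - M s

/-- `L` is a monotone function whose increments are Lipschitz constants of `y ↦ ν_y` on intervals,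
for `‖y‖ ≤ r`. -/
def ParamBMeasure.LDom (ν : ParamBMeasure N) (r : ℝ) (L : ℝ → ℝ) : Prop :=
  Monotone L ∧ ∀ y₁ y₂ : Euc N, ‖y₁‖ ≤ r → ‖y₂‖ ≤ r → ∀ s t : ℝ, s ≤ t →
    |ν y₁ (Icc s t) - ν y₂ (Icc s t)| ≤ (L t - L s) * ‖y₁ - y₂‖

theorem IsMBound.abs_le {ν : Euc N → BMeasure} {j : ℕ} {m : Measure ℝ} {M : ℝ → ℝ}
    (h : IsMBound ν j m) (hM : Monotone M)
    (hmM : ∀ a b : ℝ, a ≤ b → m (Icc a b) = ENNReal.ofReal (M b - M a)) {y : Euc N} (hy : ‖y‖ ≤ j)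
    {s t : ℝ} (hst : s ≤ t) : |ν y (Icc s t)| ≤ M t - M s := by
  have := ((ν y).enorm_le_variation measurableSet_Icc).trans
    (h _ (Icc_mem_boundedBorel s t) y hy)
  rw [hmM s t hst, Real.enorm_eq_ofReal_abs] at this
  exact (ENNReal.ofReal_le_ofReal_iff (sub_nonneg.2 (hM hst))).1 this

theorem IsLBound.abs_le {ν : Euc N → BMeasure} {j : ℕ} {l : Measure ℝ} {L : ℝ → ℝ}
    (h : IsLBound ν j l) (hL : Monotone L)
    (hlL : ∀ a b : ℝ, a ≤ b → l (Icc a b) = ENNReal.ofReal (L b - L a)) {y₁ y₂ : Euc N}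
    (hy₁ : ‖y₁‖ ≤ j) (hy₂ : ‖y₂‖ ≤ j) {s t : ℝ} (hst : s ≤ t) :
    |ν y₁ (Icc s t) - ν y₂ (Icc s t)| ≤ (L t - L s) * ‖y₁ - y₂‖ := by
  have h₀ := sub_nonneg.2 (hL hst)
  have := ((ν y₁ - ν y₂).enorm_le_variation measurableSet_Icc).trans
    (h _ (Icc_mem_boundedBorel s t) y₁ y₂ hy₁ hy₂)
  rw [hlL s t hst, Real.enorm_eq_ofReal_abs, ← ENNReal.ofReal_mul h₀] at this
  exact (ENNReal.ofReal_le_ofReal_iff (by positivity)).1 this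

theorem exists_nat_one_le_ge (r : ℝ) : ∃ j : ℕ, 1 ≤ j ∧ r ≤ j := by
  obtain ⟨n, hn⟩ := exists_nat_ge r
  exact ⟨n + 1, by omega, by push_cast; linarith⟩

theorem ParamBMeasure.exists_mDom (ν : ParamBMeasure N) (r : ℝ) :
    ∃ M, Continuous M ∧ ν.MDom r M := by
  obtain ⟨j, hj, hr⟩ := exists_nat_one_le_ge r
  obtain ⟨m, hm, hm'⟩ := ν.exists_mBound j hj
  obtain ⟨M, h₁, h₂, -, h₃⟩ := hm.exists_cdf
  exact ⟨M, h₂, h₁, fun y hy s t hst => hm'.abs_le h₁ h₃ (hy.trans hr) hst⟩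

theorem ParamBMeasure.exists_lDom (ν : ParamBMeasure N) (r : ℝ) :
    ∃ L, Continuous L ∧ ν.LDom r L := by
  obtain ⟨j, hj, hr⟩ := exists_nat_one_le_ge r
  obtain ⟨m, hm, hm'⟩ := ν.exists_lBound j hj
  obtain ⟨M, h₁, h₂, -, h₃⟩ := hm.exists_cdf
  exact ⟨M, h₂, h₁, fun y z hy hz s t hst => hm'.abs_le h₁ h₃ (hy.trans hr) (hz.trans hr) hst⟩

/-! ### Riemann sums -/

theorem Fin.sum_succ_sub_castSucc {k : ℕ} (F : Fin (k + 1) → ℝ) :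
    ∑ i : Fin k, (F i.succ - F i.castSucc) = F (Fin.last k) - F 0 := by
  induction k with
  | zero => simp
  | succ k ih =>
    rw [Fin.sum_univ_castSucc]
    have := ih fun i => F i.castSucc
    simp only [Fin.succ_castSucc, Fin.succ_last, Fin.castSucc_zero] at this ⊢
    rw [this]
    ring

theorem exists_uniform_partition {a b δ : ℝ} (hab : a ≤ b) (hδ : 0 < δ) :
    ∃ (k : ℕ) (t : Fin (k + 1) → ℝ), StrictMono t ∧ t 0 = a ∧ t (Fin.last k) = b ∧
      ∀ i : Fin k, t i.succ - t i.castSucc < δ := by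
  rcases hab.eq_or_lt with rfl | hab
  -- Strict monotonicity forbids repeated nodes, so the degenerate interval gets one node and no
  -- cell.
  · exact ⟨0, fun _ => a, fun i k h => (h.ne (Subsingleton.elim (α := Fin 1) i k)).elim, rfl, rfl,
      fun i => i.elim0⟩
  · obtain ⟨n, hn⟩ := exists_nat_gt ((b - a) / δ)
    have hn0 : (0 : ℝ) < n := (div_pos (sub_pos.2 hab) hδ).trans hn
    refine ⟨n, fun i => a + (i : ℕ) * ((b - a) / n), fun i k h => ?_, by simp, ?_, fun i => ?_⟩
    · have : ((i : ℕ) : ℝ) < (k : ℕ) := by exact_mod_cast h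
      have h' : 0 < (b - a) / n := div_pos (sub_pos.2 hab) hn0
      simp only
      gcongr
    · simp only [Fin.val_last]
      field_simp
      ring
    · simp only [Fin.val_succ, Fin.val_castSucc]
      push_cast
      rw [div_lt_iff₀ hδ] at hn
      have : (b - a) / n < δ := by rwa [div_lt_iff₀ hn0, mul_comm]
      linarith

/-- Comparison of two integrals by comparison of the terms of the Riemann sums. -/
theorem HasCurveIntegral.abs_sub_le {ν μ : ParamBMeasure N} {y z : ℝ → Euc N} {a b A B : ℝ}
    {F : ℝ → ℝ} (hab : a ≤ b) (hA : HasCurveIntegral ν y a b A) (hB : HasCurveIntegral μ z a b B)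
    (h : ∀ s t τ : ℝ, a ≤ s → s ≤ τ → τ ≤ t → t ≤ b →
      |ν (y τ) (Icc s t) - μ (z τ) (Icc s t)| ≤ F t - F s) : |A - B| ≤ F b - F a := by
  refine le_of_forall_pos_lt_add fun ε hε => ?_
  obtain ⟨δ₁, hδ₁, h₁⟩ := hA (ε / 2) (half_pos hε)
  obtain ⟨δ₂, hδ₂, h₂⟩ := hB (ε / 2) (half_pos hε)
  obtain ⟨k, t, ht, ht₀, ht₁, hδ⟩ := exists_uniform_partition hab (lt_min hδ₁ hδ₂)
  have hle : ∀ i : Fin k, t i.castSucc ≤ t i.succ := fun i => ht.monotone i.castSucc_le_succ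
  have e₁ := h₁ k t (fun i => t i.castSucc) ht ht₀ ht₁ (fun i => left_mem_Icc.2 (hle i))
    fun i => (hδ i).trans_le (min_le_left _ _)
  have e₂ := h₂ k t (fun i => t i.castSucc) ht ht₀ ht₁ (fun i => left_mem_Icc.2 (hle i))
    fun i => (hδ i).trans_le (min_le_right _ _)
  have e₃ : |∑ i : Fin k, ν (y (t i.castSucc)) (Icc (t i.castSucc) (t i.succ)) -
      ∑ i : Fin k, μ (z (t i.castSucc)) (Icc (t i.castSucc) (t i.succ))| ≤ F b - F a := by
    rw [← ht₀, ← ht₁, ← Fin.sum_succ_sub_castSucc (fun i => F (t i)), ← Finset.sum_sub_distrib]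
    refine (Finset.abs_sum_le_sum_abs _ _).trans (Finset.sum_le_sum fun i _ => ?_)
    exact h _ _ _ (ht₀ ▸ ht.monotone (Fin.zero_le _)) le_rfl (hle i) (ht₁ ▸ ht.monotone (Fin.le_last _))
  rw [abs_lt] at *
  rw [abs_le] at e₃
  constructor <;> linarith

theorem HasCurveIntegral.unique {ν : ParamBMeasure N} {y : ℝ → Euc N} {a b A B : ℝ} (hab : a ≤ b)
    (hA : HasCurveIntegral ν y a b A) (hB : HasCurveIntegral ν y a b B) : A = B := by
  have := hA.abs_sub_le (F := fun _ => 0) hab hB (by simp)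
  simpa [sub_eq_zero] using this

theorem HasCurveIntegral.sub {ν μ : ParamBMeasure N} {y : ℝ → Euc N} {a b A B : ℝ}
    (hA : HasCurveIntegral ν y a b A) (hB : HasCurveIntegral μ y a b B) :
    HasCurveIntegral (ν - μ) y a b (A - B) := by
  intro ε hε
  obtain ⟨δ₁, hδ₁, h₁⟩ := hA (ε / 2) (half_pos hε)
  obtain ⟨δ₂, hδ₂, h₂⟩ := hB (ε / 2) (half_pos hε)
  refine ⟨min δ₁ δ₂, lt_min hδ₁ hδ₂, fun k t τ ht ht₀ ht₁ hτ hδ => ?_⟩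
  have e₁ := h₁ k t τ ht ht₀ ht₁ hτ fun i => (hδ i).trans_le (min_le_left _ _)
  have e₂ := h₂ k t τ ht ht₀ ht₁ hτ fun i => (hδ i).trans_le (min_le_right _ _)
  change |A - B - ∑ i : Fin k, (ν (y (τ i)) (Icc (t i.castSucc) (t i.succ)) -
    μ (y (τ i)) (Icc (t i.castSucc) (t i.succ)))| < ε
  rw [Finset.sum_sub_distrib]
  rw [abs_lt] at *
  constructor <;> linarith

theorem HasCurveIntegral.translate {ν : ParamBMeasure N} {y : ℝ → Euc N} {a b c A : ℝ}
    (h : HasCurveIntegral ν (fun s => y (s - c)) (a + c) (b + c) A) :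
    HasCurveIntegral (ν.translate c) y a b A := by
  intro ε hε
  obtain ⟨δ, hδ, h'⟩ := h ε hε
  refine ⟨δ, hδ, fun k t τ ht ht₀ ht₁ hτ hm => ?_⟩
  have := h' k (fun i => t i + c) (fun i => τ i + c) (fun i j hij => by simpa using ht hij)
    (by rw [ht₀]) (by rw [ht₁]) (fun i => ⟨by simpa using (hτ i).1, by simpa using (hτ i).2⟩)
    (fun i => by simpa using hm i)
  simp only [add_sub_cancel_right, ← BMeasure.translate_Icc] at this
  exact this

theorem HasCurveIntegral.congr {ν : ParamBMeasure N} {y z : ℝ → Euc N} {a b A : ℝ}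
    (h : HasCurveIntegral ν y a b A) (hyz : EqOn y z (Icc a b)) : HasCurveIntegral ν z a b A := by
  intro ε hε
  obtain ⟨δ, hδ, h'⟩ := h ε hε
  refine ⟨δ, hδ, fun k t τ ht ht₀ ht₁ hτ hm => ?_⟩
  have := h' k t τ ht ht₀ ht₁ hτ hm
  have e : ∀ i, y (τ i) = z (τ i) := fun i => hyz
    ⟨(ht₀.symm.le.trans (ht.monotone (Fin.zero_le _))).trans (hτ i).1,
      (hτ i).2.trans ((ht.monotone (Fin.le_last _)).trans ht₁.le)⟩
  simpa only [e] using this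

theorem paramIntegral_eq {ν : ParamBMeasure N} {y : ℝ → Euc N} {a b A : ℝ} (hab : a ≤ b)
    (h : HasCurveIntegral ν y a b A) : paramIntegral ν y a b = A := by
  have h' : ∃ L, HasCurveIntegral ν y a b L := ⟨A, h⟩
  rw [paramIntegral, if_pos hab, riemannIntegral, dif_pos h']
  exact h'.choose_spec.unique hab h

theorem paramIntegral_symm {ν : ParamBMeasure N} {y : ℝ → Euc N} {a b : ℝ} (hab : a < b) :
    paramIntegral ν y b a = - paramIntegral ν y a b := by
  rw [paramIntegral, paramIntegral, if_neg (not_le.2 hab), if_pos hab.le]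

/-! ### Existence of the integral -/

/-- Limits along a fixed ultrafilter replace extraction of subsequences: eventually bounded
functions converge for all parameters simultaneously, without a diagonal argument. -/
theorem Ultrafilter.exists_tendsto_of_abs_le {X : Type*} (U : Ultrafilter X) {f : X → ℝ} {C : ℝ}
    (h : ∀ᶠ x in (U : Filter X), |f x| ≤ C) : ∃ l, Tendsto f U (𝓝 l) := by
  obtain ⟨l, -, hl⟩ := isCompact_Icc.ultrafilter_le_nhds (U.map f) (s := Icc (-C) C)
    (by rw [Ultrafilter.coe_map, le_principal_iff, Filter.mem_map]
        exact h.mono fun x hx => abs_le.1 hx)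
  exact ⟨l, hl⟩

/-- Splitting of an increment along a grid. -/
theorem sum_grid_sub {p : ℕ → ℝ} (hp : Monotone p) (f : ℝ → ℝ) {s : ℝ} (hs : p 0 ≤ s) (n : ℕ) :
    ∑ k ∈ Finset.range n, (f (max (p k) (min s (p (k + 1)))) - f (p k)) =
      f (min s (p n)) - f (p 0) := by
  induction n with
  | zero => simp [hs]
  | succ n ih =>
    rw [Finset.sum_range_succ, ih]
    rcases le_total s (p n) with h | h
    · have h' := h.trans (hp n.le_succ)
      rw [min_eq_left h, min_eq_left h', max_eq_left h]
      ring
    · rw [min_eq_right h, max_eq_right (le_min h (hp n.le_succ))]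
      ring

/-- `J` is the integral of the step curve equal to `y (p k)` on the `k`-th cell, and `c k` clamps a
time to that cell. The difference with `ν v` is estimated cell by cell through `LDom`. Cells that do
not meet the open interval from `s` to `t` contribute zero, so closeness to `v` is required only on
the others. -/
theorem exists_primitive_aux (ν : ParamBMeasure N) {y : ℝ → Euc N} {r : ℝ} {L : ℝ → ℝ}
    (hL : ν.LDom r L) {p : ℕ → ℝ} (hp : Monotone p) {n : ℕ}
    (hy : ∀ k < n, ‖y (p k)‖ ≤ r) :
    ∃ J : ℝ → ℝ, J (p 0) = 0 ∧ ∀ (s t : ℝ) (v : Euc N) (η : ℝ), p 0 ≤ s → s ≤ t → t ≤ p n →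
      ‖v‖ ≤ r → (∀ k < n, p k < t → s < p (k + 1) → ‖y (p k) - v‖ ≤ η) →
      |J t - J s - ν v (Icc s t)| ≤ (L t - L s) * η := by
  let c : ℕ → ℝ → ℝ := fun k s => max (p k) (min s (p (k + 1)))
  have hc : ∀ k, Monotone (c k) := fun k s t h => max_le_max le_rfl (min_le_min h le_rfl)
  refine ⟨fun t => ∑ k ∈ Finset.range n, ((ν (y (p k))).cdf (c k t) - (ν (y (p k))).cdf (p k)),
    ?_, fun s t v η hs hst ht hv hη => ?_⟩
  · refine Finset.sum_eq_zero fun k _ => ?_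
    have h₁ : p 0 ≤ p (k + 1) := hp (Nat.zero_le _)
    have h₂ : p 0 ≤ p k := hp (Nat.zero_le _)
    simp only [c, min_eq_left h₁, max_eq_left h₂, sub_self]
  · have split : ∀ f : ℝ → ℝ, f t - f s = ∑ k ∈ Finset.range n, (f (c k t) - f (c k s)) := by
      intro f
      have e₁ := sum_grid_sub hp f (hs.trans hst) n
      have e₂ := sum_grid_sub hp f hs n
      rw [min_eq_left ht] at e₁
      rw [min_eq_left (hst.trans ht)] at e₂
      calc f t - f s = (f t - f (p 0)) - (f s - f (p 0)) := by ring
        _ = _ := by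
          rw [← e₁, ← e₂, ← Finset.sum_sub_distrib]
          exact Finset.sum_congr rfl fun k _ => by simp only [c]; ring
    rw [BMeasure.Icc_eq_cdf _ hst, split (ν v).cdf, split L, Finset.sum_mul,
      ← Finset.sum_sub_distrib, ← Finset.sum_sub_distrib]
    refine (Finset.abs_sum_le_sum_abs _ _).trans (Finset.sum_le_sum fun k hk => ?_)
    have hk := Finset.mem_range.1 hk
    have hle := hc k hst
    have e := hL.2 (y (p k)) v (hy k hk) hv _ _ hle
    rw [BMeasure.Icc_eq_cdf _ hle, BMeasure.Icc_eq_cdf _ hle] at e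
    have e' : |(ν (y (p k))).cdf (c k t) - (ν (y (p k))).cdf (p k) -
        ((ν (y (p k))).cdf (c k s) - (ν (y (p k))).cdf (p k)) -
        ((ν v).cdf (c k t) - (ν v).cdf (c k s))| ≤
        (L (c k t) - L (c k s)) * ‖y (p k) - v‖ := by
      convert e using 2
      ring
    refine e'.trans ?_
    by_cases h : p k < t ∧ s < p (k + 1)
    · exact mul_le_mul_of_nonneg_left (hη k hk h.1 h.2) (sub_nonneg.2 (hL.1 hle))
    · have : c k t = c k s := by
        have hkk := hp k.le_succ
        simp only [c]
        by_cases h₁ : p k < t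
        · have h₂ : p (k + 1) ≤ s := not_lt.1 fun h₂ => h ⟨h₁, h₂⟩
          rw [min_eq_right h₂, min_eq_right (h₂.trans hst)]
        · have h₁ := not_lt.1 h₁
          rw [max_eq_left ((min_le_left _ _).trans h₁),
            max_eq_left ((min_le_left _ _).trans (hst.trans h₁))]
      rw [this]
      simp

/-- The primitives `J n` of step curves on uniform grids are bounded at each time; `J'` is their
limit along a nonprincipal ultrafilter. It inherits the estimate that `J' t - J' s` differs from `ν
(y τ) (Icc s t)` by at most the increment of `L` times the oscillation of `y`. Summed over a fine
tagged partition, this says that the Riemann sums converge to the increment of `J'`, and all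
subintervals are served by one function. -/
theorem exists_primitive (ν : ParamBMeasure N) {y : ℝ → Euc N} {a b : ℝ} (hab : a ≤ b)
    (hy : ContinuousOn y (Icc a b)) :
    ∃ J : ℝ → ℝ, ∀ s t, a ≤ s → s ≤ t → t ≤ b → HasCurveIntegral ν y s t (J t - J s) := by
  obtain ⟨r, hr⟩ := isCompact_Icc.exists_bound_of_continuousOn hy
  obtain ⟨L, -, hL⟩ := ν.exists_lDom r
  have huc := isCompact_Icc.uniformContinuousOn_of_continuous hy
  rw [Metric.uniformContinuousOn_iff] at huc
  let p : ℕ → ℕ → ℝ := fun n k => a + k * ((b - a) / (n + 1 : ℕ))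
  have hba : ∀ n : ℕ, 0 ≤ (b - a) / (n + 1 : ℕ) := fun n =>
    div_nonneg (sub_nonneg.2 hab) (Nat.cast_nonneg _)
  have hp : ∀ n, Monotone (p n) := fun n i k hik => by
    have h₁ : (i : ℝ) ≤ k := by exact_mod_cast hik
    exact add_le_add le_rfl (mul_le_mul_of_nonneg_right h₁ (hba n))
  have hp₀ : ∀ n, p n 0 = a := fun n => by simp [p]
  have hp₁ : ∀ n, p n (n + 1) = b := fun n => by
    simp only [p]
    field_simp
    ring
  have hpmem : ∀ n, ∀ k < n + 1, p n k ∈ Icc a b := fun n k hk =>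
    ⟨hp₀ n ▸ hp n (Nat.zero_le _), hp₁ n ▸ hp n hk.le⟩
  choose J hJ₀ hJ using fun n => exists_primitive_aux ν hL (hp n) (n := n + 1)
    (fun k hk => hr _ (hpmem n k hk))
  simp only [hp₀, hp₁] at hJ hJ₀
  let U := hyperfilter ℕ
  have hlim : ∀ t : ℝ, ∃ l, t ∈ Icc a b → Tendsto (fun n => J n t) U (𝓝 l) := by
    intro t
    by_cases ht : t ∈ Icc a b
    · obtain ⟨l, hl⟩ := U.exists_tendsto_of_abs_le (f := fun n => J n t)
        (C := |ν (y a) (Icc a t)| + (L t - L a) * (r + r)) (Eventually.of_forall fun n => by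
          have := hJ n a t (y a) (r + r) le_rfl ht.1 ht.2 (hr a (left_mem_Icc.2 hab))
            fun k hk _ _ => (norm_sub_le _ _).trans
              (add_le_add (hr _ (hpmem n k hk)) (hr a (left_mem_Icc.2 hab)))
          rw [hJ₀, sub_zero] at this
          have h' := abs_sub_abs_le_abs_sub (J n t) (ν (y a) (Icc a t))
          linarith)
      exact ⟨l, fun _ => hl⟩
    · exact ⟨0, fun h => (ht h).elim⟩
  choose J' hJ' using hlim
  have key : ∀ s t τ η : ℝ, a ≤ s → s ≤ t → t ≤ b → τ ∈ Icc a b →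
      (∀ x ∈ Icc s t, ‖y x - y τ‖ ≤ η) →
      |J' t - J' s - ν (y τ) (Icc s t)| ≤ (L t - L s) * η := by
    intro s t τ η hs hst ht hτ hη
    have hL0 := sub_nonneg.2 (hL.1 hst)
    refine le_of_forall_pos_le_add fun ε hε => ?_
    -- The summand `1` keeps the divisor positive when `L` is constant between `s` and `t`.
    have hL1 : 0 < L t - L s + 1 := by linarith
    obtain ⟨δ, hδ, hδ'⟩ := huc (ε / (L t - L s + 1)) (div_pos hε hL1)
    have l₁ := ((hJ' t ⟨hs.trans hst, ht⟩).sub (hJ' s ⟨hs, hst.trans ht⟩)).sub_const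
      (ν (y τ) (Icc s t))
    refine le_of_tendsto l₁.abs ?_
    have hev : ∀ᶠ n : ℕ in atTop, (b - a) / (n + 1 : ℕ) < δ := by
      have : Tendsto (fun n : ℕ => (b - a) / (n + 1 : ℕ)) atTop (𝓝 0) :=
        (tendsto_const_div_atTop_nhds_zero_nat (b - a)).comp (tendsto_add_atTop_nat 1)
      exact this.eventually (gt_mem_nhds hδ)
    filter_upwards [Nat.hyperfilter_le_atTop hev] with n hn
    refine (hJ n s t (y τ) (η + ε / (L t - L s + 1)) hs hst ht (hr τ hτ)
      fun k hk h₁ h₂ => ?_).trans ?_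
    · have hstep : p n (k + 1) = p n k + (b - a) / (n + 1 : ℕ) := by
        simp only [p]
        push_cast
        ring
      -- A cell may begin to the left of `s`, where `hη` gives no information; its node is compared
      -- with the nearest point of `Icc s t`, at a distance below the mesh.
      have hmax : max s (p n k) ∈ Icc s t := ⟨le_max_left _ _, max_le hst h₁.le⟩
      have d : dist (p n k) (max s (p n k)) < δ := by
        rw [dist_comm, Real.dist_eq, abs_lt]
        have := hba n
        constructor
        · linarith [le_max_right s (p n k)]
        · rcases max_choice s (p n k) with h | h <;> rw [h] <;> linarith
      have := hδ' _ (hpmem n k hk) _ ⟨hs.trans hmax.1, hmax.2.trans ht⟩ d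
      rw [dist_eq_norm] at this
      have h₃ := norm_add_le (y (p n k) - y (max s (p n k))) (y (max s (p n k)) - y τ)
      rw [sub_add_sub_cancel] at h₃
      linarith [hη _ hmax]
    · rw [mul_add]
      gcongr
      rw [mul_div_assoc', div_le_iff₀ hL1]
      nlinarith
  refine ⟨J', fun s t hs hst ht ε hε => ?_⟩
  have hL1 : 0 < L t - L s + 1 := by linarith [sub_nonneg.2 (hL.1 hst)]
  obtain ⟨δ, hδ, hδ'⟩ := huc (ε / (L t - L s + 1)) (div_pos hε hL1)
  refine ⟨δ, hδ, fun k q τ hq hq₀ hq₁ hτ hm => ?_⟩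
  have hle : ∀ i : Fin k, q i.castSucc ≤ q i.succ := fun i => hq.monotone i.castSucc_le_succ
  have h₁ : ∀ i, s ≤ q i := fun i => hq₀ ▸ hq.monotone (Fin.zero_le _)
  have h₂ : ∀ i, q i ≤ t := fun i => hq₁ ▸ hq.monotone (Fin.le_last _)
  rw [← hq₀, ← hq₁, ← Fin.sum_succ_sub_castSucc (fun i => J' (q i)), ← Finset.sum_sub_distrib]
  calc _ ≤ ∑ i : Fin k, (L (q i.succ) - L (q i.castSucc)) * (ε / (L t - L s + 1)) := by
        refine (Finset.abs_sum_le_sum_abs _ _).trans (Finset.sum_le_sum fun i _ => ?_)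
        have ha := hs.trans (h₁ i.castSucc)
        have hb := (h₂ i.succ).trans ht
        refine key _ _ _ _ ha (hle i) hb ⟨ha.trans (hτ i).1, (hτ i).2.trans hb⟩ fun x hx => ?_
        rw [← dist_eq_norm]
        refine (hδ' _ ⟨ha.trans hx.1, hx.2.trans hb⟩ _ ⟨ha.trans (hτ i).1, (hτ i).2.trans hb⟩ ?_).le
        rw [Real.dist_eq, abs_lt]
        constructor <;> linarith [hx.1, hx.2, (hτ i).1, (hτ i).2, hm i]
    _ = (L t - L s) * (ε / (L t - L s + 1)) := by
        rw [← Finset.sum_mul, Fin.sum_succ_sub_castSucc (fun i => L (q i)), hq₀, hq₁]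
    _ < ε := by
        rw [mul_div_assoc', div_lt_iff₀ hL1]
        nlinarith

/-! ### Properties of the integral -/

theorem hasCurveIntegral_paramIntegral (ν : ParamBMeasure N) {y : ℝ → Euc N} {a b : ℝ}
    (hab : a ≤ b) (hy : ContinuousOn y (Icc a b)) :
    HasCurveIntegral ν y a b (paramIntegral ν y a b) := by
  obtain ⟨J, hJ⟩ := exists_primitive ν hab hy
  have := hJ a b le_rfl hab le_rfl
  rwa [paramIntegral_eq hab this]

theorem paramIntegral_eq_primitive (ν : ParamBMeasure N) {y : ℝ → Euc N} {a b : ℝ}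
    (hy : ContinuousOn y (Icc a b)) :
    ∃ J : ℝ → ℝ, ∀ s ∈ Icc a b, ∀ t ∈ Icc a b, paramIntegral ν y s t = J t - J s := by
  by_cases hab : a ≤ b
  · obtain ⟨J, hJ⟩ := exists_primitive ν hab hy
    refine ⟨J, fun s hs t ht => ?_⟩
    rcases le_or_gt s t with h | h
    · exact paramIntegral_eq h (hJ s t hs.1 h ht.2)
    · rw [paramIntegral_symm h, paramIntegral_eq h.le (hJ t s ht.1 h.le hs.2), neg_sub]
  · exact ⟨0, fun s hs => (hab (hs.1.trans hs.2)).elim⟩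

theorem paramIntegral_add (ν : ParamBMeasure N) {y : ℝ → Euc N} {a b s t u : ℝ}
    (hy : ContinuousOn y (Icc a b)) (hs : s ∈ Icc a b) (ht : t ∈ Icc a b) (hu : u ∈ Icc a b) :
    paramIntegral ν y s t + paramIntegral ν y t u = paramIntegral ν y s u := by
  obtain ⟨J, hJ⟩ := paramIntegral_eq_primitive ν hy
  rw [hJ s hs t ht, hJ t ht u hu, hJ s hs u hu]
  ring

theorem paramIntegral_self (ν : ParamBMeasure N) (y : ℝ → Euc N) (s : ℝ) :
    paramIntegral ν y s s = 0 := by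
  obtain ⟨J, hJ⟩ := paramIntegral_eq_primitive ν (y := y) (a := s) (b := s) (by simp)
  simpa using hJ s (by simp) s (by simp)

theorem paramIntegral_swap (ν : ParamBMeasure N) (y : ℝ → Euc N) (s t : ℝ) :
    paramIntegral ν y t s = - paramIntegral ν y s t := by
  rcases lt_trichotomy s t with h | rfl | h
  · exact paramIntegral_symm h
  · rw [paramIntegral_self, neg_zero]
  · rw [paramIntegral_symm h, neg_neg]

/-- To prove a property of oriented integrals it suffices to consider `s ≤ t`. -/
theorem uIcc_wlog {p : ℝ → ℝ → Prop} (hsymm : ∀ s t, p s t → p t s) (h : ∀ s t, s ≤ t → p s t)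
    (s t : ℝ) : p s t := by
  rcases le_total s t with hst | hst
  · exact h s t hst
  · exact hsymm _ _ (h t s hst)

theorem paramIntegral_sub (ν μ : ParamBMeasure N) {y : ℝ → Euc N} {s t : ℝ}
    (hy : ContinuousOn y (uIcc s t)) :
    paramIntegral (ν - μ) y s t = paramIntegral ν y s t - paramIntegral μ y s t := by
  revert hy
  refine uIcc_wlog (p := fun s t => ContinuousOn y (uIcc s t) →
    paramIntegral (ν - μ) y s t = paramIntegral ν y s t - paramIntegral μ y s t)
    (fun s t h hy => ?_) (fun s t hst hy => ?_) s t
  · rw [uIcc_comm] at hy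
    rw [paramIntegral_swap _ _ s t, paramIntegral_swap ν _ s t, paramIntegral_swap μ _ s t, h hy]
    ring
  · rw [uIcc_of_le hst] at hy
    exact paramIntegral_eq hst ((hasCurveIntegral_paramIntegral ν hst hy).sub
      (hasCurveIntegral_paramIntegral μ hst hy))

theorem paramIntegral_congr (ν : ParamBMeasure N) {y z : ℝ → Euc N} {s t : ℝ}
    (hy : ContinuousOn y (uIcc s t)) (hyz : EqOn y z (uIcc s t)) :
    paramIntegral ν y s t = paramIntegral ν z s t := by
  revert hy hyz
  refine uIcc_wlog (p := fun s t => ContinuousOn y (uIcc s t) → EqOn y z (uIcc s t) →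
    paramIntegral ν y s t = paramIntegral ν z s t)
    (fun s t h hy hyz => ?_) (fun s t hst hy hyz => ?_) s t
  · rw [uIcc_comm] at hy hyz
    rw [paramIntegral_swap _ _ s t, paramIntegral_swap ν _ s t, h hy hyz]
  · rw [uIcc_of_le hst] at hy hyz
    exact (paramIntegral_eq hst ((hasCurveIntegral_paramIntegral ν hst hy).congr hyz)).symm

theorem paramIntegral_translate (ν : ParamBMeasure N) {y : ℝ → Euc N} {s t : ℝ} (c : ℝ)
    (hy : ContinuousOn y (uIcc s t)) :
    paramIntegral (ν.translate c) y s t =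
      paramIntegral ν (fun x => y (x - c)) (s + c) (t + c) := by
  revert hy
  refine uIcc_wlog (p := fun s t => ContinuousOn y (uIcc s t) →
    paramIntegral (ν.translate c) y s t =
      paramIntegral ν (fun x => y (x - c)) (s + c) (t + c))
    (fun s t h hy => ?_) (fun s t hst hy => ?_) s t
  · rw [uIcc_comm] at hy
    rw [paramIntegral_swap _ _ s t, paramIntegral_swap ν _ (s + c), h hy]
  · rw [uIcc_of_le hst] at hy
    refine paramIntegral_eq hst (HasCurveIntegral.translate
      (hasCurveIntegral_paramIntegral ν (by linarith) ?_))
    exact hy.comp (by fun_prop) fun x hx => ⟨by linarith [hx.1], by linarith [hx.2]⟩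

theorem ParamBMeasure.sub_Icc (ν μ : ParamBMeasure N) (y : Euc N) (A : Set ℝ) :
    (ν - μ) y A = ν y A - μ y A := rfl

theorem ParamBMeasure.MDom.abs_paramIntegral_le {ν : ParamBMeasure N} {r : ℝ} {M : ℝ → ℝ}
    (hM : ν.MDom r M) {y : ℝ → Euc N} {s t : ℝ} (hy : ContinuousOn y (uIcc s t))
    (hr : ∀ x ∈ uIcc s t, ‖y x‖ ≤ r) : |paramIntegral ν y s t| ≤ |M t - M s| := by
  revert hy hr
  refine uIcc_wlog (p := fun s t => ContinuousOn y (uIcc s t) → (∀ x ∈ uIcc s t, ‖y x‖ ≤ r) →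
    |paramIntegral ν y s t| ≤ |M t - M s|)
    (fun s t h hy hr => ?_) (fun s t hst hy hr => ?_) s t
  · rw [uIcc_comm] at hy hr
    rw [paramIntegral_swap _ _ s t, abs_neg, abs_sub_comm]
    exact h hy hr
  · rw [uIcc_of_le hst] at hy hr
    have h := hasCurveIntegral_paramIntegral ν hst hy
    -- `ν - ν` plays the role of the zero parametric b-measure, so that the comparison lemma for two
    -- integrals applies.
    have h₀ := h.sub h
    rw [sub_self] at h₀
    rw [abs_of_nonneg (sub_nonneg.2 (hM.1 hst))]
    have := h.abs_sub_le (F := M) hst h₀ fun u v τ hu h₁ h₂ hv => by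
      rw [ParamBMeasure.sub_Icc, sub_self, sub_zero]
      exact hM.2 _ (hr τ ⟨hu.trans h₁, h₂.trans hv⟩) _ _ (h₁.trans h₂)
    rwa [sub_zero] at this

theorem ParamBMeasure.LDom.abs_paramIntegral_sub_le {ν : ParamBMeasure N} {r : ℝ} {L : ℝ → ℝ}
    (hL : ν.LDom r L) {y z : ℝ → Euc N} {s t η : ℝ} (hy : ContinuousOn y (uIcc s t))
    (hz : ContinuousOn z (uIcc s t)) (hyr : ∀ x ∈ uIcc s t, ‖y x‖ ≤ r)
    (hzr : ∀ x ∈ uIcc s t, ‖z x‖ ≤ r) (hη : ∀ x ∈ uIcc s t, ‖y x - z x‖ ≤ η) :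
    |paramIntegral ν y s t - paramIntegral ν z s t| ≤ |L t - L s| * η := by
  revert hy hz hyr hzr hη
  refine uIcc_wlog (p := fun s t => ContinuousOn y (uIcc s t) → ContinuousOn z (uIcc s t) →
    (∀ x ∈ uIcc s t, ‖y x‖ ≤ r) → (∀ x ∈ uIcc s t, ‖z x‖ ≤ r) →
    (∀ x ∈ uIcc s t, ‖y x - z x‖ ≤ η) →
    |paramIntegral ν y s t - paramIntegral ν z s t| ≤ |L t - L s| * η)
    (fun s t h hy hz hyr hzr hη => ?_) (fun s t hst hy hz hyr hzr hη => ?_) s t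
  · rw [uIcc_comm] at hy hz hyr hzr hη
    rw [paramIntegral_swap _ y s t, paramIntegral_swap _ z s t, abs_sub_comm (L s), neg_sub_neg,
      abs_sub_comm]
    exact h hy hz hyr hzr hη
  · rw [uIcc_of_le hst] at hy hz hyr hzr hη
    rw [abs_of_nonneg (sub_nonneg.2 (hL.1 hst)), sub_mul]
    refine (hasCurveIntegral_paramIntegral ν hst hy).abs_sub_le (F := fun x => L x * η) hst
      (hasCurveIntegral_paramIntegral ν hst hz) fun u v τ hu h₁ h₂ hv => ?_
    have hτ : τ ∈ Icc s t := ⟨hu.trans h₁, h₂.trans hv⟩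
    refine (hL.2 _ _ (hyr τ hτ) (hzr τ hτ) _ _ (h₁.trans h₂)).trans ?_
    rw [← sub_mul]
    exact mul_le_mul_of_nonneg_left (hη τ hτ) (sub_nonneg.2 (hL.1 (h₁.trans h₂)))

theorem paramIntegral_const (ν : ParamBMeasure N) (v : Euc N) {s t : ℝ} (hst : s ≤ t) :
    paramIntegral ν (fun _ => v) s t = ν v (Icc s t) := by
  refine paramIntegral_eq hst fun ε hε => ⟨1, one_pos, fun k q τ hq hq₀ hq₁ hτ hm => ?_⟩
  have : ∑ i : Fin k, ν v (Icc (q i.castSucc) (q i.succ)) = ν v (Icc s t) := by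
    rw [BMeasure.Icc_eq_cdf _ hst, ← hq₀, ← hq₁,
      ← Fin.sum_succ_sub_castSucc fun i => (ν v).cdf (q i)]
    exact Finset.sum_congr rfl fun i _ =>
      BMeasure.Icc_eq_cdf _ (hq.monotone i.castSucc_le_succ)
  rw [this, sub_self, abs_zero]
  exact hε

/-! ### The Euclidean norm -/

theorem Euc.abs_apply_le (v : Euc N) (i : Fin N) : |v i| ≤ ‖v‖ := PiLp.norm_apply_le v i

theorem Euc.norm_le_sqrt_mul {v : Euc N} {c : ℝ} (hc : 0 ≤ c) (h : ∀ i, |v i| ≤ c) :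
    ‖v‖ ≤ √N * c := by
  rw [EuclideanSpace.norm_eq]
  calc √(∑ i, ‖v i‖ ^ 2) ≤ √(∑ _i : Fin N, c ^ 2) :=
        Real.sqrt_le_sqrt (Finset.sum_le_sum fun i _ => pow_le_pow_left₀ (norm_nonneg _) (h i) 2)
    _ = √N * c := by simp [Real.sqrt_sq hc]

/-- The coordinatewise retraction onto the cube `[-R, R]^N`. -/
noncomputable def Euc.clamp (R : ℝ) (v : Euc N) : Euc N :=
  WithLp.toLp 2 fun i => max (-R) (min (v i) R)

theorem Euc.clamp_apply (R : ℝ) (v : Euc N) (i : Fin N) :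
    Euc.clamp R v i = max (-R) (min (v i) R) := rfl

/-- Clamping is 1-Lipschitz for the Euclidean norm because it is so in each coordinate. The price of
working coordinatewise is that the values lie in the ball of radius `√N * R` instead of `R`. -/
theorem Euc.norm_clamp_sub_le (R : ℝ) (v w : Euc N) :
    ‖Euc.clamp R v - Euc.clamp R w‖ ≤ ‖v - w‖ := by
  rw [EuclideanSpace.norm_eq, EuclideanSpace.norm_eq]
  refine Real.sqrt_le_sqrt (Finset.sum_le_sum fun i _ => ?_)
  refine pow_le_pow_left₀ (norm_nonneg _) ?_ 2
  rw [PiLp.sub_apply, PiLp.sub_apply, Euc.clamp_apply, Euc.clamp_apply, Real.norm_eq_abs,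
    Real.norm_eq_abs]
  refine (abs_max_sub_max_le_max _ _ _ _).trans ?_
  rw [sub_self, abs_zero]
  refine max_le (abs_nonneg _) ((abs_min_sub_min_le_max _ _ _ _).trans ?_)
  simp

theorem Euc.continuous_clamp (R : ℝ) : Continuous (Euc.clamp (N := N) R) :=
  (LipschitzWith.of_dist_le_mul (K := 1) fun v w => by
    simpa [dist_eq_norm] using Euc.norm_clamp_sub_le R v w).continuous

theorem Euc.norm_clamp_le {R : ℝ} (hR : 0 ≤ R) (v : Euc N) : ‖Euc.clamp R v‖ ≤ √N * R := by
  refine Euc.norm_le_sqrt_mul hR fun i => ?_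
  rw [Euc.clamp_apply, abs_le]
  exact ⟨le_max_left _ _, max_le (by linarith) (min_le_right _ _)⟩

theorem Euc.clamp_eq_self {R : ℝ} {v : Euc N} (h : ‖v‖ ≤ R) : Euc.clamp R v = v := by
  ext i
  have := abs_le.1 ((Euc.abs_apply_le v i).trans h)
  rw [Euc.clamp_apply, min_eq_left this.2, max_eq_right this.1]

/-! ### Generalized differential equations -/

theorem VecParamBMeasure.exists_lDom (ν : VecParamBMeasure N) (r : ℝ) :
    ∃ L, Continuous L ∧ Monotone L ∧ ∀ i, (ν i).LDom r L := by
  choose L hc hL using fun i => (ν i).exists_lDom r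
  have hmono : Monotone fun t => ∑ i, L i t := fun s t hst =>
    Finset.sum_le_sum fun i _ => (hL i).1 hst
  refine ⟨fun t => ∑ i, L i t, by fun_prop, hmono,
    fun i => ⟨hmono, fun y z hy hz s t hst => ?_⟩⟩
  refine ((hL i).2 y z hy hz s t hst).trans (mul_le_mul_of_nonneg_right ?_ (norm_nonneg _))
  rw [← Finset.sum_sub_distrib]
  exact Finset.single_le_sum (f := fun i => L i t - L i s)
    (fun k _ => sub_nonneg.2 ((hL k).1 hst)) (Finset.mem_univ i)

/-- `y` solves `y' = ν_{r(y(t))}` on `[a, b]`. -/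
def SolvesOn (ν : VecParamBMeasure N) (r : Euc N → Euc N) (y : ℝ → Euc N) (a b : ℝ) : Prop :=
  ContinuousOn y (Icc a b) ∧ ∀ s ∈ Icc a b, ∀ t ∈ Icc a b, ∀ i,
    y t i - y s i = paramIntegral (ν i) (r ∘ y) s t

/-- `SolvesOn` singles out no initial time, which makes restriction, gluing and translation formal.
Additivity of the integral recovers this form from the equation based at one point. -/
theorem SolvesOn.of_base {ν : VecParamBMeasure N} {r : Euc N → Euc N} (hr : Continuous r)
    {y : ℝ → Euc N} {a b c : ℝ} (hy : ContinuousOn y (Icc a b)) (hc : c ∈ Icc a b)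
    (h : ∀ t ∈ Icc a b, ∀ i, y t i = y c i + paramIntegral (ν i) (r ∘ y) c t) :
    SolvesOn ν r y a b := by
  refine ⟨hy, fun s hs t ht i => ?_⟩
  rw [h t ht i, h s hs i, ← paramIntegral_add (ν i) (hr.comp_continuousOn hy) hc hs ht]
  ring

theorem SolvesOn.mono {ν : VecParamBMeasure N} {r : Euc N → Euc N} {y : ℝ → Euc N}
    {a b a' b' : ℝ} (h : SolvesOn ν r y a b) (ha : a ≤ a') (hb : b' ≤ b) :
    SolvesOn ν r y a' b' :=
  have hsub := Icc_subset_Icc ha hb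
  ⟨h.1.mono hsub, fun s hs t ht => h.2 s (hsub hs) t (hsub ht)⟩

theorem SolvesOn.congr {ν : VecParamBMeasure N} {r r' : Euc N → Euc N} (hr : Continuous r)
    {y z : ℝ → Euc N} {a b : ℝ} (h : SolvesOn ν r y a b) (hyz : EqOn y z (Icc a b))
    (hrr : ∀ t ∈ Icc a b, r (y t) = r' (y t)) : SolvesOn ν r' z a b := by
  refine ⟨h.1.congr hyz.symm, fun s hs t ht i => ?_⟩
  rw [← hyz hs, ← hyz ht, h.2 s hs t ht i]
  have hsub : uIcc s t ⊆ Icc a b := uIcc_subset_Icc hs ht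
  exact paramIntegral_congr _ (hr.comp_continuousOn (h.1.mono hsub)) fun x hx => by
    rw [Function.comp_apply, Function.comp_apply, ← hyz (hsub hx), hrr x (hsub hx)]

theorem SolvesOn.union {ν : VecParamBMeasure N} {r : Euc N → Euc N} (hr : Continuous r)
    {y : ℝ → Euc N} {a b c : ℝ} (hac : a ≤ c) (hcb : c ≤ b) (h₁ : SolvesOn ν r y a c)
    (h₂ : SolvesOn ν r y c b) : SolvesOn ν r y a b := by
  have hy : ContinuousOn y (Icc a b) := by
    rw [← Icc_union_Icc_eq_Icc hac hcb]
    exact h₁.1.union_of_isClosed h₂.1 isClosed_Icc isClosed_Icc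
  refine SolvesOn.of_base hr hy ⟨hac, hcb⟩ fun t ht i => ?_
  rcases le_total t c with h | h
  · rw [← h₁.2 c ⟨hac, le_rfl⟩ t ⟨ht.1, h⟩ i]
    ring
  · rw [← h₂.2 c ⟨le_rfl, hcb⟩ t ⟨h, ht.2⟩ i]
    ring

open Classical in
theorem SolvesOn.glue {ν : VecParamBMeasure N} {r : Euc N → Euc N} (hr : Continuous r)
    {y z : ℝ → Euc N} {a b c : ℝ} (hac : a ≤ c) (hcb : c ≤ b) (h₁ : SolvesOn ν r y a c)
    (h₂ : SolvesOn ν r z c b) (hyz : y c = z c) :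
    ∃ w, SolvesOn ν r w a b ∧ EqOn y w (Icc a c) ∧ EqOn z w (Icc c b) := by
  have e₁ : EqOn y (fun t => if t ≤ c then y t else z t) (Icc a c) := fun t ht => by
    simp [ht.2]
  have e₂ : EqOn z (fun t => if t ≤ c then y t else z t) (Icc c b) := fun t ht => by
    rcases ht.1.eq_or_lt with rfl | h
    · simp [hyz]
    · simp [not_le.2 h]
  exact ⟨_, (h₁.congr hr e₁ fun _ _ => rfl).union hr hac hcb (h₂.congr hr e₂ fun _ _ => rfl), e₁, e₂⟩

theorem isSolution_iff {ν : VecParamBMeasure N} {t₀ : ℝ} {y₀ : Euc N} {a b : ℝ} {y : ℝ → Euc N} :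
    IsSolution ν t₀ y₀ a b y ↔ t₀ ∈ Icc a b ∧ SolvesOn ν id y a b ∧ y t₀ = y₀ := by
  constructor
  · rintro ⟨h₁, h₂, h₃⟩
    have h₀ : y t₀ = y₀ := by
      ext i
      rw [h₃ t₀ h₁ i, paramIntegral_self, add_zero]
    refine ⟨h₁, SolvesOn.of_base continuous_id h₂ h₁ fun t ht i => ?_, h₀⟩
    rw [h₀]
    exact h₃ t ht i
  · rintro ⟨h₁, h₂, rfl⟩
    exact ⟨h₁, h₂.1, fun t ht i => eq_add_of_sub_eq' (h₂.2 t₀ h₁ t ht i)⟩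

/-- Induction over intervals on which a continuous monotone function has small increments. -/
theorem interval_induction {L : ℝ → ℝ} (hc : Continuous L) {p : ℝ → ℝ → Prop}
    (base : ∀ a b, a ≤ b → L b - L a ≤ 1 / 2 → p a b)
    (glue : ∀ a c b, a ≤ c → c ≤ b → p a c → p c b → p a b) {a b : ℝ} (hab : a ≤ b) : p a b := by
  have key : ∀ n : ℕ, ∀ a, a ≤ b → L b - L a ≤ (n + 1) / 2 → p a b := by
    intro n
    induction n with
    | zero => exact fun a hab h => base a b hab (by simpa using h)
    | succ n ih =>
      intro a hab h
      by_cases hs : L b - L a ≤ 1 / 2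
      · exact base a b hab hs
      -- By continuity a piece with increment exactly `1/2` can be cut off; what remains satisfies
      -- the bound for `n`.
      · obtain ⟨c, hc, hc'⟩ := intermediate_value_Icc hab hc.continuousOn
          (show L a + 1 / 2 ∈ Icc (L a) (L b) from ⟨by linarith, by linarith⟩)
        refine glue a c b hc.1 hc.2 (base a c hc.1 (by linarith)) (ih c hc.2 ?_)
        push_cast at h
        linarith
  obtain ⟨n, hn⟩ := exists_nat_ge (2 * (L b - L a))
  exact key n a hab (by linarith)

/-- A Gronwall estimate for increments dominated by a continuous monotone function. -/
theorem gronwall {E : Type*} [NormedAddCommGroup E] {L : ℝ → ℝ} (hL : Monotone L)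
    (hc : Continuous L) {a b : ℝ} (hab : a ≤ b) :
    ∃ C : ℝ, 1 ≤ C ∧ ∀ (d : ℝ → E) (ε : ℝ), 0 ≤ ε → ContinuousOn d (Icc a b) →
      (∀ s ∈ Icc a b, ∀ t ∈ Icc a b, ∀ η, (∀ x ∈ uIcc s t, ‖d x‖ ≤ η) →
        ‖d t - d s‖ ≤ ε + |L t - L s| * η) →
      ∀ s ∈ Icc a b, ∀ t ∈ Icc a b, ‖d t‖ ≤ C * (‖d s‖ + ε) := by
  refine interval_induction hc (p := fun a b => ∃ C : ℝ, 1 ≤ C ∧ ∀ (d : ℝ → E) (ε : ℝ), 0 ≤ ε →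
      ContinuousOn d (Icc a b) →
      (∀ s ∈ Icc a b, ∀ t ∈ Icc a b, ∀ η, (∀ x ∈ uIcc s t, ‖d x‖ ≤ η) →
        ‖d t - d s‖ ≤ ε + |L t - L s| * η) →
      ∀ s ∈ Icc a b, ∀ t ∈ Icc a b, ‖d t‖ ≤ C * (‖d s‖ + ε)) (fun a b hab h => ?_)
    (fun a c b hac hcb ⟨C₁, h₁, h₁'⟩ ⟨C₂, h₂, h₂'⟩ => ?_) hab
  · refine ⟨2, one_le_two, fun d ε hε hd hη s hs t ht => ?_⟩
    -- At a maximum point `x` of the norm the hypothesis reads `‖d x‖ ≤ ‖d s‖ + ε + ‖d x‖ / 2`;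
    -- absorbing the last term gives the constant `2`.
    obtain ⟨x, hx, hmax⟩ := isCompact_Icc.exists_isMaxOn ⟨s, hs⟩ hd.norm
    have e := hη s hs x hx ‖d x‖ fun z hz => hmax (uIcc_subset_Icc hs hx hz)
    have hLx : |L x - L s| ≤ 1 / 2 := by
      have := hL hx.1
      have := hL hx.2
      have := hL hs.1
      have := hL hs.2
      rw [abs_le]
      constructor <;> linarith
    have h₁ := mul_le_mul_of_nonneg_right hLx (norm_nonneg (d x))
    have h₂ := norm_sub_norm_le (d x) (d s)
    have h₃ : ‖d t‖ ≤ ‖d x‖ := hmax ht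
    linarith
  · have hsub₁ : Icc a c ⊆ Icc a b := Icc_subset_Icc_right hcb
    have hsub₂ : Icc c b ⊆ Icc a b := Icc_subset_Icc_left hac
    -- Crossing `c` costs `C' * (C * (‖d s‖ + ε) + ε)`, and the extra `ε` is at most `C * (‖d s‖ +
    -- ε)`; this accounts for the factor `2`.
    refine ⟨2 * (C₁ * C₂), by nlinarith, fun d ε hε hd hη => ?_⟩
    have k₁ := h₁' d ε hε (hd.mono hsub₁) fun s hs t ht => hη s (hsub₁ hs) t (hsub₁ ht)
    have k₂ := h₂' d ε hε (hd.mono hsub₂) fun s hs t ht => hη s (hsub₂ hs) t (hsub₂ ht)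
    have hC : C₁ ≤ C₁ * C₂ := by nlinarith
    have hC' : C₂ ≤ C₁ * C₂ := by nlinarith
    have hC₀ : 0 ≤ C₁ * C₂ := by positivity
    have hc₁ : c ∈ Icc a c := ⟨hac, le_rfl⟩
    have hc₂ : c ∈ Icc c b := ⟨le_rfl, hcb⟩
    have weak : ∀ {s t C : ℝ}, 0 ≤ C → C ≤ C₁ * C₂ → ‖d t‖ ≤ C * (‖d s‖ + ε) →
        ‖d t‖ ≤ 2 * (C₁ * C₂) * (‖d s‖ + ε) := fun {s t C} _ hC h => by
      have : 0 ≤ ‖d s‖ + ε := by positivity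
      nlinarith
    have comp : ∀ {s t C C' : ℝ}, 1 ≤ C → 1 ≤ C' → C * C' = C₁ * C₂ → ‖d c‖ ≤ C * (‖d s‖ + ε) →
        ‖d t‖ ≤ C' * (‖d c‖ + ε) → ‖d t‖ ≤ 2 * (C₁ * C₂) * (‖d s‖ + ε) :=
      fun {s t C C'} hC hC' hCC h h' => by
        have h₀ := norm_nonneg (d s)
        have h₁ : ε ≤ C * (‖d s‖ + ε) := by nlinarith
        calc ‖d t‖ ≤ C' * (C * (‖d s‖ + ε) + C * (‖d s‖ + ε)) :=
              h'.trans (mul_le_mul_of_nonneg_left (by linarith) (by linarith))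
          _ = _ := by rw [← hCC]; ring
    intro s hs t ht
    rcases le_total s c with hsc | hsc <;> rcases le_total t c with htc | htc
    · exact weak (by linarith) hC (k₁ s ⟨hs.1, hsc⟩ t ⟨ht.1, htc⟩)
    · exact comp h₁ h₂ rfl (k₁ s ⟨hs.1, hsc⟩ c hc₁) (k₂ c hc₂ t ⟨htc, ht.2⟩)
    · exact comp h₂ h₁ (mul_comm _ _) (k₂ s ⟨hsc, hs.2⟩ c hc₂) (k₁ c hc₁ t ⟨ht.1, htc⟩)
    · exact weak (by linarith) hC' (k₂ s ⟨hsc, hs.2⟩ t ⟨htc, ht.2⟩)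

/-! ### The truncated equation: existence and continuous dependence -/

theorem continuousOn_paramIntegral (ν : ParamBMeasure N) {y : ℝ → Euc N} {a b c : ℝ}
    (hy : ContinuousOn y (Icc a b)) (hc : c ∈ Icc a b) :
    ContinuousOn (fun t => paramIntegral ν y c t) (Icc a b) := by
  obtain ⟨r, hr⟩ := isCompact_Icc.exists_bound_of_continuousOn hy
  obtain ⟨M, hMc, hM⟩ := ν.exists_mDom r
  intro t ht
  rw [ContinuousWithinAt, tendsto_iff_dist_tendsto_zero]
  have h₀ : Tendsto (fun s => |M s - M t|) (𝓝[Icc a b] t) (𝓝 0) := by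
    have : Tendsto (fun s => |M s - M t|) (𝓝 t) (𝓝 |M t - M t|) :=
      ((hMc.tendsto t).sub_const _).abs
    rw [sub_self, abs_zero] at this
    exact this.mono_left nhdsWithin_le_nhds
  refine squeeze_zero' (Eventually.of_forall fun _ => dist_nonneg) ?_ h₀
  filter_upwards [self_mem_nhdsWithin] with s hs
  have hsub : uIcc t s ⊆ Icc a b := uIcc_subset_Icc ht hs
  rw [Real.dist_eq, ← paramIntegral_add ν hy hc ht hs, add_sub_cancel_left]
  exact hM.abs_paramIntegral_le (hy.mono hsub) fun x hx => hr x (hsub hx)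

/-- Existence on arbitrary compact intervals for the truncated equation. -/
theorem exists_solvesOn_clamp (ν : VecParamBMeasure N) {R : ℝ} (hR : 0 ≤ R) {a b t₀ : ℝ}
    (ht₀ : t₀ ∈ Icc a b) (y₀ : Euc N) :
    ∃ y, SolvesOn ν (Euc.clamp R) y a b ∧ y t₀ = y₀ := by
  obtain ⟨L, hLc, hLm, hL⟩ := ν.exists_lDom (√N * R)
  have hcl := Euc.continuous_clamp (N := N) R
  have hκ : 0 ≤ √(N : ℝ) := Real.sqrt_nonneg _
  -- The factor `√N` pays for passing from coordinates to the Euclidean norm, so that increments at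
  -- most `1/2` make the integral operator a contraction with constant `1/2`.
  refine interval_induction (L := fun t => √N * L t) (by fun_prop)
    (p := fun a b => ∀ t₀ ∈ Icc a b, ∀ y₀ : Euc N,
      ∃ y, SolvesOn ν (Euc.clamp R) y a b ∧ y t₀ = y₀)
    (fun a b hab h t₀ ht₀ y₀ => ?_) (fun a c b hac hcb h₁ h₂ t₀ ht₀ y₀ => ?_)
    (ht₀.1.trans ht₀.2) t₀ ht₀ y₀
  · have hext : ∀ y : C(Icc a b, Euc N), Continuous (Euc.clamp R ∘ IccExtend hab y) := fun y =>
      hcl.comp y.continuous.Icc_extend'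
    let T : C(Icc a b, Euc N) → C(Icc a b, Euc N) := fun y =>
      ⟨fun t => y₀ + WithLp.toLp 2 fun i =>
        paramIntegral (ν i) (Euc.clamp R ∘ IccExtend hab y) t₀ t, by
          refine continuous_const.add ((PiLp.continuous_toLp 2 _).comp (continuous_pi fun i => ?_))
          exact continuousOn_iff_continuous_domRestrict.1
            (continuousOn_paramIntegral (ν i) (hext y).continuousOn ht₀)⟩
    have hT : ∀ y t i, T y t i = y₀ i +
        paramIntegral (ν i) (Euc.clamp R ∘ IccExtend hab y) t₀ t := fun y t i => rfl
    have hcontr : ContractingWith (1 / 2) T := by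
      refine ⟨by norm_num, LipschitzWith.of_dist_le_mul fun y z => ?_⟩
      rw [ContinuousMap.dist_le (by positivity)]
      intro t
      have hsub : uIcc t₀ t ⊆ Icc a b := uIcc_subset_Icc ht₀ t.2
      have hLt : √N * |L t - L t₀| ≤ 1 / 2 := by
        rw [← abs_of_nonneg hκ, ← abs_mul, abs_le, mul_sub]
        have e₁ := mul_le_mul_of_nonneg_left (hLm t.2.1) hκ
        have e₂ := mul_le_mul_of_nonneg_left (hLm t.2.2) hκ
        have e₃ := mul_le_mul_of_nonneg_left (hLm ht₀.1) hκ
        have e₄ := mul_le_mul_of_nonneg_left (hLm ht₀.2) hκ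
        constructor <;> linarith
      calc dist (T y t) (T z t) = ‖T y t - T z t‖ := dist_eq_norm _ _
        _ ≤ √N * (|L t - L t₀| * dist y z) := by
          refine Euc.norm_le_sqrt_mul (by positivity) fun i => ?_
          rw [PiLp.sub_apply, hT, hT, add_sub_add_left_eq_sub]
          refine (hL i).abs_paramIntegral_sub_le (hext y).continuousOn (hext z).continuousOn
            (fun x _ => Euc.norm_clamp_le hR _) (fun x _ => Euc.norm_clamp_le hR _) fun x _ => ?_
          refine (Euc.norm_clamp_sub_le R _ _).trans ?_
          rw [← dist_eq_norm]
          exact ContinuousMap.dist_apply_le_dist (projIcc a b hab x)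
        _ ≤ _ := by
          rw [← mul_assoc]
          refine mul_le_mul_of_nonneg_right (hLt.trans ?_) dist_nonneg
          simp
    let y := ContractingWith.fixedPoint T hcontr
    have hy : T y = y := hcontr.fixedPoint_isFixedPt
    have hval : ∀ (t : ℝ) (ht : t ∈ Icc a b), IccExtend hab y t = y ⟨t, ht⟩ := fun t ht =>
      IccExtend_of_mem hab y ht
    have hval' : ∀ t ∈ Icc a b, ∀ i, IccExtend hab y t i = y₀ i +
        paramIntegral (ν i) (Euc.clamp R ∘ IccExtend hab y) t₀ t := fun t ht i => by
      rw [hval t ht, ← hT y ⟨t, ht⟩ i, hy]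
    have h₀ : IccExtend hab y t₀ = y₀ := by
      ext i
      rw [hval' t₀ ht₀ i, paramIntegral_self, add_zero]
    refine ⟨IccExtend hab y, SolvesOn.of_base hcl (y.continuous.Icc_extend').continuousOn ht₀ ?_, h₀⟩
    rw [h₀]
    exact hval'
  · rcases le_total t₀ c with h | h
    · obtain ⟨y, hy, hy₀⟩ := h₁ t₀ ⟨ht₀.1, h⟩ y₀
      obtain ⟨z, hz, hz₀⟩ := h₂ c ⟨le_rfl, hcb⟩ (y c)
      obtain ⟨w, hw, e, -⟩ := hy.glue hcl hac hcb hz hz₀.symm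
      exact ⟨w, hw, by rw [← e ⟨ht₀.1, h⟩, hy₀]⟩
    · obtain ⟨z, hz, hz₀⟩ := h₂ t₀ ⟨h, ht₀.2⟩ y₀
      obtain ⟨y, hy, hy₀⟩ := h₁ c ⟨hac, le_rfl⟩ (z c)
      obtain ⟨w, hw, -, e⟩ := hy.glue hcl hac hcb hz hy₀
      exact ⟨w, hw, by rw [← e ⟨h, ht₀.2⟩, hz₀]⟩

/-- Continuous dependence for the truncated equation, in the form of an estimate. -/
theorem exists_clamp_estimate (ν : VecParamBMeasure N) {R : ℝ} (hR : 0 ≤ R) {a b : ℝ}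
    (hab : a ≤ b) :
    ∃ C : ℝ, 1 ≤ C ∧ ∀ (μ : VecParamBMeasure N) (y z : ℝ → Euc N) (ε : ℝ), 0 ≤ ε →
      SolvesOn μ (Euc.clamp R) y a b → SolvesOn ν (Euc.clamp R) z a b →
      (∀ s ∈ Icc a b, ∀ t ∈ Icc a b, ∀ i, |paramIntegral (μ i) (Euc.clamp R ∘ y) s t -
        paramIntegral (ν i) (Euc.clamp R ∘ y) s t| ≤ ε) →
      ∀ s ∈ Icc a b, ∀ t ∈ Icc a b, ‖y t - z t‖ ≤ C * (‖y s - z s‖ + √N * ε) := by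
  obtain ⟨L, hLc, hLm, hL⟩ := ν.exists_lDom (√N * R)
  have hcl := Euc.continuous_clamp (N := N) R
  have hκ : 0 ≤ √(N : ℝ) := Real.sqrt_nonneg _
  obtain ⟨C, hC, h⟩ := gronwall (E := Euc N) (L := fun t => √N * L t) (hLm.const_mul hκ)
    (by fun_prop) hab
  refine ⟨C, hC, fun μ y z ε hε hy hz hyε => ?_⟩
  refine h (fun t => y t - z t) (√N * ε) (by positivity) (hy.1.sub hz.1) fun s hs t ht η hη => ?_
  have hsub : uIcc s t ⊆ Icc a b := uIcc_subset_Icc hs ht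
  have hη₀ : 0 ≤ η := (norm_nonneg _).trans (hη s left_mem_uIcc)
  rw [← mul_sub, abs_mul, abs_of_nonneg hκ, mul_assoc, ← mul_add]
  refine Euc.norm_le_sqrt_mul (by positivity) fun i => ?_
  have e₁ := hyε s hs t ht i
  have e₂ := (hL i).abs_paramIntegral_sub_le (s := s) (t := t) (η := η)
    (hcl.comp_continuousOn (hy.1.mono hsub)) (hcl.comp_continuousOn (hz.1.mono hsub))
    (fun x _ => Euc.norm_clamp_le hR _) (fun x _ => Euc.norm_clamp_le hR _)
    (fun x hx => (Euc.norm_clamp_sub_le R _ _).trans (hη x hx))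
  -- The intermediate term is the integral of `ν` along `y`. The first difference compares the
  -- equations along one curve, the second compares two curves for `ν`; no Lipschitz bound for `μ`
  -- is used.
  have e₃ : (y t - z t - (y s - z s)) i = (paramIntegral (μ i) (Euc.clamp R ∘ y) s t -
      paramIntegral (ν i) (Euc.clamp R ∘ y) s t) + (paramIntegral (ν i) (Euc.clamp R ∘ y) s t -
      paramIntegral (ν i) (Euc.clamp R ∘ z) s t) := by
    rw [← hy.2 s hs t ht i, ← hz.2 s hs t ht i]
    simp only [PiLp.sub_apply]
    ring
  rw [e₃]
  exact (abs_add_le _ _).trans (add_le_add e₁ e₂)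

/-! ### Uniqueness and maximal solutions -/

theorem eqOn_of_solvesOn_clamp {ν : VecParamBMeasure N} {R : ℝ} (hR : 0 ≤ R) {y z : ℝ → Euc N}
    {a b t₀ : ℝ} (hy : SolvesOn ν (Euc.clamp R) y a b) (hz : SolvesOn ν (Euc.clamp R) z a b)
    (ht₀ : t₀ ∈ Icc a b) (h₀ : y t₀ = z t₀) : EqOn y z (Icc a b) := by
  obtain ⟨C, -, hC⟩ := exists_clamp_estimate ν hR (ht₀.1.trans ht₀.2)
  intro t ht
  have := hC ν y z 0 le_rfl hy hz (by simp) t₀ ht₀ t ht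
  rw [h₀, sub_self, norm_zero, mul_zero, add_zero, mul_zero] at this
  exact sub_eq_zero.1 (norm_le_zero_iff.1 this)

theorem SolvesOn.to_clamp {ν : VecParamBMeasure N} {y : ℝ → Euc N} {a b R : ℝ}
    (h : SolvesOn ν id y a b) (hR : ∀ t ∈ Icc a b, ‖y t‖ ≤ R) : SolvesOn ν (Euc.clamp R) y a b :=
  h.congr continuous_id (fun _ _ => rfl) fun t ht => (Euc.clamp_eq_self (hR t ht)).symm

theorem SolvesOn.of_clamp {ν : VecParamBMeasure N} {y : ℝ → Euc N} {a b R : ℝ}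
    (h : SolvesOn ν (Euc.clamp R) y a b) (hR : ∀ t ∈ Icc a b, ‖y t‖ ≤ R) : SolvesOn ν id y a b :=
  h.congr (Euc.continuous_clamp R) (fun _ _ => rfl) fun t ht => Euc.clamp_eq_self (hR t ht)

/-- Both solutions are bounded on the compact interval, hence solve the equation truncated at a
common level, for which uniqueness is known. -/
theorem eqOn_of_solvesOn {ν : VecParamBMeasure N} {y z : ℝ → Euc N} {a b t₀ : ℝ}
    (hy : SolvesOn ν id y a b) (hz : SolvesOn ν id z a b) (ht₀ : t₀ ∈ Icc a b)
    (h₀ : y t₀ = z t₀) : EqOn y z (Icc a b) := by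
  obtain ⟨R₁, h₁⟩ := isCompact_Icc.exists_bound_of_continuousOn hy.1
  obtain ⟨R₂, h₂⟩ := isCompact_Icc.exists_bound_of_continuousOn hz.1
  have hR : 0 ≤ max R₁ R₂ := (norm_nonneg _).trans ((h₁ t₀ ht₀).trans (le_max_left _ _))
  exact eqOn_of_solvesOn_clamp hR (hy.to_clamp fun t ht => (h₁ t ht).trans (le_max_left _ _))
    (hz.to_clamp fun t ht => (h₂ t ht).trans (le_max_right _ _)) ht₀ h₀

/-- A solution extends, as a truncated solution, and stays away from the truncation level near the
original interval. -/
theorem SolvesOn.exists_extension {ν : VecParamBMeasure N} {y : ℝ → Euc N} {a b t₀ : ℝ}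
    (hy : SolvesOn ν id y a b) (ht₀ : t₀ ∈ Icc a b) :
    ∃ (δ R : ℝ) (z : ℝ → Euc N), 0 < δ ∧ 0 ≤ R ∧ SolvesOn ν (Euc.clamp R) z (a - δ) (b + δ) ∧
      EqOn y z (Icc a b) ∧ ∀ t ∈ Icc (a - δ) (b + δ), ‖z t‖ < R := by
  have hab := ht₀.1.trans ht₀.2
  obtain ⟨R, hR⟩ := isCompact_Icc.exists_bound_of_continuousOn hy.1
  -- Truncating one unit above the bound of `y` makes the bound strict, so it persists on a slightly
  -- larger interval.
  have hR₀ : 0 ≤ R + 1 := by linarith [(norm_nonneg _).trans (hR t₀ ht₀)]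
  obtain ⟨z, hz, hz₀⟩ := exists_solvesOn_clamp ν hR₀ (a := a - 1) (b := b + 1) (t₀ := t₀)
    ⟨by linarith [ht₀.1], by linarith [ht₀.2]⟩ (y t₀)
  have hyz : EqOn y z (Icc a b) := eqOn_of_solvesOn_clamp hR₀
    (hy.to_clamp fun t ht => (hR t ht).trans (by linarith))
    (hz.mono (by linarith) (by linarith)) ht₀ hz₀.symm
  have hnear : ∀ x ∈ Icc a b, ∀ᶠ t in 𝓝 x, ‖z t‖ < R + 1 := fun x hx => by
    have hc : ContinuousAt z x := hz.1.continuousAt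
      (Icc_mem_nhds (by linarith [hx.1]) (by linarith [hx.2]))
    have hx' : ‖z x‖ < R + 1 := by
      rw [← hyz hx]
      linarith [hR x hx]
    exact hc.norm.eventually (gt_mem_nhds hx')
  obtain ⟨δ₁, hδ₁, h₁⟩ := Metric.eventually_nhds_iff.1 (hnear a (left_mem_Icc.2 hab))
  obtain ⟨δ₂, hδ₂, h₂⟩ := Metric.eventually_nhds_iff.1 (hnear b (right_mem_Icc.2 hab))
  obtain ⟨δ, hδ, hδ'⟩ := exists_between (lt_min one_pos (lt_min hδ₁ hδ₂))
  have k₀ : δ < 1 := hδ'.trans_le (min_le_left _ _)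
  have k₁ : δ < δ₁ := hδ'.trans_le ((min_le_right _ _).trans (min_le_left _ _))
  have k₂ : δ < δ₂ := hδ'.trans_le ((min_le_right _ _).trans (min_le_right _ _))
  refine ⟨δ, R + 1, z, hδ, hR₀, hz.mono (by linarith) (by linarith), hyz, fun t ht => ?_⟩
  rcases lt_or_ge t a with h | h
  · exact h₁ (by rw [Real.dist_eq, abs_lt]; constructor <;> linarith [ht.1])
  · rcases lt_or_ge b t with h' | h'
    · exact h₂ (by rw [Real.dist_eq, abs_lt]; constructor <;> linarith [ht.2])
    · rw [← hyz ⟨h, h'⟩]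
      linarith [hR t ⟨h, h'⟩]

/-- The value `solution ν y₀ t` comes from a solution chosen separately for each `t`. The choice is
harmless: two solutions agree on the intersection of their intervals, which contains `0` and `t`. -/
theorem IsSolution.eq_solution {ν : VecParamBMeasure N} {y₀ : Euc N} {a b t : ℝ} {z : ℝ → Euc N}
    (hz : IsSolution ν 0 y₀ a b z) (ht : t ∈ Icc a b) : z t = solution ν y₀ t := by
  have h : ∃ y : ℝ → Euc N, ∃ a b : ℝ, IsSolution ν 0 y₀ a b y ∧ t ∈ Icc a b := ⟨z, a, b, hz, ht⟩
  rw [solution, dif_pos h]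
  obtain ⟨a', b', h', ht'⟩ := h.choose_spec
  rw [isSolution_iff] at hz h'
  refine eqOn_of_solvesOn (a := max a a') (b := min b b') (t₀ := 0)
    (hz.2.1.mono (le_max_left _ _) (min_le_left _ _))
    (h'.2.1.mono (le_max_right _ _) (min_le_right _ _))
    ⟨max_le hz.1.1 h'.1.1, le_min hz.1.2 h'.1.2⟩ (hz.2.2.trans h'.2.2.symm)
    ⟨max_le ht.1 ht'.1, le_min ht.2 ht'.2⟩

theorem ordConnected_maximalInterval (ν : VecParamBMeasure N) (y₀ : Euc N) :
    (maximalInterval ν y₀).OrdConnected := by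
  refine ⟨fun s ⟨a, b, y, hy, hs⟩ t ⟨a', b', y', hy', ht⟩ x hx => ?_⟩
  rcases le_total 0 x with h | h
  · exact ⟨a', b', y', hy', hy'.1.1.trans h, hx.2.trans ht.2⟩
  · exact ⟨a, b, y, hy, hs.1.trans hx.1, h.trans hy.1.2⟩

theorem isSolution_const (ν : VecParamBMeasure N) (y₀ : Euc N) :
    IsSolution ν 0 y₀ 0 0 fun _ => y₀ := by
  refine ⟨by simp, continuousOn_const, fun t ht i => ?_⟩
  rw [Icc_self, mem_singleton_iff] at ht
  rw [ht, paramIntegral_self, add_zero]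

theorem zero_mem_maximalInterval (ν : VecParamBMeasure N) (y₀ : Euc N) :
    0 ∈ maximalInterval ν y₀ :=
  ⟨0, 0, _, isSolution_const ν y₀, by simp⟩

theorem solution_zero (ν : VecParamBMeasure N) (y₀ : Euc N) : solution ν y₀ 0 = y₀ :=
  ((isSolution_const ν y₀).eq_solution (by simp)).symm

theorem isSolution_solution {ν : VecParamBMeasure N} {y₀ : Euc N} {a b : ℝ} (h₀ : 0 ∈ Icc a b)
    (hab : Icc a b ⊆ maximalInterval ν y₀) : IsSolution ν 0 y₀ a b (solution ν y₀) := by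
  obtain ⟨a₁, b₁, y, hy, ha⟩ := hab (left_mem_Icc.2 (h₀.1.trans h₀.2))
  obtain ⟨a₂, b₂, z, hz, hb⟩ := hab (right_mem_Icc.2 (h₀.1.trans h₀.2))
  rw [isSolution_iff] at hy hz
  -- A solution reaching `a` and another one reaching `b` are restricted to the two sides of `0` and
  -- glued there.
  obtain ⟨w, hw, e, -⟩ := (hy.2.1.mono ha.1 hy.1.2).glue continuous_id h₀.1 h₀.2
    (hz.2.1.mono hz.1.1 hb.2) (hy.2.2.trans hz.2.2.symm)
  have hw₀ : w 0 = y₀ := by rw [← e ⟨h₀.1, le_rfl⟩, hy.2.2]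
  have hw' : IsSolution ν 0 y₀ a b w := isSolution_iff.2 ⟨h₀, hw, hw₀⟩
  rw [isSolution_iff]
  exact ⟨h₀, hw.congr continuous_id (fun t ht => hw'.eq_solution ht) fun _ _ => rfl,
    solution_zero ν y₀⟩

theorem isWellPosed (ν : VecParamBMeasure N) (y₀ : Euc N) : IsWellPosed ν y₀ := by
  refine ⟨?_, ordConnected_maximalInterval ν y₀, zero_mem_maximalInterval ν y₀,
    fun a b => isSolution_solution, fun a b z hz t ht => hz.eq_solution ht⟩
  rw [isOpen_iff_mem_nhds]
  rintro t ⟨a, b, y, hy, ht⟩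
  rw [isSolution_iff] at hy
  obtain ⟨δ, R, z, hδ, -, hz, hyz, hR⟩ := hy.2.1.exists_extension hy.1
  have hz' : IsSolution ν 0 y₀ (a - δ) (b + δ) z := isSolution_iff.2
    ⟨⟨by linarith [hy.1.1], by linarith [hy.1.2]⟩, hz.of_clamp fun t ht => (hR t ht).le,
      by rw [← hyz hy.1, hy.2.2]⟩
  filter_upwards [Icc_mem_nhds (show a - δ < t by linarith [ht.1])
    (show t < b + δ by linarith [ht.2])] with x hx
  exact ⟨_, _, z, hz', hx⟩

/-! ### The cocycle property -/

theorem SolvesOn.translate {ν : VecParamBMeasure N} {y : ℝ → Euc N} {a b : ℝ} (c : ℝ)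
    (h : SolvesOn ν id y a b) :
    SolvesOn (ν.translate c) id (fun t => y (t + c)) (a - c) (b - c) := by
  have hmaps : MapsTo (fun t => t + c) (Icc (a - c) (b - c)) (Icc a b) := fun t ht =>
    ⟨by linarith [ht.1], by linarith [ht.2]⟩
  have hcont : ContinuousOn (fun t => y (t + c)) (Icc (a - c) (b - c)) :=
    h.1.comp (by fun_prop) hmaps
  refine ⟨hcont, fun s hs t ht i => ?_⟩
  rw [h.2 _ (hmaps hs) _ (hmaps ht) i]
  have := paramIntegral_translate (ν i) c (y := fun t => y (t + c)) (s := s) (t := t)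
    (hcont.mono (uIcc_subset_Icc hs ht))
  simp only [sub_add_cancel] at this
  exact this.symm

theorem isSolution_translate {ν : VecParamBMeasure N} {y₀ : Euc N} {s t : ℝ}
    (hs : s ∈ maximalInterval ν y₀) (hts : t + s ∈ maximalInterval ν y₀) :
    ∃ a b, t ∈ Icc a b ∧
      IsSolution (ν.translate s) 0 (solution ν y₀ s) a b fun x => solution ν y₀ (x + s) := by
  have h0 := zero_mem_maximalInterval ν y₀
  let a := min 0 (min s (t + s))
  let b := max 0 (max s (t + s))
  have ha : a ∈ maximalInterval ν y₀ := min_rec' (· ∈ _) h0 (min_rec' (· ∈ _) hs hts)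
  have hb : b ∈ maximalInterval ν y₀ := max_rec' (· ∈ _) h0 (max_rec' (· ∈ _) hs hts)
  have e₁ : a ≤ s := (min_le_right _ _).trans (min_le_left _ _)
  have e₂ : a ≤ t + s := (min_le_right _ _).trans (min_le_right _ _)
  have e₃ : s ≤ b := (le_max_left _ _).trans (le_max_right _ _)
  have e₄ : t + s ≤ b := (le_max_right _ _).trans (le_max_right _ _)
  have hsol := isSolution_iff.1 (isSolution_solution ⟨min_le_left _ _, le_max_left _ _⟩
    ((ordConnected_maximalInterval ν y₀).out ha hb))
  refine ⟨a - s, b - s, ⟨by linarith, by linarith⟩, isSolution_iff.2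
    ⟨⟨by linarith, by linarith⟩, hsol.2.1.translate s, by rw [zero_add]⟩⟩

theorem mem_maximalInterval_translate {ν : VecParamBMeasure N} {y₀ : Euc N} {s t : ℝ}
    (hs : s ∈ maximalInterval ν y₀) (hts : t + s ∈ maximalInterval ν y₀) :
    t ∈ maximalInterval (ν.translate s) (solution ν y₀ s) := by
  obtain ⟨a, b, ht, h⟩ := isSolution_translate hs hts
  exact ⟨a, b, _, h, ht⟩

theorem solution_translate {ν : VecParamBMeasure N} {y₀ : Euc N} {s t : ℝ}
    (hs : s ∈ maximalInterval ν y₀) (hts : t + s ∈ maximalInterval ν y₀) :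
    solution ν y₀ (t + s) = solution (ν.translate s) (solution ν y₀ s) t := by
  obtain ⟨a, b, ht, h⟩ := isSolution_translate hs hts
  exact h.eq_solution ht

theorem BMeasure.translate_translate (μ : BMeasure) (s t : ℝ) :
    (μ.translate s).translate t = μ.translate (t + s) := by
  refine BMeasure.ext_of_Icc fun a b _ => ?_
  simp only [BMeasure.translate_Icc, add_assoc]

theorem BMeasure.translate_zero (μ : BMeasure) : μ.translate 0 = μ := by
  refine BMeasure.ext_of_Icc fun a b _ => ?_
  simp only [BMeasure.translate_Icc, add_zero]

theorem VecParamBMeasure.translate_translate (ν : VecParamBMeasure N) (s t : ℝ) :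
    (ν.translate s).translate t = ν.translate (t + s) := by
  funext i
  ext1
  funext y
  exact BMeasure.translate_translate (ν i y) s t

theorem VecParamBMeasure.translate_zero (ν : VecParamBMeasure N) : ν.translate 0 = ν := by
  funext i
  ext1
  funext y
  exact BMeasure.translate_zero (ν i y)

/-- The converse is the direct implication applied to the translated equation and the time `-s`,
which leads back to `ν` and `y₀`. -/
theorem mem_maximalInterval_translate_iff {ν : VecParamBMeasure N} {y₀ : Euc N} {s t : ℝ}
    (hs : s ∈ maximalInterval ν y₀) :
    t + s ∈ maximalInterval ν y₀ ↔ t ∈ maximalInterval (ν.translate s) (solution ν y₀ s) := by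
  refine ⟨mem_maximalInterval_translate hs, fun h => ?_⟩
  have h0 : -s + s ∈ maximalInterval ν y₀ := by
    rw [neg_add_cancel]
    exact zero_mem_maximalInterval ν y₀
  have h₁ := mem_maximalInterval_translate hs h0
  have h₂ := solution_translate hs h0
  rw [neg_add_cancel, solution_zero] at h₂
  have h₃ := mem_maximalInterval_translate (t := t + s) h₁ (by rwa [add_neg_cancel_right])
  rwa [VecParamBMeasure.translate_translate, neg_add_cancel, VecParamBMeasure.translate_zero,
    ← h₂] at h₃

/-! ### Topologies generated by seminorms -/

/-- The properties of seminorms which are needed to describe the neighbourhoods in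
`seminormTopology`. -/
structure SeminormLike {V ι : Type*} [Sub V] (p : ι → V → ℝ≥0∞) : Prop where
  self : ∀ i a, p i (a - a) = 0
  symm : ∀ i a b, p i (a - b) = p i (b - a)
  triangle : ∀ i a b c, p i (a - c) ≤ p i (a - b) + p i (b - c)

/-- The generating balls have arbitrary centres; the triangle inequality shows that those centred at
the limit suffice. -/
theorem SeminormLike.tendsto_iff {V ι X : Type*} [Sub V] {p : ι → V → ℝ≥0∞} (hp : SeminormLike p)
    {l : Filter X} {f : X → V} {v : V} :
    Tendsto f l (@nhds _ (seminormTopology p) v) ↔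
      ∀ i (ε : ℝ), 0 < ε → ∀ᶠ x in l, p i (f x - v) ≤ ENNReal.ofReal ε := by
  rw [TopologicalSpace.tendsto_nhds_generateFrom_iff]
  constructor
  · intro h i ε hε
    have hε' := ENNReal.ofReal_pos.2 hε
    filter_upwards [h {ν | p i (ν - v) < ENNReal.ofReal ε} ⟨i, v, _, hε', rfl⟩
      (show p i (v - v) < _ by rwa [hp.self])] with x hx
    exact le_of_lt hx
  · rintro h _ ⟨i, w, ε, -, rfl⟩ hv
    obtain ⟨r, hr, hr'⟩ := ENNReal.lt_iff_exists_add_pos_lt.1 (show p i (v - w) < ε from hv)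
    filter_upwards [h i r hr] with x hx
    rw [ENNReal.ofReal_coe_nnreal] at hx
    calc p i (f x - w) ≤ p i (f x - v) + p i (v - w) := hp.triangle i _ _ _
      _ ≤ r + p i (v - w) := by gcongr
      _ < ε := by rwa [add_comm]

theorem SeminormLike.t2Space {V ι : Type*} [Sub V] {p : ι → V → ℝ≥0∞} (hp : SeminormLike p)
    (h : ∀ v w, (∀ i, p i (v - w) = 0) → v = w) : @T2Space V (seminormTopology p) := by
  let _ := seminormTopology p
  rw [t2_iff_nhds]
  intro v w hvw
  have h₁ := hp.tendsto_iff.1 (tendsto_id'.2 (inf_le_left : 𝓝 v ⊓ 𝓝 w ≤ 𝓝 v))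
  have h₂ := hp.tendsto_iff.1 (tendsto_id'.2 (inf_le_right : 𝓝 v ⊓ 𝓝 w ≤ 𝓝 w))
  refine h v w fun i => le_antisymm (ENNReal.le_of_forall_pos_le_add fun ε hε _ => ?_) zero_le
  have hε' : (0 : ℝ) < ε / 2 := by positivity
  obtain ⟨x, hx₁, hx₂⟩ := ((h₁ i _ hε').and (h₂ i _ hε')).exists
  calc p i (v - w) ≤ p i (v - x) + p i (x - w) := hp.triangle i _ _ _
    _ ≤ ENNReal.ofReal (ε / 2) + ENNReal.ofReal (ε / 2) := by
      rw [hp.symm]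
      exact add_le_add hx₁ hx₂
    _ = 0 + ε := by
      rw [← ENNReal.ofReal_add hε'.le hε'.le, add_halves, ENNReal.ofReal_coe_nnreal, zero_add]

theorem tendsto_productTopology_iff {X : Type*} {T : TopologicalSpace (ParamBMeasure N)}
    {l : Filter X} {f : X → VecParamBMeasure N} {ν : VecParamBMeasure N} :
    Tendsto f l (@nhds _ (productTopology T) ν) ↔
      ∀ i, Tendsto (fun x => f x i) l (@nhds _ T (ν i)) :=
  @tendsto_pi_nhds _ (Fin N) (fun _ => ParamBMeasure N) (fun _ => T) f ν l

theorem continuousOn_of_mem_admissibleCurves {θ : ℝ → ℝ} {j : ℕ} {I : RatInterval} {y : ℝ → Euc N}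
    (h : y ∈ admissibleCurves N θ j I) : ContinuousOn y (uIcc (I.1.1 : ℝ) (I.1.2 : ℝ)) := by
  rw [uIcc_of_le (by exact_mod_cast I.2.le)]
  exact h.1

theorem seminormLike_sigmaTheta (θ : ℕ → RatInterval → ℝ → ℝ) :
    SeminormLike (fun (p : RatInterval × {j : ℕ // 1 ≤ j}) (ν : ParamBMeasure N) =>
    ⨆ y ∈ admissibleCurves N (θ p.2 p.1) p.2 p.1, ‖paramIntegral ν y p.1.1.1 p.1.1.2‖ₑ) where
  self p a := by
    simp only [ENNReal.iSup_eq_zero]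
    intro y hy
    rw [paramIntegral_sub _ _ (continuousOn_of_mem_admissibleCurves hy), sub_self, enorm_zero]
  symm p a b := by
    refine iSup_congr fun y => iSup_congr fun hy => ?_
    rw [paramIntegral_sub _ _ (continuousOn_of_mem_admissibleCurves hy), paramIntegral_sub _ _ (continuousOn_of_mem_admissibleCurves hy),
      ← enorm_neg, neg_sub]
  triangle p a b c := by
    refine iSup₂_le fun y hy => ?_
    refine le_trans ?_ (add_le_add (le_iSup₂_of_le y hy le_rfl) (le_iSup₂_of_le y hy le_rfl))
    rw [paramIntegral_sub _ _ (continuousOn_of_mem_admissibleCurves hy), paramIntegral_sub _ _ (continuousOn_of_mem_admissibleCurves hy),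
      paramIntegral_sub _ _ (continuousOn_of_mem_admissibleCurves hy)]
    refine le_trans (le_of_eq ?_) (enorm_add_le _ _)
    rw [sub_add_sub_cancel]

theorem seminormLike_sigmaD (D : Set (Euc N)) :
    SeminormLike (fun (p : RatInterval × D) (ν : ParamBMeasure N) => ‖ν p.2 p.1.toSet‖ₑ) where
  self p a := by rw [ParamBMeasure.sub_Icc, sub_self, enorm_zero]
  symm p a b := by rw [ParamBMeasure.sub_Icc, ParamBMeasure.sub_Icc, ← enorm_neg, neg_sub]
  triangle p a b c := by
    rw [ParamBMeasure.sub_Icc, ParamBMeasure.sub_Icc, ParamBMeasure.sub_Icc]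
    refine le_trans (le_of_eq ?_) (enorm_add_le _ _)
    rw [sub_add_sub_cancel]

theorem Real.enorm_le_ofReal_iff {x ε : ℝ} (hε : 0 ≤ ε) : ‖x‖ₑ ≤ ENNReal.ofReal ε ↔ |x| ≤ ε := by
  rw [Real.enorm_eq_ofReal_abs, ENNReal.ofReal_le_ofReal_iff hε]

/-! ### Convergence in the two product topologies -/

theorem tendsto_thetaTopology_iff {X : Type*} {m : ℕ → Measure ℝ} {l : Filter X}
    {f : X → VecParamBMeasure N} {ν : VecParamBMeasure N} :
    Tendsto f l (@nhds _ (thetaTopology N m) ν) ↔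
      ∀ (i : Fin N) (I : RatInterval) (j : ℕ), 1 ≤ j → ∀ ε : ℝ, 0 < ε → ∀ᶠ x in l,
        ∀ y ∈ admissibleCurves N (moduliOf N m j I) j I,
          |paramIntegral (f x i) y I.1.1 I.1.2 - paramIntegral (ν i) y I.1.1 I.1.2| ≤ ε := by
  simp only [tendsto_productTopology_iff,
    (seminormLike_sigmaTheta (moduliOf N m)).tendsto_iff, iSup₂_le_iff]
  refine ⟨fun h i I j hj ε hε => (h i (I, ⟨j, hj⟩) ε hε).mono fun x hx y hy => ?_,
    fun h i p ε hε => (h i p.1 p.2 p.2.2 ε hε).mono fun x hx y hy => ?_⟩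
  · rw [← Real.enorm_le_ofReal_iff hε.le, ← paramIntegral_sub _ _ (continuousOn_of_mem_admissibleCurves hy)]
    exact hx y hy
  · rw [paramIntegral_sub _ _ (continuousOn_of_mem_admissibleCurves hy), Real.enorm_le_ofReal_iff hε.le]
    exact hx y hy

theorem tendsto_denseTopology_iff {X : Type*} {D : Set (Euc N)} {l : Filter X}
    {f : X → VecParamBMeasure N} {ν : VecParamBMeasure N} :
    Tendsto f l (@nhds _ (denseTopology N D) ν) ↔
      ∀ (i : Fin N) (I : RatInterval), ∀ y ∈ D,
        Tendsto (fun x => f x i y I.toSet) l (𝓝 (ν i y I.toSet)) := by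
  simp only [tendsto_productTopology_iff,
    (seminormLike_sigmaD D).tendsto_iff, Metric.tendsto_nhds]
  refine ⟨fun h i I y hy ε hε => (h i (I, ⟨y, hy⟩) (ε / 2) (half_pos hε)).mono fun x hx => ?_,
    fun h i p ε hε => (h i p.1 p.2 p.2.2 ε hε).mono fun x hx => ?_⟩
  · rw [ParamBMeasure.sub_Icc, Real.enorm_le_ofReal_iff (half_pos hε).le] at hx
    exact hx.trans_lt (half_lt_self hε)
  · rw [ParamBMeasure.sub_Icc, Real.enorm_le_ofReal_iff hε.le]
    exact le_of_lt hx

/-! ### The modulus of continuity of a measure under translations -/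

/-- The supremum of the measures of the intervals of length `s`. -/
noncomputable def translateModulus (m : Measure ℝ) (s : ℝ) : ℝ :=
  (⨆ τ : ℝ, m (Icc τ (τ + s))).toReal

/-- The supremum over all translations absorbs the base point in `I`, so the modulus does not depend
on the interval. -/
theorem moduliOf_eq (m : ℕ → Measure ℝ) (j : ℕ) (I : RatInterval) (s : ℝ) :
    moduliOf N m j I s = √N * translateModulus (m j) s := by
  have h : ∀ t τ : ℝ, translateMeasure (m j) τ (Icc t (t + s)) = m j (Icc (t + τ) (t + τ + s)) :=
    fun t τ => by rw [translateMeasure_apply, shiftSet_Icc, add_right_comm]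
  rw [moduliOf, translateModulus]
  congr 2
  simp only [h]
  refine le_antisymm (iSup₂_le fun t _ => iSup_le fun τ =>
    le_iSup (fun τ => m j (Icc τ (τ + s))) (t + τ)) (iSup_le fun τ => ?_)
  refine le_iSup₂_of_le (I.1.1 : ℝ) (left_mem_Icc.2 (by exact_mod_cast I.2.le))
    (le_iSup_of_le (τ - I.1.1) ?_)
  rw [add_sub_cancel]

theorem translateModulus_nonneg (m : Measure ℝ) (s : ℝ) : 0 ≤ translateModulus m s :=
  ENNReal.toReal_nonneg

theorem translateMeasure_zero_Icc (m : Measure ℝ) (s t : ℝ) :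
    translateMeasure m 0 (Icc s t) = m (Icc s t) := by
  rw [translateMeasure_apply, shiftSet_Icc, add_zero, add_zero]

/-- Finitely many intervals of length `δ / 2`, each of measure at most `1`, cover an interval of
length `s`. Finiteness matters because `translateModulus` is defined by `toReal`, which would turn
an infinite supremum into `0`. -/
theorem iSup_Icc_lt_top {m : Measure ℝ}
    (h : EquicontinuousFamily fun τ : ℝ => translateMeasure m τ) (s : ℝ) :
    ⨆ τ : ℝ, m (Icc τ (τ + s)) < ∞ := by
  obtain ⟨δ, hδ, hδ'⟩ := h 1 one_pos
  have h₁ : ∀ τ, m (Icc τ (τ + δ / 2)) ≤ 1 := fun τ => by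
    have := hδ' 0 τ (τ + δ / 2) (by linarith) (by linarith)
    rw [translateMeasure_zero_Icc, ENNReal.ofReal_one] at this
    exact this.le
  have h₂ : ∀ (n : ℕ) (τ : ℝ), m (Icc τ (τ + n * (δ / 2))) ≤ n + 1 := by
    intro n
    induction n with
    | zero =>
      intro τ
      refine (measure_mono (Icc_subset_Icc_right ?_)).trans ((h₁ τ).trans (by simp))
      simp only [CharP.cast_eq_zero, zero_mul]
      linarith
    | succ n ih =>
      intro τ
      have hsub : Icc τ (τ + (n + 1 : ℕ) * (δ / 2)) ⊆
          Icc τ (τ + n * (δ / 2)) ∪ Icc (τ + n * (δ / 2)) (τ + n * (δ / 2) + δ / 2) := by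
        intro x hx
        push_cast at hx
        rcases le_total x (τ + n * (δ / 2)) with h | h
        · exact Or.inl ⟨hx.1, h⟩
        · exact Or.inr ⟨h, by linarith [hx.2]⟩
      refine (measure_mono hsub).trans ((measure_union_le _ _).trans ?_)
      push_cast
      exact add_le_add (ih τ) (h₁ _)
  obtain ⟨n, hn⟩ := exists_nat_ge (s / (δ / 2))
  rw [div_le_iff₀ (by linarith)] at hn
  refine (iSup_le fun τ => (measure_mono (Icc_subset_Icc_right ?_)).trans (h₂ n τ)).trans_lt
    (show (n : ℝ≥0∞) + 1 < ∞ by finiteness)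
  linarith

theorem translateModulus_mono {m : Measure ℝ}
    (h : EquicontinuousFamily fun τ : ℝ => translateMeasure m τ) : Monotone (translateModulus m) :=
  fun s t hst => ENNReal.toReal_mono (iSup_Icc_lt_top h t).ne
    (iSup_mono fun τ => measure_mono (Icc_subset_Icc_right (by linarith)))

theorem exists_translateModulus_le {m : Measure ℝ}
    (h : EquicontinuousFamily fun τ : ℝ => translateMeasure m τ) {ε : ℝ} (hε : 0 < ε) :
    ∃ δ, 0 < δ ∧ ∀ s < δ, translateModulus m s ≤ ε := by
  obtain ⟨δ, hδ, hδ'⟩ := h ε hε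
  refine ⟨δ, hδ, fun s hs => ENNReal.toReal_le_of_le_ofReal hε.le (iSup_le fun τ => ?_)⟩
  rcases le_or_gt 0 s with h₀ | h₀
  · have := hδ' 0 τ (τ + s) (by linarith) (by linarith)
    rw [translateMeasure_zero_Icc] at this
    exact this.le
  · rw [Icc_eq_empty (by linarith), measure_empty]
    exact zero_le

theorem sub_le_translateModulus {m : Measure ℝ}
    (h : EquicontinuousFamily fun τ : ℝ => translateMeasure m τ) {M : ℝ → ℝ}
    (hm : ∀ a b : ℝ, a ≤ b → m (Icc a b) = ENNReal.ofReal (M b - M a)) {s t : ℝ} (hst : s ≤ t) :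
    M t - M s ≤ translateModulus m (t - s) := by
  rw [translateModulus, ← ENNReal.ofReal_le_iff_le_toReal (iSup_Icc_lt_top h _).ne, ← hm s t hst]
  refine le_iSup_of_le s ?_
  rw [add_sub_cancel]

theorem continuous_of_sub_le_translateModulus {m : Measure ℝ}
    (h : EquicontinuousFamily fun τ : ℝ => translateMeasure m τ) {M : ℝ → ℝ} (hM : Monotone M)
    (hm : ∀ s t, s ≤ t → M t - M s ≤ translateModulus m (t - s)) : Continuous M := by
  rw [Metric.continuous_iff]
  intro x ε hε
  obtain ⟨δ, hδ, hδ'⟩ := exists_translateModulus_le h (half_pos hε)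
  refine ⟨δ, hδ, fun y hy => ?_⟩
  rw [Real.dist_eq, abs_lt] at hy ⊢
  rcases le_total x y with hxy | hxy
  · have := hm x y hxy
    have := hδ' (y - x) (by linarith)
    constructor <;> linarith [hM hxy]
  · have := hm y x hxy
    have := hδ' (x - y) (by linarith)
    constructor <;> linarith [hM hxy]

/-! ### Translation-invariant bounds -/

/-- `ν` has `m`-bounds of which the moduli of continuity are those of the family `m`. -/
def HasModulusBounds (m : ℕ → Measure ℝ) (ν : VecParamBMeasure N) : Prop :=
  ∀ j : ℕ, 1 ≤ j → ∃ M : ℝ → ℝ, Monotone M ∧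
    (∀ s t, s ≤ t → M t - M s ≤ translateModulus (m j) (t - s)) ∧ ∀ i, (ν i).MDom j M

theorem HasModulusBounds.abs_paramIntegral_le {m : ℕ → Measure ℝ} {ν : VecParamBMeasure N}
    (h : HasModulusBounds m ν) {j : ℕ} (hj : 1 ≤ j) (i : Fin N) {y : ℝ → Euc N} {s t : ℝ}
    (hy : ContinuousOn y (uIcc s t)) (hyj : ∀ x ∈ uIcc s t, ‖y x‖ ≤ j) :
    |paramIntegral (ν i) y s t| ≤ translateModulus (m j) |t - s| := by
  obtain ⟨M, hM, hω, hMi⟩ := h j hj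
  refine ((hMi i).abs_paramIntegral_le hy hyj).trans ?_
  rcases le_total s t with hst | hst
  · rw [abs_of_nonneg (sub_nonneg.2 (hM hst)), abs_of_nonneg (sub_nonneg.2 hst)]
    exact hω s t hst
  · rw [abs_sub_comm, abs_of_nonneg (sub_nonneg.2 (hM hst)), abs_sub_comm t,
      abs_of_nonneg (sub_nonneg.2 hst)]
    exact hω t s hst

theorem ParamBMeasure.MDom.translate {ν : ParamBMeasure N} {r : ℝ} {M : ℝ → ℝ} (h : ν.MDom r M)
    (c : ℝ) : (ν.translate c).MDom r fun t => M (t + c) := by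
  refine ⟨fun s t hst => h.1 (by linarith), fun y hy s t hst => ?_⟩
  change |(ν y).translate c (Icc s t)| ≤ _
  rw [BMeasure.translate_Icc]
  exact h.2 y hy _ _ (by linarith)

theorem ParamBMeasure.LDom.translate {ν : ParamBMeasure N} {r : ℝ} {L : ℝ → ℝ} (h : ν.LDom r L)
    (c : ℝ) : (ν.translate c).LDom r fun t => L (t + c) := by
  refine ⟨fun s t hst => h.1 (by linarith), fun y z hy hz s t hst => ?_⟩
  change |(ν y).translate c (Icc s t) - (ν z).translate c (Icc s t)| ≤ _
  rw [BMeasure.translate_Icc, BMeasure.translate_Icc]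
  exact h.2 y z hy hz _ _ (by linarith)

theorem HasModulusBounds.translate {m : ℕ → Measure ℝ} {ν : VecParamBMeasure N}
    (h : HasModulusBounds m ν) (c : ℝ) : HasModulusBounds m (ν.translate c) := by
  intro j hj
  obtain ⟨M, hM, hω, hMi⟩ := h j hj
  refine ⟨fun t => M (t + c), fun s t hst => hM (by linarith), fun s t hst => ?_,
    fun i => (hMi i).translate c⟩
  convert hω (s + c) (t + c) (by linarith) using 2
  ring

theorem hasModulusBounds_of_isMBound {m : ℕ → Measure ℝ} {ν : VecParamBMeasure N}
    (hm : ∀ j, 1 ≤ j → IsContinuousMeasure (m j))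
    (hm_bound : ∀ j, 1 ≤ j → ∀ i : Fin N, IsMBound (ν i) j (m j))
    (hm_equi : ∀ j, 1 ≤ j → EquicontinuousFamily (fun τ : ℝ => translateMeasure (m j) τ)) :
    HasModulusBounds m ν := by
  intro j hj
  obtain ⟨M, h₁, -, -, h₂⟩ := (hm j hj).exists_cdf
  exact ⟨M, h₁, fun s t hst => sub_le_translateModulus (hm_equi j hj) h₂ hst,
    fun i => ⟨h₁, fun y hy s t hst => (hm_bound j hj i).abs_le h₁ h₂ hy hst⟩⟩

/-- After normalization at `0` the functions are bounded at each time, hence converge along the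
ultrafilter. The bound `B` depends only on the length of the interval and passes to the limit; it is
used with the modulus of `m` and, for Lipschitz functions, with an affine bound. -/
theorem exists_limit_of_increments_le {X : Type*} (U : Ultrafilter X) {M : X → ℝ → ℝ} {B : ℝ → ℝ}
    (h : ∀ᶠ x in (U : Filter X), Monotone (M x) ∧ ∀ s t, s ≤ t → M x t - M x s ≤ B (t - s)) :
    ∃ M' : ℝ → ℝ, Monotone M' ∧ (∀ s t, s ≤ t → M' t - M' s ≤ B (t - s)) ∧
      ∀ s t, Tendsto (fun x => M x t - M x s) U (𝓝 (M' t - M' s)) := by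
  have hb : ∀ t, ∃ l, Tendsto (fun x => M x t - M x 0) U (𝓝 l) := fun t => by
    refine U.exists_tendsto_of_abs_le (C := max (B t) (B (-t))) ?_
    filter_upwards [h] with x hx
    rcases le_total 0 t with ht | ht
    · have := hx.2 0 t ht
      rw [abs_of_nonneg (sub_nonneg.2 (hx.1 ht))]
      rw [sub_zero] at this
      exact this.trans (le_max_left _ _)
    · have := hx.2 t 0 ht
      rw [abs_sub_comm, abs_of_nonneg (sub_nonneg.2 (hx.1 ht))]
      rw [zero_sub] at this
      exact this.trans (le_max_right _ _)
  choose M' hM' using hb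
  have key : ∀ s t, Tendsto (fun x => M x t - M x s) U (𝓝 (M' t - M' s)) := fun s t => by
    simpa using (hM' t).sub (hM' s)
  refine ⟨M', fun s t hst => ?_, fun s t hst => ?_, key⟩
  · exact sub_nonneg.1 (ge_of_tendsto (key s t) (h.mono fun x hx => sub_nonneg.2 (hx.1 hst)))
  · exact le_of_tendsto (key s t) (h.mono fun x hx => hx.2 s t hst)

/-- The topologies only see rational intervals; this transfers inequalities between continuous
distribution functions to all intervals. -/
theorem nonneg_of_forall_rat {F : ℝ × ℝ → ℝ} (hF : Continuous F)
    (h : ∀ p q : ℚ, p < q → 0 ≤ F (p, q)) {s t : ℝ} (hst : s < t) : 0 ≤ F (s, t) := by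
  by_contra! hneg
  have hopen : IsOpen {x : ℝ × ℝ | F x < 0 ∧ x.1 < x.2} :=
    (isOpen_lt hF continuous_const).inter (isOpen_lt continuous_fst continuous_snd)
  obtain ⟨⟨p, q⟩, hpq⟩ := ((Rat.denseRange_cast (𝕜 := ℝ)).prodMap
    (Rat.denseRange_cast (𝕜 := ℝ))).exists_mem_open hopen ⟨(s, t), hneg, hst⟩
  have hlt : (p : ℝ) < q := hpq.2
  exact absurd (h p q (by exact_mod_cast hlt)) (not_le.2 hpq.1)

theorem ParamBMeasure.continuous_cdf (ν : ParamBMeasure N) (y : Euc N) :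
    Continuous (ν y).cdf := by
  obtain ⟨M, hc, hM⟩ := ν.exists_mDom ‖y‖
  have key : ∀ s t, |(ν y).cdf t - (ν y).cdf s| ≤ |M t - M s| := by
    refine uIcc_wlog (fun s t h => ?_) fun s t hst => ?_
    · rwa [abs_sub_comm, abs_sub_comm (M s)]
    · rw [← BMeasure.Icc_eq_cdf _ hst]
      exact (hM.2 y le_rfl s t hst).trans (le_abs_self _)
  rw [continuous_iff_continuousAt]
  intro s
  rw [ContinuousAt, tendsto_iff_dist_tendsto_zero]
  refine squeeze_zero (fun _ => dist_nonneg) (fun t => key s t) ?_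
  have : Tendsto (fun t => |M t - M s|) (𝓝 s) (𝓝 |M s - M s|) := ((hc.tendsto s).sub_const _).abs
  rwa [sub_self, abs_zero] at this

/-- The dominating functions `M x` converge along the same ultrafilter. Their limit keeps the
modulus, hence is continuous, and the domination passes to the limit on rational intervals and from
there to all intervals. -/
theorem HasModulusBounds.of_ultrafilter {m : ℕ → Measure ℝ}
    (hm_equi : ∀ j, 1 ≤ j → EquicontinuousFamily (fun τ : ℝ => translateMeasure (m j) τ))
    {X : Type*} (U : Ultrafilter X) {f : X → VecParamBMeasure N} {ν : VecParamBMeasure N}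
    (hf : ∀ᶠ x in (U : Filter X), HasModulusBounds m (f x))
    (hlim : ∀ (i : Fin N) (y : Euc N) (p q : ℚ), p < q →
      Tendsto (fun x => f x i y (Icc (p : ℝ) q)) U (𝓝 (ν i y (Icc (p : ℝ) q)))) :
    HasModulusBounds m ν := by
  intro j hj
  have : ∀ x, ∃ M : ℝ → ℝ, HasModulusBounds m (f x) → Monotone M ∧
    (∀ s t, s ≤ t → M t - M s ≤ translateModulus (m j) (t - s)) ∧ ∀ i, (f x i).MDom j M :=
    fun x => by
      by_cases h : HasModulusBounds m (f x)
      · obtain ⟨M, hM⟩ := h j hj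
        exact ⟨M, fun _ => hM⟩
      · exact ⟨0, fun h' => (h h').elim⟩
  choose M hM using this
  obtain ⟨M', h₁, h₂, h₃⟩ := exists_limit_of_increments_le U
    (hf.mono fun x hx => ⟨(hM x hx).1, (hM x hx).2.1⟩)
  have hc := continuous_of_sub_le_translateModulus (hm_equi j hj) h₁ h₂
  refine ⟨M', h₁, h₂, fun i => ⟨h₁, fun y hy s t hst => ?_⟩⟩
  rcases hst.eq_or_lt with rfl | hst
  · rw [BMeasure.Icc_self, abs_zero, sub_self]
  · rw [BMeasure.Icc_eq_cdf _ hst.le, ← sub_nonneg]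
    have hcdf := (ν i).continuous_cdf y
    refine nonneg_of_forall_rat
      (F := fun x => M' x.2 - M' x.1 - |(ν i y).cdf x.2 - (ν i y).cdf x.1|) (by fun_prop)
      (fun p q hpq => ?_) hst
    have hpq' : (p : ℝ) ≤ q := by exact_mod_cast hpq.le
    simp only
    rw [← BMeasure.Icc_eq_cdf _ hpq']
    refine ge_of_tendsto ((h₃ p q).sub (hlim i y p q hpq).abs) (hf.mono fun x hx => ?_)
    exact sub_nonneg.2 (((hM x hx).2.2 i).2 y hy _ _ hpq')

/-! ### Curves with the prescribed moduli of continuity -/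

/-- Curves in the ball of radius `j`, defined on the whole line, with the modulus of continuity
associated with `m`. -/
def globalCurves (N : ℕ) (m : ℕ → Measure ℝ) (j : ℕ) : Set (ℝ → Euc N) :=
  {y | Continuous y ∧ (∀ t, ‖y t‖ ≤ j) ∧
    ∀ s t, ‖y s - y t‖ ≤ √N * translateModulus (m j) |s - t|}

/-- Since the modulus is independent of the interval, one global curve is a test curve on all
rational intervals at once. -/
theorem globalCurves_subset {m : ℕ → Measure ℝ} {j : ℕ} {y : ℝ → Euc N}
    (hy : y ∈ globalCurves N m j) (I : RatInterval) :
    y ∈ admissibleCurves N (moduliOf N m j I) j I :=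
  ⟨hy.1.continuousOn, fun t _ => hy.2.1 t, fun s _ t _ => by
    rw [moduliOf_eq]
    exact hy.2.2 s t⟩

theorem const_mem_globalCurves {m : ℕ → Measure ℝ} {j : ℕ} {v : Euc N} (hv : ‖v‖ ≤ j) :
    (fun _ => v) ∈ globalCurves N m j :=
  ⟨continuous_const, fun _ => hv, fun s t => by
    rw [sub_self, norm_zero]
    exact mul_nonneg (Real.sqrt_nonneg _) (translateModulus_nonneg _ _)⟩

theorem comp_sub_mem_globalCurves {m : ℕ → Measure ℝ} {j : ℕ} {y : ℝ → Euc N}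
    (hy : y ∈ globalCurves N m j) (c : ℝ) : (fun t => y (t - c)) ∈ globalCurves N m j :=
  ⟨hy.1.comp (by fun_prop), fun t => hy.2.1 _, fun s t => by
    simpa using hy.2.2 (s - c) (t - c)⟩

/-- Extension of a curve with the prescribed modulus by constants. -/
theorem exists_globalCurve {m : ℕ → Measure ℝ} {j : ℕ}
    (hm : EquicontinuousFamily (fun τ : ℝ => translateMeasure (m j) τ)) {y : ℝ → Euc N} {a b : ℝ}
    (hab : a ≤ b) (hy : ContinuousOn y (Icc a b)) (hj : ∀ t ∈ Icc a b, ‖y t‖ ≤ j)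
    (hω : ∀ s ∈ Icc a b, ∀ t ∈ Icc a b, ‖y s - y t‖ ≤ √N * translateModulus (m j) |s - t|) :
    ∃ z ∈ globalCurves N m j, EqOn y z (Icc a b) := by
  refine ⟨fun t => y (projIcc a b hab t), ⟨?_, fun t => hj _ (projIcc a b hab t).2,
    fun s t => (hω _ (projIcc a b hab s).2 _ (projIcc a b hab t).2).trans ?_⟩, fun t ht => ?_⟩
  · exact hy.comp_continuous (continuous_subtype_val.comp continuous_projIcc)
      fun t => (projIcc a b hab t).2
  · refine mul_le_mul_of_nonneg_left (translateModulus_mono hm ?_) (Real.sqrt_nonneg _)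
    simp only [coe_projIcc]
    refine (abs_max_sub_max_le_max _ _ _ _).trans ?_
    rw [sub_self, abs_zero]
    refine max_le (abs_nonneg _) ((abs_min_sub_min_le_max _ _ _ _).trans ?_)
    simp
  · simp only [projIcc_of_mem hab ht]

/-- Constant curves are test curves, and the integral along a constant curve is the value of `ν_y`
on the interval. -/
theorem tendsto_apply_of_tendsto_theta {m : ℕ → Measure ℝ} {X : Type*} {l : Filter X}
    {f : X → VecParamBMeasure N} {ν : VecParamBMeasure N}
    (h : Tendsto f l (@nhds _ (thetaTopology N m) ν)) (i : Fin N) (y : Euc N) (I : RatInterval) :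
    Tendsto (fun x => f x i y I.toSet) l (𝓝 (ν i y I.toSet)) := by
  have hI : (I.1.1 : ℝ) ≤ I.1.2 := by exact_mod_cast I.2.le
  obtain ⟨j, hj, hyj⟩ := exists_nat_one_le_ge ‖y‖
  rw [Metric.tendsto_nhds]
  intro ε hε
  filter_upwards [tendsto_thetaTopology_iff.1 h i I j hj (ε / 2) (half_pos hε)] with x hx
  have := hx _ (globalCurves_subset (const_mem_globalCurves (m := m) hyj) I)
  rw [paramIntegral_const _ _ hI, paramIntegral_const _ _ hI] at this
  exact this.trans_lt (half_lt_self hε)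

theorem hasModulusBounds_of_mem_hull {m : ℕ → Measure ℝ} {ν₀ ν : VecParamBMeasure N}
    (hm_equi : ∀ j, 1 ≤ j → EquicontinuousFamily (fun τ : ℝ => translateMeasure (m j) τ))
    (h₀ : HasModulusBounds m ν₀) (hν : ν ∈ hull (thetaTopology N m) ν₀) :
    HasModulusBounds m ν := by
  let _ := thetaTopology N m
  obtain ⟨U, hU, hU'⟩ := mem_closure_iff_ultrafilter.1 (show ν ∈ closure _ from hν)
  refine HasModulusBounds.of_ultrafilter hm_equi U (f := id) ?_ fun i y p q hpq =>
    tendsto_apply_of_tendsto_theta (tendsto_id'.2 hU') i y ⟨(p, q), hpq⟩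
  filter_upwards [hU]
  rintro _ ⟨t, rfl⟩
  exact h₀.translate t

/-- Convergence in `σ_Θ` is uniform over all subintervals of a compact interval. -/
theorem eventually_abs_paramIntegral_sub_le {m : ℕ → Measure ℝ}
    (hm_equi : ∀ j, 1 ≤ j → EquicontinuousFamily (fun τ : ℝ => translateMeasure (m j) τ))
    {X : Type*} {l : Filter X} {f : X → VecParamBMeasure N} {ν : VecParamBMeasure N}
    (h : Tendsto f l (@nhds _ (thetaTopology N m) ν)) (hf : ∀ᶠ x in l, HasModulusBounds m (f x))
    (hν : HasModulusBounds m ν) {j : ℕ} (hj : 1 ≤ j) (a b : ℝ) {ε : ℝ} (hε : 0 < ε) :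
    ∀ᶠ x in l, ∀ y ∈ globalCurves N m j, ∀ s ∈ Icc a b, ∀ t ∈ Icc a b, ∀ i,
      |paramIntegral (f x i) y s t - paramIntegral (ν i) y s t| ≤ ε := by
  -- Moving `s` and `t` to rational grid points costs at most `ε / 8` at each end for each of the
  -- two integrands; the remaining `ε / 2` is left for the grid interval.
  obtain ⟨δ, hδ, hδ'⟩ := exists_translateModulus_le (hm_equi j hj) (ε := ε / 8) (by linarith)
  obtain ⟨n, hn⟩ := exists_nat_one_div_lt hδ
  have hn₀ : (0 : ℝ) < n + 1 := by positivity
  let q : ℤ → ℚ := fun k => k / (n + 1 : ℕ)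
  have hq : StrictMono q := fun k k' hk => by
    have : (k : ℚ) < k' := by exact_mod_cast hk
    simp only [q]
    gcongr
  -- Only finitely many pairs of grid points are relevant to `Icc a b`, so finitely many convergence
  -- conditions suffice for all subintervals and all curves.
  have hgrid : ∀ᶠ x in l, ∀ i : Fin N, ∀ k ∈ Finset.Icc ⌊a * (n + 1)⌋ ⌊b * (n + 1)⌋,
      ∀ k' ∈ Finset.Icc ⌊a * (n + 1)⌋ ⌊b * (n + 1)⌋, k < k' → ∀ y ∈ globalCurves N m j,
      |paramIntegral (f x i) y (q k) (q k') - paramIntegral (ν i) y (q k) (q k')| ≤ ε / 2 := by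
    rw [eventually_all]
    intro i
    rw [Filter.eventually_all_finset]
    intro k _
    rw [Filter.eventually_all_finset]
    intro k' _
    by_cases hk : k < k'
    · filter_upwards [tendsto_thetaTopology_iff.1 h i ⟨(q k, q k'), hq hk⟩ j hj (ε / 2)
        (half_pos hε)] with x hx _ y hy
      exact hx y (globalCurves_subset hy _)
    · exact Eventually.of_forall fun x hx => (hk hx).elim
  filter_upwards [hgrid, hf] with x hx hfx y hy s hs t ht i
  let k : ℝ → ℤ := fun s => ⌊s * (n + 1)⌋
  have hk : ∀ s ∈ Icc a b, k s ∈ Finset.Icc ⌊a * (n + 1)⌋ ⌊b * (n + 1)⌋ := fun s hs => by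
    rw [Finset.mem_Icc]
    exact ⟨Int.floor_mono (by have := hs.1; gcongr), Int.floor_mono (by have := hs.2; gcongr)⟩
  have hnear : ∀ s, |s - q (k s)| < δ := fun s => by
    have e : ((q (k s) : ℚ) : ℝ) = (k s : ℝ) / (n + 1) := by simp [q]
    have h₁ : (k s : ℝ) ≤ s * (n + 1) := Int.floor_le _
    have h₂ : s * (n + 1) < k s + 1 := Int.lt_floor_add_one _
    have h₃ : (k s : ℝ) / (n + 1) ≤ s := by rwa [div_le_iff₀ hn₀]
    have h₄ : s < (k s : ℝ) / (n + 1) + 1 / (n + 1) := by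
      rwa [← add_div, lt_div_iff₀ hn₀]
    rw [e, abs_of_nonneg (sub_nonneg.2 h₃)]
    linarith
  have hends : ∀ μ : VecParamBMeasure N, HasModulusBounds m μ → ∀ s t, |s - t| < δ →
      |paramIntegral (μ i) y s t| ≤ ε / 8 := fun μ hμ s t hst =>
    (hμ.abs_paramIntegral_le hj i hy.1.continuousOn fun x _ => hy.2.1 x).trans
      (hδ' _ (by rwa [abs_sub_comm]))
  have hmid : |paramIntegral (f x i) y (q (k s)) (q (k t)) -
      paramIntegral (ν i) y (q (k s)) (q (k t))| ≤ ε / 2 := by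
    rcases lt_trichotomy (k s) (k t) with hst | hst | hst
    · exact hx i _ (hk s hs) _ (hk t ht) hst y hy
    · rw [hst, paramIntegral_self, paramIntegral_self, sub_self, abs_zero]
      linarith
    · rw [paramIntegral_swap _ _ (q (k t) : ℝ), paramIntegral_swap (ν i) _ (q (k t) : ℝ),
        neg_sub_neg, abs_sub_comm]
      exact hx i _ (hk t ht) _ (hk s hs) hst y hy
  have hsplit : ∀ μ : ParamBMeasure N, paramIntegral μ y s t = paramIntegral μ y s (q (k s)) +
      paramIntegral μ y (q (k s)) (q (k t)) + paramIntegral μ y (q (k t)) t := fun μ => by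
    let A := min (min s t) (min (q (k s) : ℝ) (q (k t)))
    let B := max (max s t) (max (q (k s) : ℝ) (q (k t)))
    have m₁ : s ∈ Icc A B := ⟨by simp [A], by simp [B]⟩
    have m₂ : t ∈ Icc A B := ⟨by simp [A], by simp [B]⟩
    have m₃ : (q (k s) : ℝ) ∈ Icc A B := ⟨by simp [A], by simp [B]⟩
    have m₄ : (q (k t) : ℝ) ∈ Icc A B := ⟨by simp [A], by simp [B]⟩
    rw [paramIntegral_add μ hy.1.continuousOn m₁ m₃ m₄, paramIntegral_add μ hy.1.continuousOn m₁ m₄ m₂]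
  rw [hsplit, hsplit]
  have e₁ := abs_le.1 (hends _ hfx s _ (hnear s))
  have e₂ := abs_le.1 (hends _ hν s _ (hnear s))
  have e₃ := abs_le.1 (hends _ hfx _ t (by rw [abs_sub_comm]; exact hnear t))
  have e₄ := abs_le.1 (hends _ hν _ t (by rw [abs_sub_comm]; exact hnear t))
  rw [abs_le] at hmid ⊢
  constructor <;> linarith [hmid.1, hmid.2, e₁.1, e₁.2, e₂.1, e₂.2, e₃.1, e₃.2, e₄.1, e₄.2]

/-! ### Continuity of translations and continuous dependence of solutions -/

/-- Translation moves the interval and the curve instead of the measure. Three errors remain: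
replacing `f x` by `ν` (uniform over test curves, so the moving curve is no obstacle), moving the
endpoints (small by the modulus of `m j`), and replacing the curve shifted by `τ x` with the one
shifted by `c` (small by the equicontinuity of the curve and the Lipschitz bound of `ν`). -/
theorem tendsto_translate {m : ℕ → Measure ℝ}
    (hm_equi : ∀ j, 1 ≤ j → EquicontinuousFamily (fun τ : ℝ => translateMeasure (m j) τ))
    {X : Type*} {l : Filter X} {f : X → VecParamBMeasure N} {ν : VecParamBMeasure N}
    (h : Tendsto f l (@nhds _ (thetaTopology N m) ν)) (hf : ∀ᶠ x in l, HasModulusBounds m (f x))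
    (hν : HasModulusBounds m ν) {τ : X → ℝ} {c : ℝ} (hτ : Tendsto τ l (𝓝 c)) :
    Tendsto (fun x => (f x).translate (τ x)) l (@nhds _ (thetaTopology N m) (ν.translate c)) := by
  rw [tendsto_thetaTopology_iff]
  intro i I j hj ε hε
  set a : ℝ := ((I.1.1 : ℚ) : ℝ)
  set b : ℝ := ((I.1.2 : ℚ) : ℝ)
  have hab : a ≤ b := by
    simp only [a, b]
    exact_mod_cast I.2.le
  obtain ⟨L, hLm, hL⟩ : ∃ L : ℝ → ℝ, Monotone L ∧ (ν i).LDom j L := by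
    obtain ⟨L, -, hL⟩ := (ν i).exists_lDom j
    exact ⟨L, hL.1, hL⟩
  have hΔ : 0 ≤ L (b + c) - L (a + c) := sub_nonneg.2 (hLm (by linarith))
  set K := (L (b + c) - L (a + c)) * √N
  have hK : 0 ≤ K := by positivity
  obtain ⟨δ₁, hδ₁, h₁⟩ := exists_translateModulus_le (hm_equi j hj) (ε := ε / 8) (by linarith)
  obtain ⟨δ₂, hδ₂, h₂⟩ := exists_translateModulus_le (hm_equi j hj) (ε := ε / 4 / (K + 1))
    (by positivity)
  filter_upwards [eventually_abs_paramIntegral_sub_le hm_equi h hf hν hj (a + c - 1) (b + c + 1)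
    (show 0 < ε / 4 by linarith), hτ.eventually (Metric.ball_mem_nhds c one_pos),
    hτ.eventually (Metric.ball_mem_nhds c hδ₁), hτ.eventually (Metric.ball_mem_nhds c hδ₂)]
    with x hx k₀ k₁ k₂ y hy
  rw [Real.dist_eq] at k₀ k₁ k₂
  have hyc : ContinuousOn y (uIcc a b) := continuousOn_of_mem_admissibleCurves hy
  obtain ⟨z, hz, hyz⟩ := exists_globalCurve (hm_equi j hj) hab hy.1 hy.2.1 fun s hs t ht => by
    rw [← moduliOf_eq m j I]
    exact hy.2.2 s hs t ht
  have hyz' : EqOn y z (uIcc a b) := by rwa [uIcc_of_le hab]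
  have hzτ := comp_sub_mem_globalCurves hz (τ x)
  have hzc := comp_sub_mem_globalCurves hz c
  rw [paramIntegral_congr _ hyc hyz', paramIntegral_congr _ hyc hyz']
  change |paramIntegral ((f x i).translate (τ x)) z a b -
    paramIntegral ((ν i).translate c) z a b| ≤ ε
  rw [paramIntegral_translate _ _ hz.1.continuousOn, paramIntegral_translate _ _ hz.1.continuousOn]
  have k₀' := abs_lt.1 k₀
  have e₁ := hx _ hzτ (a + τ x) ⟨by linarith, by linarith⟩ (b + τ x) ⟨by linarith, by linarith⟩ i
  have e₂ : ∀ u, |paramIntegral (ν i) (fun s => z (s - τ x)) (u + c) (u + τ x)| ≤ ε / 8 := fun u =>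
    (hν.abs_paramIntegral_le hj i hzτ.1.continuousOn fun s _ => hzτ.2.1 s).trans
      (h₁ _ (by rwa [add_sub_add_left_eq_sub]))
  have e₃ : |paramIntegral (ν i) (fun s => z (s - τ x)) (a + c) (b + c) -
      paramIntegral (ν i) (fun s => z (s - c)) (a + c) (b + c)| ≤ ε / 4 := by
    refine (hL.abs_paramIntegral_sub_le (η := √N * (ε / 4 / (K + 1))) hzτ.1.continuousOn
      hzc.1.continuousOn (fun s _ => hzτ.2.1 s) (fun s _ => hzc.2.1 s) fun s _ => ?_).trans ?_
    · refine (hz.2.2 _ _).trans (mul_le_mul_of_nonneg_left (h₂ _ ?_) (Real.sqrt_nonneg _))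
      rwa [sub_sub_sub_cancel_left, abs_sub_comm]
    · rw [abs_of_nonneg hΔ, ← mul_assoc, mul_div_assoc', div_le_iff₀ (by linarith)]
      change K * _ ≤ _
      nlinarith
  have hsplit : paramIntegral (ν i) (fun s => z (s - τ x)) (a + τ x) (b + τ x) =
      paramIntegral (ν i) (fun s => z (s - τ x)) (a + c) (b + c) +
      paramIntegral (ν i) (fun s => z (s - τ x)) (b + c) (b + τ x) -
      paramIntegral (ν i) (fun s => z (s - τ x)) (a + c) (a + τ x) := by
    have hco : ContinuousOn (fun s => z (s - τ x)) (Icc (a + c - 1) (b + c + 1)) :=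
      hzτ.1.continuousOn
    have m₁ : a + τ x ∈ Icc (a + c - 1) (b + c + 1) := ⟨by linarith, by linarith⟩
    have m₂ : b + τ x ∈ Icc (a + c - 1) (b + c + 1) := ⟨by linarith, by linarith⟩
    have m₃ : a + c ∈ Icc (a + c - 1) (b + c + 1) := ⟨by linarith, by linarith⟩
    have m₄ : b + c ∈ Icc (a + c - 1) (b + c + 1) := ⟨by linarith, by linarith⟩
    rw [paramIntegral_add _ hco m₃ m₄ m₂, ← paramIntegral_add _ hco m₃ m₁ m₂]
    ring
  have e₄ := abs_le.1 (e₂ a)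
  have e₅ := abs_le.1 (e₂ b)
  rw [abs_le] at e₁ e₃ ⊢
  constructor <;> linarith [e₁.1, e₁.2, e₃.1, e₃.2, e₄.1, e₄.2, e₅.1, e₅.2]

theorem translate_mem_hull {m : ℕ → Measure ℝ} {ν₀ ν : VecParamBMeasure N}
    (hm_equi : ∀ j, 1 ≤ j → EquicontinuousFamily (fun τ : ℝ => translateMeasure (m j) τ))
    (h₀ : HasModulusBounds m ν₀) (hν : ν ∈ hull (thetaTopology N m) ν₀) (t : ℝ) :
    ν.translate t ∈ hull (thetaTopology N m) ν₀ := by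
  have hb := hasModulusBounds_of_mem_hull hm_equi h₀ hν
  let _ := thetaTopology N m
  obtain ⟨U, hU, hU'⟩ := mem_closure_iff_ultrafilter.1 (show ν ∈ closure _ from hν)
  have hUb : ∀ᶠ μ in (U : Filter (VecParamBMeasure N)), HasModulusBounds m μ := by
    filter_upwards [hU]
    rintro _ ⟨s, rfl⟩
    exact h₀.translate s
  refine mem_closure_of_tendsto
    (tendsto_translate hm_equi (tendsto_id'.2 hU') hUb hb (tendsto_const_nhds (x := t))) ?_
  filter_upwards [hU]
  rintro _ ⟨s, rfl⟩
  exact ⟨t + s, (VecParamBMeasure.translate_translate ν₀ s t).symm⟩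

/-! ### The hull as a flow, and continuous dependence on its elements -/

theorem tendsto_hullSpace_val {T : TopologicalSpace (VecParamBMeasure N)} {ν₀ : VecParamBMeasure N}
    (ν : HullSpace T ν₀) :
    Tendsto (fun μ : HullSpace T ν₀ => μ.1) (𝓝 ν) (@nhds _ T ν.1) :=
  (@continuous_subtype_val _ T (fun μ => μ ∈ hull T ν₀)).tendsto ν

theorem tendsto_hullSpace_iff {T : TopologicalSpace (VecParamBMeasure N)} {ν₀ : VecParamBMeasure N}
    {X : Type*} {l : Filter X} {f : X → HullSpace T ν₀} {ν : HullSpace T ν₀} :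
    Tendsto f l (𝓝 ν) ↔ Tendsto (fun x => (f x).1) l (@nhds _ T ν.1) :=
  let _ := T
  tendsto_subtype_rng (p := fun μ => μ ∈ hull T ν₀)

/-- The translation flow on the hull. -/
noncomputable def hullFlow {m : ℕ → Measure ℝ} {ν₀ : VecParamBMeasure N}
    (hm_equi : ∀ j, 1 ≤ j → EquicontinuousFamily (fun τ : ℝ => translateMeasure (m j) τ))
    (h₀ : HasModulusBounds m ν₀) : Flow ℝ (HullSpace (thetaTopology N m) ν₀) where
  toFun t ν := ⟨ν.1.translate t, translate_mem_hull hm_equi h₀ ν.2 t⟩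
  cont' := by
    refine continuous_iff_continuousAt.2 fun ⟨t, ν⟩ => ?_
    refine tendsto_hullSpace_iff.2 (tendsto_translate hm_equi
      (f := fun x : ℝ × HullSpace (thetaTopology N m) ν₀ => x.2.1) (τ := fun x => x.1) ?_
      (Eventually.of_forall fun x => hasModulusBounds_of_mem_hull hm_equi h₀ x.2.2)
      (hasModulusBounds_of_mem_hull hm_equi h₀ ν.2) (continuous_fst.tendsto _))
    exact (tendsto_hullSpace_val ν).comp (continuous_snd.tendsto (t, ν))
  map_add' s t ν := Subtype.ext (VecParamBMeasure.translate_translate ν.1 t s).symm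
  map_zero' ν := Subtype.ext (VecParamBMeasure.translate_zero ν.1)

/-- This is the reason for the choice of the moduli: truncated solutions of every equation with
these bounds share the modulus `√N * translateModulus (m j)`. Only the clamped curve, which enters
the integral, has to lie in the ball of radius `j`. -/
theorem HasModulusBounds.norm_sub_le_of_solvesOn {m : ℕ → Measure ℝ} {ν : VecParamBMeasure N}
    (h : HasModulusBounds m ν) {j : ℕ} (hj : 1 ≤ j) {R : ℝ} (hR : 0 ≤ R) (hRj : √N * R ≤ j)
    {y : ℝ → Euc N} {a b : ℝ} (hy : SolvesOn ν (Euc.clamp R) y a b) :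
    ∀ s ∈ Icc a b, ∀ t ∈ Icc a b, ‖y s - y t‖ ≤ √N * translateModulus (m j) |s - t| := by
  intro s hs t ht
  refine Euc.norm_le_sqrt_mul (translateModulus_nonneg _ _) fun i => ?_
  rw [PiLp.sub_apply, hy.2 t ht s hs i]
  exact h.abs_paramIntegral_le hj i
    ((Euc.continuous_clamp R).comp_continuousOn (hy.1.mono (uIcc_subset_Icc ht hs)))
    fun x _ => (Euc.norm_clamp_le hR _).trans hRj

/-- Continuous dependence of the solutions on the equation and the initial value, uniformly near
a compact interval of existence. -/
theorem exists_uniform_solution {m : ℕ → Measure ℝ}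
    (hm_equi : ∀ j, 1 ≤ j → EquicontinuousFamily (fun τ : ℝ => translateMeasure (m j) τ))
    {X : Type*} {l : Filter X} {f : X → VecParamBMeasure N} {ν : VecParamBMeasure N}
    (h : Tendsto f l (@nhds _ (thetaTopology N m) ν)) (hf : ∀ᶠ x in l, HasModulusBounds m (f x))
    (hν : HasModulusBounds m ν) {Y : X → Euc N} {y₀ : Euc N} (hY : Tendsto Y l (𝓝 y₀)) {t : ℝ}
    (ht : t ∈ maximalInterval ν y₀) :
    ∃ (A B : ℝ) (z : ℝ → Euc N), A < t ∧ t < B ∧ ContinuousOn z (Icc A B) ∧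
      z t = solution ν y₀ t ∧ ∀ η : ℝ, 0 < η → ∀ᶠ x in l, ∀ s ∈ Icc A B,
        s ∈ maximalInterval (f x) (Y x) ∧ ‖solution (f x) (Y x) s - z s‖ ≤ η := by
  obtain ⟨a, b, y, hy, htab⟩ := ht
  have hyt := hy.eq_solution htab
  rw [isSolution_iff] at hy
  obtain ⟨δ, R, z, hδ, hR, hz, hyz, hzR⟩ := hy.2.1.exists_extension hy.1
  have h0 : (0 : ℝ) ∈ Icc (a - δ) (b + δ) := ⟨by linarith [hy.1.1], by linarith [hy.1.2]⟩
  have hAB : a - δ ≤ b + δ := h0.1.trans h0.2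
  have hz0 : z 0 = y₀ := by rw [← hyz hy.1, hy.2.2]
  refine ⟨a - δ, b + δ, z, by linarith [htab.1], by linarith [htab.2], hz.1,
    by rw [← hyz htab, hyt], fun η hη => ?_⟩
  obtain ⟨x₀, hx₀, hmax⟩ := isCompact_Icc.exists_isMaxOn ⟨0, h0⟩ hz.1.norm
  -- The second term is the gap between the maximum of `‖z‖` and the truncation level: within
  -- distance `ρ` of `z` the truncation is inactive.
  set ρ := min η (R - ‖z x₀‖)
  have hρ : 0 < ρ := lt_min hη (sub_pos.2 (hzR x₀ hx₀))
  obtain ⟨C, hC, hest⟩ := exists_clamp_estimate ν hR hAB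
  obtain ⟨j, hj, hRj⟩ := exists_nat_one_le_ge (√N * R)
  have hcl := Euc.continuous_clamp (N := N) R
  choose w hw hw0 using fun x => exists_solvesOn_clamp (f x) hR h0 (Y x)
  have hC₀ : 0 < C := by linarith
  -- Half of `ρ / C` is allotted to the initial values and half to `√N` times the error of the
  -- integrals.
  have hε : 0 < ρ / (2 * C * (√N + 1)) := by positivity
  filter_upwards [eventually_abs_paramIntegral_sub_le hm_equi h hf hν hj (a - δ) (b + δ) hε, hf,
    hY.eventually (Metric.ball_mem_nhds y₀ (show 0 < ρ / (2 * C) by positivity))] with x hx hfx hYx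
  have hmod := hfx.norm_sub_le_of_solvesOn hj hR hRj (hw x)
  -- The clamped solution `w x` varies with `x`, but it coincides on the interval with a global test
  -- curve, along which the convergence of `f` is uniform.
  obtain ⟨u, hu, hwu⟩ := exists_globalCurve (hm_equi j hj) hAB (hcl.comp_continuousOn (hw x).1)
    (fun s _ => (Euc.norm_clamp_le hR _).trans hRj)
    fun s hs t ht => (Euc.norm_clamp_sub_le R _ _).trans (hmod s hs t ht)
  have hclose : ∀ s ∈ Icc (a - δ) (b + δ), ‖w x s - z s‖ ≤ ρ := fun s hs => by
    have := hest (f x) (w x) z _ hε.le (hw x) hz (fun s hs t ht i => by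
      have hsub : uIcc s t ⊆ Icc (a - δ) (b + δ) := uIcc_subset_Icc hs ht
      have hcc := hcl.comp_continuousOn ((hw x).1.mono hsub)
      rw [paramIntegral_congr (f x i) hcc (hwu.mono hsub),
        paramIntegral_congr (ν i) hcc (hwu.mono hsub)]
      exact hx u hu s hs t ht i) 0 h0 s hs
    rw [hw0, hz0, ← dist_eq_norm] at this
    refine this.trans ?_
    have e₁ : dist (Y x) y₀ ≤ ρ / (2 * C) := le_of_lt hYx
    have e₂ : √N * (ρ / (2 * C * (√N + 1))) ≤ ρ / (2 * C) := by
      rw [mul_div_assoc', div_le_div_iff₀ (by positivity) (by positivity)]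
      nlinarith [show 0 < ρ * C by positivity]
    calc C * (dist (Y x) y₀ + √N * (ρ / (2 * C * (√N + 1))))
        ≤ C * (ρ / (2 * C) + ρ / (2 * C)) := by gcongr
      _ = ρ := by field_simp; ring
  have hsol : IsSolution (f x) 0 (Y x) (a - δ) (b + δ) (w x) := by
    refine isSolution_iff.2 ⟨h0, (hw x).of_clamp fun s hs => ?_, hw0 x⟩
    have e₁ := (hclose s hs).trans (min_le_right _ _)
    have e₂ : ‖z s‖ ≤ ‖z x₀‖ := hmax hs
    have e₃ := norm_sub_norm_le (w x s) (z s)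
    linarith
  intro s hs
  refine ⟨⟨_, _, _, hsol, hs⟩, ?_⟩
  rw [← hsol.eq_solution hs]
  exact (hclose s hs).trans (min_le_left _ _)

theorem eventually_mem_maximalInterval {m : ℕ → Measure ℝ}
    (hm_equi : ∀ j, 1 ≤ j → EquicontinuousFamily (fun τ : ℝ => translateMeasure (m j) τ))
    {X : Type*} {l : Filter X} {f : X → VecParamBMeasure N} {ν : VecParamBMeasure N}
    (h : Tendsto f l (@nhds _ (thetaTopology N m) ν)) (hf : ∀ᶠ x in l, HasModulusBounds m (f x))
    (hν : HasModulusBounds m ν) {Y : X → Euc N} {y₀ : Euc N} (hY : Tendsto Y l (𝓝 y₀)) {t : ℝ}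
    (ht : t ∈ maximalInterval ν y₀) {τ : X → ℝ} (hτ : Tendsto τ l (𝓝 t)) :
    (∀ᶠ x in l, τ x ∈ maximalInterval (f x) (Y x)) ∧
      Tendsto (fun x => solution (f x) (Y x) (τ x)) l (𝓝 (solution ν y₀ t)) := by
  obtain ⟨A, B, z, hA, hB, hz, hzt, hη⟩ := exists_uniform_solution hm_equi h hf hν hY ht
  have hmem := hτ.eventually (Icc_mem_nhds hA hB)
  refine ⟨?_, ?_⟩
  · filter_upwards [hη 1 one_pos, hmem] with x hx hx'
    exact (hx _ hx').1
  · rw [← hzt, Metric.tendsto_nhds]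
    intro ε hε
    have hzc := ((hz.continuousAt (Icc_mem_nhds hA hB)).tendsto.comp hτ).eventually
      (Metric.ball_mem_nhds _ (half_pos hε))
    filter_upwards [hη (ε / 2) (half_pos hε), hmem, hzc] with x hx hx' hx''
    have e₁ := (hx _ hx').2
    rw [← dist_eq_norm] at e₁
    have e₂ : dist (z (τ x)) (z t) < ε / 2 := hx''
    linarith [dist_triangle (solution (f x) (Y x) (τ x)) (z (τ x)) (z t)]

theorem isLocalContinuousSkewProductFlow {m : ℕ → Measure ℝ} {ν₀ : VecParamBMeasure N}
    (hm_equi : ∀ j, 1 ≤ j → EquicontinuousFamily (fun τ : ℝ => translateMeasure (m j) τ))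
    (h₀ : HasModulusBounds m ν₀) :
    IsLocalContinuousSkewProductFlow (hullFlow hm_equi h₀) (flowDomain (thetaTopology N m) ν₀)
      (fun p => (hullFlow hm_equi h₀ p.1 p.2.1, solution p.2.1.1 p.2.2 p.1)) := by
  -- Openness of the domain and continuity of the solution are both instances of the convergence
  -- result, with the neighbourhood filter of `p` as `l`.
  have hdep : ∀ p ∈ flowDomain (thetaTopology N m) ν₀,
      (∀ᶠ q in 𝓝 p, q ∈ flowDomain (thetaTopology N m) ν₀) ∧
      Tendsto (fun q : ℝ × HullSpace (thetaTopology N m) ν₀ × Euc N => solution q.2.1.1 q.2.2 q.1)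
        (𝓝 p) (𝓝 (solution p.2.1.1 p.2.2 p.1)) := fun p hp =>
    eventually_mem_maximalInterval hm_equi (l := 𝓝 p) (f := fun q => q.2.1.1)
      (Y := fun q => q.2.2) (τ := fun q => q.1)
      ((tendsto_hullSpace_val p.2.1).comp ((continuous_fst.comp continuous_snd).tendsto p))
      (Eventually.of_forall fun q => hasModulusBounds_of_mem_hull hm_equi h₀ q.2.1.2)
      (hasModulusBounds_of_mem_hull hm_equi h₀ p.2.1.2)
      ((continuous_snd.comp continuous_snd).tendsto p) hp (continuous_fst.tendsto p)
  refine ⟨⟨isOpen_iff_mem_nhds.2 fun p hp => (hdep p hp).1,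
    fun x => ordConnected_maximalInterval x.1.1 x.2, fun x => zero_mem_maximalInterval x.1.1 x.2,
    fun x => Prod.ext ((hullFlow hm_equi h₀).map_zero' x.1) (solution_zero x.1.1 x.2),
    fun s t x hs => mem_maximalInterval_translate_iff hs,
    fun s t x hs hts => Prod.ext ((hullFlow hm_equi h₀).map_add' t s x.1) (solution_translate hs hts),
    fun p hp => ?_⟩, fun p _ => rfl⟩
  refine ContinuousAt.continuousWithinAt (Tendsto.prodMk_nhds ?_ (hdep p hp).2)
  have hc : Continuous fun q : ℝ × HullSpace (thetaTopology N m) ν₀ × Euc N =>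
      hullFlow hm_equi h₀ q.1 q.2.1 :=
    (hullFlow hm_equi h₀).cont'.comp (continuous_fst.prodMk (continuous_fst.comp continuous_snd))
  exact hc.tendsto p

/-! ### b-measures from distribution functions -/

/-- The sum of a Stieltjes function and a continuous function, if it is monotone. -/
noncomputable def StieltjesFunction.addContinuous (S : StieltjesFunction ℝ) (g : ℝ → ℝ)
    (hg : Continuous g) (h : Monotone fun t => S t + g t) : StieltjesFunction ℝ where
  toFun t := S t + g t
  mono' := h
  right_continuous' t := (S.right_continuous t).add hg.continuousWithinAt

/-- A continuous summand leaves the jumps unchanged; equality of atoms is what `BMeasure.ofMeasures`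
requires of the pair. -/
theorem StieltjesFunction.addContinuous_measure_singleton (S : StieltjesFunction ℝ) (g : ℝ → ℝ)
    (hg : Continuous g) (h : Monotone fun t => S t + g t) (t : ℝ) :
    (S.addContinuous g hg h).measure {t} = S.measure {t} := by
  have : Function.leftLim (S.addContinuous g hg h) t = Function.leftLim S t + g t :=
    leftLim_eq_of_tendsto
      ((S.mono.tendsto_leftLim t).add (hg.tendsto t |>.mono_left nhdsWithin_le_nhds))
  rw [StieltjesFunction.measure_singleton, StieltjesFunction.measure_singleton, this]
  change ENNReal.ofReal (S t + g t - _) = _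
  rw [add_sub_add_right_eq_sub]

theorem BMeasure.ofMeasures_addContinuous_Icc (S : StieltjesFunction ℝ) (g : ℝ → ℝ)
    (hg : Continuous g) (h : Monotone fun t => S t + g t) {s t : ℝ} (hst : s ≤ t) :
    BMeasure.ofMeasures (S.addContinuous g hg h).measure S.measure
      (S.addContinuous_measure_singleton g hg h) (Icc s t) = g t - g s := by
  rw [BMeasure.Icc_eq_Ioc _ hst, BMeasure.ofMeasures_apply _ (Ioc_mem_boundedBorel s t),
    Measure.real, Measure.real, StieltjesFunction.measure_Ioc, StieltjesFunction.measure_Ioc,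
    ENNReal.toReal_ofReal (sub_nonneg.2 (StieltjesFunction.mono _ hst)),
    ENNReal.toReal_ofReal (sub_nonneg.2 (S.mono hst))]
  change S t + g t - (S s + g s) - _ = _
  ring

/-- A Jordan decomposition: `g = (M + g) - M` is a difference of two monotone functions, because `M`
dominates the increments of `g`. -/
theorem BMeasure.exists_of_increments_le {g M : ℝ → ℝ} (hg : Continuous g) (hM : Monotone M)
    (hMc : Continuous M) (h : ∀ s t, s ≤ t → |g t - g s| ≤ M t - M s) :
    ∃ μ : BMeasure, ∀ s t, s ≤ t → μ (Icc s t) = g t - g s := by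
  let S : StieltjesFunction ℝ := ⟨M, hM, fun _ => hMc.continuousWithinAt⟩
  have hS : Monotone fun t => S t + g t := fun s t hst => by
    have := (abs_le.1 (h s t hst)).1
    change M s + g s ≤ M t + g t
    linarith
  exact ⟨_, fun s t hst => BMeasure.ofMeasures_addContinuous_Icc S g hg hS hst⟩

/-- Both `S + μ.cdf` and `S - μ.cdf` are monotone, so `S + μ` and `S - μ` are given by positive
measures `P` and `Q`. Their nonnegativity on `A` is the claim, with no need of a Hahn decomposition.
-/
theorem BMeasure.enorm_le_stieltjes {μ : BMeasure} (hμ : Continuous μ.cdf)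
    (S : StieltjesFunction ℝ) (h : ∀ s t, s ≤ t → |μ (Icc s t)| ≤ S t - S s) {A : Set ℝ}
    (hA : A ∈ boundedBorel) : ‖μ A‖ₑ ≤ S.measure A := by
  have h' : ∀ s t, s ≤ t → |μ.cdf t - μ.cdf s| ≤ S t - S s := fun s t hst => by
    rw [← μ.Icc_eq_cdf hst]
    exact h s t hst
  have hP : Monotone fun t => S t + μ.cdf t := fun s t hst => by
    have := (abs_le.1 (h' s t hst)).1
    simp only
    linarith
  have hQ : Monotone fun t => S t + -μ.cdf t := fun s t hst => by
    have := (abs_le.1 (h' s t hst)).2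
    simp only
    linarith
  let P := S.addContinuous μ.cdf hμ hP
  let Q := S.addContinuous (fun t => -μ.cdf t) hμ.neg hQ
  have hPQ : P.measure + Q.measure = S.measure + S.measure := by
    rw [← StieltjesFunction.measure_add, ← StieltjesFunction.measure_add]
    congr 1
    ext t
    change S t + μ.cdf t + (S t + -μ.cdf t) = S t + S t
    ring
  have hμP : μ = BMeasure.ofMeasures P.measure S.measure
      (S.addContinuous_measure_singleton _ hμ hP) := BMeasure.ext_of_Icc fun s t hst => by
    rw [BMeasure.ofMeasures_addContinuous_Icc S _ hμ hP hst, μ.Icc_eq_cdf hst]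
  have hfin : ∀ F : StieltjesFunction ℝ, F.measure A ≠ ∞ := fun F => hA.2.measure_lt_top.ne
  have e : P.measure.real A + Q.measure.real A = S.measure.real A + S.measure.real A := by
    have := congrArg (fun m : Measure ℝ => m A) hPQ
    simp only [Measure.add_apply] at this
    simp only [Measure.real]
    rw [← ENNReal.toReal_add (hfin _) (hfin _), this, ENNReal.toReal_add (hfin _) (hfin _)]
  have hval : μ A = P.measure.real A - S.measure.real A := by
    rw [hμP, BMeasure.ofMeasures_apply _ hA]
  rw [← ofReal_measureReal (hfin S), Real.enorm_le_ofReal_iff measureReal_nonneg, hval, abs_le]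
  have := measureReal_nonneg (μ := P.measure) (s := A)
  have := measureReal_nonneg (μ := Q.measure) (s := A)
  constructor <;> linarith

theorem BMeasure.apply_diff_countable (μ : BMeasure) {A B : Set ℝ} (hA : A ∈ boundedBorel)
    (hB : B.Countable) : μ (A \ B) = μ A := by
  have h₀ : μ.restrictSigned A hA B = 0 := by
    have := (μ.restrictSigned A hA).of_biUnion (f := fun x : ℝ => {x}) hB
      (fun x _ y _ hxy => by simpa [Function.onFun] using hxy) fun x _ => measurableSet_singleton x
    rw [biUnion_of_singleton] at this
    rw [this]
    refine (tsum_congr fun x => ?_).trans tsum_zero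
    rw [μ.restrictSigned_apply _ (measurableSet_singleton _)]
    by_cases hx : (x : ℝ) ∈ A
    · rw [singleton_inter_of_mem hx, μ.map_singleton]
    · rw [singleton_inter_eq_empty.2 hx, μ.map_empty]
  have h₁ := (μ.restrictSigned A hA).of_add_of_sdiff hB.measurableSet .univ (subset_univ B)
  rw [h₀, zero_add, μ.restrictSigned_apply _ .univ,
    μ.restrictSigned_apply _ (MeasurableSet.univ.diff hB.measurableSet), univ_inter] at h₁
  rw [← h₁]
  congr 1
  ext x
  simp [and_comm]

/-- Increments of a monotone function which dominate the values of b-measures on intervals give a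
bound for their total variation, by a measure without atoms. -/
theorem exists_continuousMeasure_of_monotone {F : ℝ → ℝ} (hF : Monotone F) :
    ∃ m, IsContinuousMeasure m ∧ ∀ (μ : BMeasure) (c : ℝ), 0 ≤ c → Continuous μ.cdf →
      (∀ s t, s ≤ t → |μ (Icc s t)| ≤ (F t - F s) * c) →
      ∀ A ∈ boundedBorel, μ.variation A ≤ m A * ENNReal.ofReal c := by
  let S := hF.stieltjesFunction
  let B : Set ℝ := {x | Function.leftLim S x ≠ S x}
  have hB : B.Countable := S.countable_leftLim_ne
  -- `F` may jump, as limits of Lipschitz functions can. The atoms of its right-continuous version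
  -- lie in the countable set `B`, which the b-measures do not charge, so `B` can be removed.
  refine ⟨S.measure.restrict Bᶜ, ⟨inferInstance, fun t => ?_⟩, fun μ c hc hμ h => ?_⟩
  · rw [Measure.restrict_apply (measurableSet_singleton t)]
    by_cases ht : t ∈ B
    · simp [ht]
    · refine measure_mono_null inter_subset_left ?_
      have ht' : Function.leftLim S t = S t := not_not.1 ht
      rw [StieltjesFunction.measure_singleton, ht', sub_self, ENNReal.ofReal_zero]
  · let c' : NNReal := ⟨c, hc⟩
    have hS : ∀ s t, s ≤ t → |μ (Icc s t)| ≤ (c' • S) t - (c' • S) s := fun s t hst => by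
      change _ ≤ c * S t - c * S s
      rw [μ.Icc_eq_cdf hst, ← mul_sub, mul_comm]
      have hshift : ∀ u : ℝ, Tendsto (fun h => u + h) (𝓝[>] 0) (𝓝[>] u) := fun u => by
        refine tendsto_nhdsWithin_iff.2 ⟨?_, ?_⟩
        · have : Tendsto (fun h => u + h) (𝓝 0) (𝓝 (u + 0)) := (continuous_const_add u).tendsto 0
          rw [add_zero] at this
          exact this.mono_left nhdsWithin_le_nhds
        · filter_upwards [self_mem_nhdsWithin] with h hh
          exact lt_add_of_pos_right u hh
      have hr : ∀ u, Tendsto (fun h => F (u + h)) (𝓝[>] 0) (𝓝 (S u)) := fun u =>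
        (hF.tendsto_rightLim u).comp (hshift u)
      have hg : ∀ u, Tendsto (fun h => μ.cdf (u + h)) (𝓝[>] 0) (𝓝 (μ.cdf u)) := fun u =>
        ((hμ.tendsto u).mono_left nhdsWithin_le_nhds).comp (hshift u)
      -- The inequality for `F` at `s + x` and `t + x` passes to right limits, because the
      -- distribution function of `μ` is continuous.
      refine le_of_tendsto_of_tendsto' ((hg t).sub (hg s)).abs (((hr t).sub (hr s)).mul_const c)
        fun x => ?_
      rw [← μ.Icc_eq_cdf (by linarith)]
      exact h _ _ (by linarith)
    intro A hA
    have := BMeasure.variation_le (μ := μ) (m := ENNReal.ofReal c • S.measure.restrict Bᶜ)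
      (fun A hA => ?_) A hA
    · rwa [Measure.smul_apply, smul_eq_mul, mul_comm] at this
    · have hAB : A \ B ∈ boundedBorel := ⟨hA.1.diff hB.measurableSet, hA.2.subset sdiff_subset⟩
      rw [← μ.apply_diff_countable hA hB]
      refine (BMeasure.enorm_le_stieltjes hμ _ hS hAB).trans ?_
      rw [StieltjesFunction.measure_smul, Measure.smul_apply, Measure.smul_apply,
        Measure.restrict_apply hA.1, ← sdiff_eq]
      rw [ENNReal.smul_def, ENNReal.ofReal, Real.toNNReal_of_nonneg hc]
      exact le_rfl

theorem BMeasure.cdf_eq_sub {μ : BMeasure} {g : ℝ → ℝ}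
    (h : ∀ s t, s ≤ t → μ (Icc s t) = g t - g s) (t : ℝ) : μ.cdf t = g t - g 0 := by
  rcases le_total 0 t with ht | ht
  · rw [← h 0 t ht, μ.Icc_eq_cdf ht, μ.cdf_zero, sub_zero]
  · rw [← neg_sub, ← h t 0 ht, μ.Icc_eq_cdf ht, μ.cdf_zero, zero_sub, neg_neg]

/-- Construction of parametric b-measures from families of distribution functions. -/
theorem ParamBMeasure.exists_of_increments_le {g : Euc N → ℝ → ℝ} {M L : ℕ → ℝ → ℝ}
    (hM : ∀ j : ℕ, 1 ≤ j → Monotone (M j) ∧ Continuous (M j)) (hL : ∀ j : ℕ, 1 ≤ j → Monotone (L j))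
    (hgM : ∀ j : ℕ, 1 ≤ j → ∀ y : Euc N, ‖y‖ ≤ j → ∀ s t, s ≤ t → |g y t - g y s| ≤ M j t - M j s)
    (hgL : ∀ j : ℕ, 1 ≤ j → ∀ y z : Euc N, ‖y‖ ≤ j → ‖z‖ ≤ j → ∀ s t, s ≤ t →
      |(g y t - g y s) - (g z t - g z s)| ≤ (L j t - L j s) * ‖y - z‖) :
    ∃ ν : ParamBMeasure N, ∀ y s t, s ≤ t → ν y (Icc s t) = g y t - g y s := by
  have hgc : ∀ y, Continuous (g y) := fun y => by
    obtain ⟨j, hj, hyj⟩ := exists_nat_one_le_ge ‖y‖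
    have key : ∀ s t, |g y t - g y s| ≤ |M j t - M j s| := by
      refine uIcc_wlog (fun s t h => ?_) fun s t hst => ?_
      · rwa [abs_sub_comm, abs_sub_comm (M j s)]
      · exact (hgM j hj y hyj s t hst).trans (le_abs_self _)
    rw [continuous_iff_continuousAt]
    intro s
    rw [ContinuousAt, tendsto_iff_dist_tendsto_zero]
    refine squeeze_zero (fun _ => dist_nonneg) (fun t => key s t) ?_
    have : Tendsto (fun t => |M j t - M j s|) (𝓝 s) (𝓝 |M j s - M j s|) :=
      (((hM j hj).2.tendsto s).sub_const _).abs
    rwa [sub_self, abs_zero] at this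
  have hex : ∀ y, ∃ μ : BMeasure, ∀ s t, s ≤ t → μ (Icc s t) = g y t - g y s := fun y => by
    obtain ⟨j, hj, hyj⟩ := exists_nat_one_le_ge ‖y‖
    exact BMeasure.exists_of_increments_le (hgc y) (hM j hj).1 (hM j hj).2 (hgM j hj y hyj)
  choose μ hμ using hex
  have hcdf : ∀ y, Continuous (μ y).cdf := fun y => by
    have : (μ y).cdf = fun t => g y t - g y 0 := funext (BMeasure.cdf_eq_sub (hμ y))
    rw [this]
    exact (hgc y).sub continuous_const
  refine ⟨⟨μ, fun j hj => ?_, fun j hj => ?_⟩, hμ⟩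
  · obtain ⟨m, hm, h⟩ := exists_continuousMeasure_of_monotone (hM j hj).1
    refine ⟨m, hm, fun A hA y hy => ?_⟩
    have := h (μ y) 1 zero_le_one (hcdf y) (fun s t hst => by
      rw [hμ y s t hst, mul_one]
      exact hgM j hj y hy s t hst) A hA
    rwa [ENNReal.ofReal_one, mul_one] at this
  · obtain ⟨l, hl, h⟩ := exists_continuousMeasure_of_monotone (hL j hj)
    refine ⟨l, hl, fun A hA y z hy hz => h (μ y - μ z) _ (norm_nonneg _) ?_ (fun s t hst => ?_) A hA⟩
    · have : (μ y - μ z).cdf = fun t => (μ y).cdf t - (μ z).cdf t :=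
        funext (BMeasure.cdf_sub (μ y) (μ z))
      rw [this]
      exact (hcdf y).sub (hcdf z)
    · rw [BMeasure.sub_apply, hμ y s t hst, hμ z s t hst]
      exact hgL j hj y z hy hz s t hst

/-! ### Compactness of the hull -/

/-- Bounds which are uniform under translations, both for the variation and for the Lipschitz
constants. -/
def HasUniformBounds (m : ℕ → Measure ℝ) (c : ℕ → ℝ) (ν : VecParamBMeasure N) : Prop :=
  HasModulusBounds m ν ∧ ∀ j : ℕ, 1 ≤ j → ∃ L : ℝ → ℝ, Monotone L ∧
    (∀ s t, s ≤ t → L t - L s ≤ c j * (t - s + 1)) ∧ ∀ i, (ν i).LDom j L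

theorem HasUniformBounds.translate {m : ℕ → Measure ℝ} {c : ℕ → ℝ} {ν : VecParamBMeasure N}
    (h : HasUniformBounds m c ν) (a : ℝ) : HasUniformBounds m c (ν.translate a) := by
  refine ⟨h.1.translate a, fun j hj => ?_⟩
  obtain ⟨L, hL, hc, hLi⟩ := h.2 j hj
  refine ⟨fun t => L (t + a), fun s t hst => hL (by linarith), fun s t hst => ?_,
    fun i => (hLi i).translate a⟩
  convert hc (s + a) (t + a) (by linarith) using 2
  ring

/-- An interval is covered by `⌈t - s⌉₊` unit intervals. The resulting bound depends only on the
length and therefore survives translations and limits. -/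
theorem sub_le_of_boundedFamily {l : Measure ℝ} {c : ℝ} {L : ℝ → ℝ} (hc : 0 < c)
    (h : ∀ t, l (Icc t (t + 1)) ≤ ENNReal.ofReal c) (hL : Monotone L)
    (hl : ∀ a b : ℝ, a ≤ b → l (Icc a b) = ENNReal.ofReal (L b - L a)) {s t : ℝ} (hst : s ≤ t) :
    L t - L s ≤ c * (t - s + 1) := by
  have h₁ : ∀ s, L (s + 1) - L s ≤ c := fun s => by
    have := h s
    rwa [hl s (s + 1) (by linarith), ENNReal.ofReal_le_ofReal_iff hc.le] at this
  have h₂ : ∀ n : ℕ, L (s + n) - L s ≤ n * c := fun n => by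
    induction n with
    | zero => simp
    | succ n ih =>
      have := h₁ (s + n)
      push_cast
      rw [← add_assoc]
      linarith
  have h₃ := hL (show t ≤ s + ⌈t - s⌉₊ by linarith [Nat.le_ceil (t - s)])
  have h₄ := Nat.ceil_lt_add_one (sub_nonneg.2 hst)
  nlinarith [h₂ ⌈t - s⌉₊]

/-- Pointwise limits of uniformly bounded families of parametric b-measures. -/
theorem HasUniformBounds.exists_limit {m : ℕ → Measure ℝ} {c : ℕ → ℝ}
    (hm_equi : ∀ j, 1 ≤ j → EquicontinuousFamily (fun τ : ℝ => translateMeasure (m j) τ))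
    (U : Ultrafilter (VecParamBMeasure N))
    (hU : ∀ᶠ μ in (U : Filter (VecParamBMeasure N)), HasUniformBounds m c μ) :
    ∃ ν : VecParamBMeasure N, HasUniformBounds m c ν ∧ ∀ (i : Fin N) (y : Euc N) (s t : ℝ), s ≤ t →
      Tendsto (fun μ : VecParamBMeasure N => μ i y (Icc s t)) U (𝓝 (ν i y (Icc s t))) := by
  -- The bounds hold only for `U`-almost all `μ` and for `j ≥ 1`; the implications allow bounding
  -- functions to be chosen for all `μ` and `j`.
  have hMex : ∀ (μ : VecParamBMeasure N) (j : ℕ), ∃ M : ℝ → ℝ, HasUniformBounds m c μ → 1 ≤ j →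
      Monotone M ∧ (∀ s t, s ≤ t → M t - M s ≤ translateModulus (m j) (t - s)) ∧
      ∀ i, (μ i).MDom j M := fun μ j => by
    by_cases h : HasUniformBounds m c μ ∧ 1 ≤ j
    · obtain ⟨M, hM⟩ := h.1.1 j h.2
      exact ⟨M, fun _ _ => hM⟩
    · exact ⟨0, fun h₁ h₂ => (h ⟨h₁, h₂⟩).elim⟩
  have hLex : ∀ (μ : VecParamBMeasure N) (j : ℕ), ∃ L : ℝ → ℝ, HasUniformBounds m c μ → 1 ≤ j →
      Monotone L ∧ (∀ s t, s ≤ t → L t - L s ≤ c j * (t - s + 1)) ∧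
      ∀ i, (μ i).LDom j L := fun μ j => by
    by_cases h : HasUniformBounds m c μ ∧ 1 ≤ j
    · obtain ⟨L, hL⟩ := h.1.2 j h.2
      exact ⟨L, fun _ _ => hL⟩
    · exact ⟨0, fun h₁ h₂ => (h ⟨h₁, h₂⟩).elim⟩
  choose M hM using hMex
  choose L hL using hLex
  have hM' : ∀ j : ℕ, ∃ M' : ℝ → ℝ, 1 ≤ j → Monotone M' ∧
      (∀ s t, s ≤ t → M' t - M' s ≤ translateModulus (m j) (t - s)) ∧
      ∀ s t, Tendsto (fun μ => M μ j t - M μ j s) U (𝓝 (M' t - M' s)) := fun j => by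
    by_cases hj : 1 ≤ j
    · obtain ⟨M', h⟩ := exists_limit_of_increments_le U (M := fun μ => M μ j)
        (B := translateModulus (m j)) (hU.mono fun μ hμ => ⟨(hM μ j hμ hj).1, (hM μ j hμ hj).2.1⟩)
      exact ⟨M', fun _ => h⟩
    · exact ⟨0, fun h => (hj h).elim⟩
  have hL' : ∀ j : ℕ, ∃ L' : ℝ → ℝ, 1 ≤ j → Monotone L' ∧
      (∀ s t, s ≤ t → L' t - L' s ≤ c j * (t - s + 1)) ∧
      ∀ s t, Tendsto (fun μ => L μ j t - L μ j s) U (𝓝 (L' t - L' s)) := fun j => by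
    by_cases hj : 1 ≤ j
    · obtain ⟨L', h⟩ := exists_limit_of_increments_le U (M := fun μ => L μ j)
        (B := fun u => c j * (u + 1)) (hU.mono fun μ hμ => ⟨(hL μ j hμ hj).1, (hL μ j hμ hj).2.1⟩)
      exact ⟨L', fun _ => h⟩
    · exact ⟨0, fun h => (hj h).elim⟩
  choose M' hM' using hM'
  choose L' hL' using hL'
  -- The limit is taken of the normalized distribution functions, at every real time; since each `y`
  -- lies in some ball, the modulus of `m j` bounds them.
  have hgex : ∀ (i : Fin N) (y : Euc N) (t : ℝ), ∃ l,
      Tendsto (fun μ : VecParamBMeasure N => (μ i y).cdf t) U (𝓝 l) := fun i y t => by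
    obtain ⟨j, hj, hyj⟩ := exists_nat_one_le_ge ‖y‖
    refine U.exists_tendsto_of_abs_le (C := translateModulus (m j) |t|) (hU.mono fun μ hμ => ?_)
    obtain ⟨h₁, h₂, h₃⟩ := hM μ j hμ hj
    rcases le_total 0 t with ht | ht
    · have e₁ := (h₃ i).2 y hyj 0 t ht
      rw [BMeasure.Icc_eq_cdf _ ht, BMeasure.cdf_zero, sub_zero] at e₁
      have e₂ := h₂ 0 t ht
      rw [sub_zero] at e₂
      rw [abs_of_nonneg ht]
      exact e₁.trans e₂
    · have e₁ := (h₃ i).2 y hyj t 0 ht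
      rw [BMeasure.Icc_eq_cdf _ ht, BMeasure.cdf_zero, zero_sub, abs_neg] at e₁
      have e₂ := h₂ t 0 ht
      rw [zero_sub] at e₂
      rw [abs_of_nonpos ht]
      exact e₁.trans e₂
  choose g hg using hgex
  have hgM : ∀ (i : Fin N) (j : ℕ), 1 ≤ j → ∀ y : Euc N, ‖y‖ ≤ j → ∀ s t, s ≤ t →
      |g i y t - g i y s| ≤ M' j t - M' j s := fun i j hj y hy s t hst => by
    refine le_of_tendsto_of_tendsto ((hg i y t).sub (hg i y s)).abs ((hM' j hj).2.2 s t)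
      (hU.mono fun μ hμ => ?_)
    simp only
    rw [← BMeasure.Icc_eq_cdf _ hst]
    exact ((hM μ j hμ hj).2.2 i).2 y hy s t hst
  have hgL : ∀ (i : Fin N) (j : ℕ), 1 ≤ j → ∀ y z : Euc N, ‖y‖ ≤ j → ‖z‖ ≤ j → ∀ s t, s ≤ t →
      |(g i y t - g i y s) - (g i z t - g i z s)| ≤ (L' j t - L' j s) * ‖y - z‖ :=
    fun i j hj y z hy hz s t hst => by
    refine le_of_tendsto_of_tendsto (((hg i y t).sub (hg i y s)).sub
      ((hg i z t).sub (hg i z s))).abs (((hL' j hj).2.2 s t).mul_const _) (hU.mono fun μ hμ => ?_)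
    simp only
    rw [← BMeasure.Icc_eq_cdf _ hst, ← BMeasure.Icc_eq_cdf _ hst]
    exact ((hL μ j hμ hj).2.2 i).2 y z hy hz s t hst
  have hνex : ∀ i, ∃ ν : ParamBMeasure N, ∀ y s t, s ≤ t → ν y (Icc s t) = g i y t - g i y s :=
    fun i => ParamBMeasure.exists_of_increments_le
      (fun j hj => ⟨(hM' j hj).1, continuous_of_sub_le_translateModulus (hm_equi j hj)
        (hM' j hj).1 (hM' j hj).2.1⟩) (fun j hj => (hL' j hj).1) (hgM i) (hgL i)
  choose ν hν using hνex
  refine ⟨ν, ⟨fun j hj => ⟨M' j, (hM' j hj).1, (hM' j hj).2.1, fun i => ⟨(hM' j hj).1,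
    fun y hy s t hst => ?_⟩⟩, fun j hj => ⟨L' j, (hL' j hj).1, (hL' j hj).2.1, fun i =>
      ⟨(hL' j hj).1, fun y z hy hz s t hst => ?_⟩⟩⟩, fun i y s t hst => ?_⟩
  · rw [hν i y s t hst]
    exact hgM i j hj y hy s t hst
  · rw [hν i y s t hst, hν i z s t hst]
    exact hgL i j hj y z hy hz s t hst
  · rw [hν i y s t hst]
    refine ((hg i y t).sub (hg i y s)).congr fun μ => ?_
    rw [BMeasure.Icc_eq_cdf _ hst]

/-- Approximation of integrals by sums over a grid, with values in a finite net. -/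
theorem ParamBMeasure.LDom.abs_paramIntegral_sub_sum_le {ν : ParamBMeasure N} {r : ℝ} {L : ℝ → ℝ}
    (hL : ν.LDom r L) {p : ℕ → ℝ} (hp : Monotone p) (n : ℕ) {y : ℝ → Euc N}
    (hy : ContinuousOn y (Icc (p 0) (p n))) (hyr : ∀ t ∈ Icc (p 0) (p n), ‖y t‖ ≤ r)
    {z : ℕ → Euc N} (hzr : ∀ k < n, ‖z k‖ ≤ r) {η : ℝ}
    (hη : ∀ k < n, ∀ t ∈ Icc (p k) (p (k + 1)), ‖y t - z k‖ ≤ η) :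
    |paramIntegral ν y (p 0) (p n) - ∑ k ∈ Finset.range n, ν (z k) (Icc (p k) (p (k + 1)))| ≤
      (L (p n) - L (p 0)) * η := by
  obtain ⟨J, hJ⟩ := paramIntegral_eq_primitive ν hy
  have hmem : ∀ k ≤ n, p k ∈ Icc (p 0) (p n) := fun k hk => ⟨hp (Nat.zero_le k), hp hk⟩
  rw [hJ _ (hmem 0 (Nat.zero_le n)) _ (hmem n le_rfl), ← Finset.sum_range_sub (fun k => J (p k)),
    ← Finset.sum_range_sub (fun k => L (p k)), ← Finset.sum_sub_distrib, Finset.sum_mul]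
  refine (Finset.abs_sum_le_sum_abs _ _).trans (Finset.sum_le_sum fun k hk => ?_)
  have hk := Finset.mem_range.1 hk
  have hle := hp k.le_succ
  have hsub : uIcc (p k) (p (k + 1)) ⊆ Icc (p 0) (p n) :=
    uIcc_subset_Icc (hmem k hk.le) (hmem (k + 1) hk)
  rw [← hJ _ (hmem k hk.le) _ (hmem (k + 1) hk), ← paramIntegral_const _ _ hle]
  refine (hL.abs_paramIntegral_sub_le (hy.mono hsub) continuousOn_const
    (fun x hx => hyr x (hsub hx)) (fun _ _ => hzr k hk)
    (fun x hx => hη k hk x (by rwa [uIcc_of_le hle] at hx))).trans ?_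
  rw [abs_of_nonneg (sub_nonneg.2 (hL.1 hle))]

/-- Under uniform bounds, pointwise convergence on intervals implies convergence in `σ_Θ`. -/
theorem tendsto_theta_of_tendsto_apply {m : ℕ → Measure ℝ} {c : ℕ → ℝ}
    (hm_equi : ∀ j, 1 ≤ j → EquicontinuousFamily (fun τ : ℝ => translateMeasure (m j) τ))
    {X : Type*} {l : Filter X} {f : X → VecParamBMeasure N} {ν : VecParamBMeasure N}
    (hf : ∀ᶠ x in l, HasUniformBounds m c (f x)) (hν : HasUniformBounds m c ν)
    (h : ∀ (i : Fin N) (y : Euc N) (s t : ℝ), s ≤ t →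
      Tendsto (fun x => f x i y (Icc s t)) l (𝓝 (ν i y (Icc s t)))) :
    Tendsto f l (@nhds _ (thetaTopology N m) ν) := by
  rw [tendsto_thetaTopology_iff]
  intro i I j hj ε hε
  obtain ⟨a, b, hab, ha, hb⟩ : ∃ a b : ℝ, a ≤ b ∧ ((I.1.1 : ℚ) : ℝ) = a ∧ ((I.1.2 : ℚ) : ℝ) = b :=
    ⟨_, _, by exact_mod_cast I.2.le, rfl, rfl⟩
  have hba := sub_nonneg.2 hab
  -- The absolute value is needed because nothing is known here about the sign of `c j`.
  set C := |c j| * (b - a + 1)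
  have hC : 0 ≤ C := by positivity
  set κ := ε / (8 * (C + 1))
  have hκ : 0 < κ := by positivity
  obtain ⟨δ, hδ, hδ'⟩ := exists_translateModulus_le (hm_equi j hj) (ε := κ / (√N + 1))
    (by positivity)
  obtain ⟨n, hn⟩ := exists_nat_gt ((b - a) / δ)
  have hn₀ : (0 : ℝ) < n := (div_nonneg hba hδ.le).trans_lt hn
  have hn₁ : (b - a) / n < δ := by
    rw [div_lt_iff₀ hδ] at hn
    rwa [div_lt_iff₀ hn₀, mul_comm]
  have hstep : 0 ≤ (b - a) / n := by positivity
  let p : ℕ → ℝ := fun k => a + k * ((b - a) / n)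
  have hp : Monotone p := fun k k' hk => by
    have : (k : ℝ) ≤ k' := by exact_mod_cast hk
    exact add_le_add le_rfl (mul_le_mul_of_nonneg_right this hstep)
  have hp₀ : p 0 = a := by simp [p]
  have hpn : p n = b := by
    simp only [p]
    field_simp
    ring
  have hp₁ : ∀ k, p (k + 1) - p k < δ := fun k => by
    simp only [p]
    push_cast
    linarith
  -- A finite net in the ball and a finite grid reduce all test curves to finitely many numbers `ν z
  -- (cell)`, on which pointwise convergence is uniform.
  obtain ⟨Y, hYsub, hYfin, hYcov⟩ := finite_cover_balls_of_compact
    (isCompact_closedBall (0 : Euc N) j) hκ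
  have hgrid : ∀ᶠ x in l, ∀ k ∈ Finset.range n, ∀ z ∈ Y,
      |f x i z (Icc (p k) (p (k + 1))) - ν i z (Icc (p k) (p (k + 1)))| ≤ ε / (2 * n) := by
    rw [Filter.eventually_all_finset]
    intro k _
    rw [Filter.eventually_all_finite hYfin]
    intro z _
    filter_upwards [(h i z _ _ (hp k.le_succ)).eventually
      (Metric.ball_mem_nhds _ (show 0 < ε / (2 * n) by positivity))] with x hx
    exact le_of_lt hx
  filter_upwards [hgrid, hf] with x hx hfx y hy
  rw [ha, hb]
  have hyI : I.toSet = Icc a b := by rw [RatInterval.toSet, ha, hb]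
  obtain ⟨hyc, hyj, hyθ⟩ := hy
  rw [hyI] at hyc hyj hyθ
  have hmem : ∀ k ≤ n, p k ∈ Icc a b := fun k hk => ⟨hp₀ ▸ hp (Nat.zero_le k), hpn ▸ hp hk⟩
  have hzex : ∀ k, ∃ z ∈ Y, k < n → dist (y (p k)) z < κ := fun k => by
    by_cases hk : k < n
    · have : y (p k) ∈ ⋃ z ∈ Y, Metric.ball z κ := hYcov (by
        rw [mem_closedBall_zero_iff]
        exact hyj _ (hmem k hk.le))
      simp only [mem_iUnion] at this
      obtain ⟨z, hz, hz'⟩ := this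
      exact ⟨z, hz, fun _ => hz'⟩
    · have : (0 : Euc N) ∈ ⋃ z ∈ Y, Metric.ball z κ := hYcov (by simp)
      simp only [mem_iUnion] at this
      obtain ⟨z, hz, -⟩ := this
      exact ⟨z, hz, fun h => (hk h).elim⟩
  choose z hzY hz using hzex
  have hzj : ∀ k, ‖z k‖ ≤ j := fun k => mem_closedBall_zero_iff.1 (hYsub (hzY k))
  -- One `κ` bounds the oscillation of the curve on a cell, the other the distance to the net.
  have hη : ∀ k < n, ∀ t ∈ Icc (p k) (p (k + 1)), ‖y t - z k‖ ≤ 2 * κ := fun k hk t ht => by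
    have htm : t ∈ Icc a b := ⟨(hmem k hk.le).1.trans ht.1, ht.2.trans (hmem (k + 1) hk).2⟩
    have e₁ := hyθ t htm (p k) (hmem k hk.le)
    rw [moduliOf_eq] at e₁
    have e₂ := hδ' |t - p k| (by
      rw [abs_of_nonneg (sub_nonneg.2 ht.1)]
      linarith [ht.2, hp₁ k])
    have e₃ : √N * (κ / (√N + 1)) ≤ κ := by
      rw [mul_div_assoc', div_le_iff₀ (by positivity)]
      nlinarith
    have e₄ := mul_le_mul_of_nonneg_left e₂ (Real.sqrt_nonneg (N : ℝ))
    have e₅ := hz k hk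
    rw [dist_eq_norm] at e₅
    have e₆ := norm_add_le (y t - y (p k)) (y (p k) - z k)
    rw [sub_add_sub_cancel] at e₆
    linarith
  -- The discretization error is the same for all `μ`: here the uniformity of the Lipschitz bounds
  -- is indispensable.
  have happ : ∀ μ : VecParamBMeasure N, HasUniformBounds m c μ →
      |paramIntegral (μ i) y a b - ∑ k ∈ Finset.range n, μ i (z k) (Icc (p k) (p (k + 1)))| ≤
        ε / 4 := fun μ hμ => by
    obtain ⟨L, hLm, hLc, hL⟩ := hμ.2 j hj
    have e₁ := (hL i).abs_paramIntegral_sub_sum_le hp n (y := y) (z := z) (η := 2 * κ)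
      (by rwa [hp₀, hpn]) (by rwa [hp₀, hpn]) (fun k _ => hzj k) hη
    rw [hp₀, hpn] at e₁
    have e₂ : L b - L a ≤ C := (hLc a b hab).trans
      (mul_le_mul_of_nonneg_right (le_abs_self _) (by linarith))
    have e₃ : C * (2 * κ) ≤ ε / 4 := by
      have : (C + 1) * κ = ε / 8 := by
        simp only [κ]
        field_simp
      nlinarith
    exact e₁.trans ((mul_le_mul_of_nonneg_right e₂ (by positivity)).trans e₃)
  have hsum : |∑ k ∈ Finset.range n, f x i (z k) (Icc (p k) (p (k + 1))) -
      ∑ k ∈ Finset.range n, ν i (z k) (Icc (p k) (p (k + 1)))| ≤ ε / 2 := by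
    rw [← Finset.sum_sub_distrib]
    refine (Finset.abs_sum_le_sum_abs _ _).trans
      ((Finset.sum_le_sum fun k hk => hx k hk (z k) (hzY k)).trans (le_of_eq ?_))
    rw [Finset.sum_const, Finset.card_range, nsmul_eq_mul]
    field_simp
  have e₁ := abs_le.1 (happ _ hfx)
  have e₂ := abs_le.1 (happ _ hν)
  rw [abs_le] at hsum ⊢
  constructor <;> linarith [hsum.1, hsum.2, e₁.1, e₁.2, e₂.1, e₂.2]

theorem isCompact_hasUniformBounds {m : ℕ → Measure ℝ} {c : ℕ → ℝ}
    (hm_equi : ∀ j, 1 ≤ j → EquicontinuousFamily (fun τ : ℝ => translateMeasure (m j) τ)) :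
    @IsCompact _ (thetaTopology N m) {ν : VecParamBMeasure N | HasUniformBounds m c ν} := by
  let _ := thetaTopology N m
  rw [isCompact_iff_ultrafilter_le_nhds]
  intro U hU
  have hU' : ∀ᶠ μ in (U : Filter (VecParamBMeasure N)), HasUniformBounds m c μ :=
    le_principal_iff.1 hU
  obtain ⟨ν, hν, hlim⟩ := HasUniformBounds.exists_limit hm_equi U hU'
  exact ⟨ν, hν, tendsto_id'.1 (tendsto_theta_of_tendsto_apply hm_equi hU' hν hlim)⟩

/-! ### Separation -/

theorem ParamBMeasure.continuous_apply_Icc (ν : ParamBMeasure N) (s t : ℝ) :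
    Continuous fun y => ν y (Icc s t) := by
  rcases lt_or_ge t s with hst | hst
  · simp only [Icc_eq_empty (not_le.2 hst), BMeasure.map_empty]
    exact continuous_const
  rw [continuous_iff_continuousAt]
  intro y
  obtain ⟨L, -, hL⟩ := ν.exists_lDom (‖y‖ + 1)
  rw [ContinuousAt, tendsto_iff_dist_tendsto_zero]
  have h₀ : Tendsto (fun z => (L t - L s) * ‖z - y‖) (𝓝 y) (𝓝 ((L t - L s) * ‖y - y‖)) := by
    have : Continuous fun z => (L t - L s) * ‖z - y‖ := by fun_prop
    exact this.tendsto y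
  rw [sub_self, norm_zero, mul_zero] at h₀
  refine squeeze_zero' (Eventually.of_forall fun _ => dist_nonneg) ?_ h₀
  filter_upwards [Metric.ball_mem_nhds y one_pos] with z hz
  rw [mem_ball_iff_norm] at hz
  have := norm_le_norm_add_norm_sub' z y
  exact hL.2 z y (by linarith) (by linarith) s t hst

/-- Equality on rational intervals for `y ∈ D` extends to all `y` by the Lipschitz dependence on
`y`, then to all compact intervals by continuity of the distribution functions, and finally to all
bounded Borel sets by `BMeasure.ext_of_Icc`. -/
theorem t2Space_denseTopology {D : Set (Euc N)} (hD : Dense D) :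
    @T2Space (VecParamBMeasure N) (denseTopology N D) := by
  have h : @T2Space (ParamBMeasure N) (sigmaD N D) := by
    refine (seminormLike_sigmaD D).t2Space fun ν μ hνμ => ?_
    have h₁ : ∀ (I : RatInterval) (y : Euc N), ν y I.toSet = μ y I.toSet := fun I y => by
      refine congrFun (Continuous.ext_on hD (ν.continuous_apply_Icc _ _)
        (μ.continuous_apply_Icc _ _) fun y hy => ?_) y
      have := hνμ (I, ⟨y, hy⟩)
      rwa [ParamBMeasure.sub_Icc, enorm_eq_zero, sub_eq_zero] at this
    ext1
    funext y
    refine BMeasure.ext_of_Icc fun s t hst => ?_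
    rcases hst.eq_or_lt with rfl | hst
    · rw [BMeasure.Icc_self, BMeasure.Icc_self]
    · have hν := ν.continuous_cdf y
      have hμ := μ.continuous_cdf y
      have := nonneg_of_forall_rat
        (F := fun x => -|((ν y).cdf x.2 - (ν y).cdf x.1) - ((μ y).cdf x.2 - (μ y).cdf x.1)|)
        (by fun_prop) (fun p q hpq => by
          have hpq' : (p : ℝ) ≤ q := by exact_mod_cast hpq.le
          have e := h₁ ⟨(p, q), hpq⟩ y
          simp only [RatInterval.toSet] at e
          rw [BMeasure.Icc_eq_cdf _ hpq', BMeasure.Icc_eq_cdf _ hpq'] at e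
          simp only
          rw [e, sub_self, abs_zero, neg_zero]) hst
      rw [BMeasure.Icc_eq_cdf _ hst.le, BMeasure.Icc_eq_cdf _ hst.le]
      exact sub_eq_zero.1 (abs_nonpos_iff.1 (neg_nonneg.1 this))
  let _ := sigmaD N D
  exact (inferInstance : T2Space (Fin N → ParamBMeasure N))

theorem thetaTopology_le_denseTopology (m : ℕ → Measure ℝ) (D : Set (Euc N)) :
    thetaTopology N m ≤ denseTopology N D := by
  rw [← continuous_id_iff_le]
  refine @continuous_iff_continuousAt _ _ (thetaTopology N m) (denseTopology N D) _ |>.2 fun ν => ?_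
  exact tendsto_denseTopology_iff.2 fun i I y _ =>
    tendsto_apply_of_tendsto_theta (f := id) (tendsto_id'.2 le_rfl) i y I

/-- If a set has compact closure in a topology, then a coarser Hausdorff topology gives the same
closure, and induces the same topology on it. -/
theorem closure_eq_and_induced_eq_of_le {X : Type*} {T T' : TopologicalSpace X} (h : T ≤ T')
    (h' : @T2Space X T') {S : Set X} (hS : @IsCompact X T (@closure X T S)) :
    @closure X T S = @closure X T' S ∧
      T.induced (Subtype.val : @closure X T S → X) =
        T'.induced (Subtype.val : @closure X T S → X) := by
  -- A compact set stays compact in the coarser topology, and is closed there because that topology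
  -- is Hausdorff.
  have hcl : ∀ K : Set X, @IsCompact X T K → IsClosed[T'] K := fun K hK => by
    have : @IsCompact X T' K := by
      simpa using @IsCompact.image X X T T' K id hK (continuous_id_iff_le.2 h)
    exact @IsCompact.isClosed X T' h' K this
  refine ⟨Subset.antisymm (closure.mono h) ?_, le_antisymm (induced_mono h) ?_⟩
  · exact @closure_minimal X T' _ _ (@subset_closure X T S) (hcl _ hS)
  · rw [← continuous_id_iff_le]
    refine (@continuous_iff_isClosed _ _ (T'.induced _) (T.induced _) _).2 fun A hA => ?_
    obtain ⟨B, hB, rfl⟩ := (@isClosed_induced_iff _ _ T _ _).1 hA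
    refine (@isClosed_induced_iff _ _ T' _ _).2
      ⟨@closure X T S ∩ B, hcl _ (@IsCompact.inter_right X T _ _ hS hB), ?_⟩
    ext x
    simp

/-- The topology `σ̄_Θ` is Hausdorff because it is finer than `σ̄_D` with `D = univ`. The compact
set of elements with uniform bounds is therefore closed, and it contains all translates of `ν₀`,
hence their closure. -/
theorem isCompact_hull {m : ℕ → Measure ℝ} {c : ℕ → ℝ} {ν₀ : VecParamBMeasure N}
    (hm_equi : ∀ j, 1 ≤ j → EquicontinuousFamily (fun τ : ℝ => translateMeasure (m j) τ))
    (h₀ : HasUniformBounds m c ν₀) :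
    @IsCompact _ (thetaTopology N m) (hull (thetaTopology N m) ν₀) := by
  have hT2 : @T2Space (VecParamBMeasure N) (thetaTopology N m) :=
    t2Space_antitone (thetaTopology_le_denseTopology m univ) (t2Space_denseTopology dense_univ)
  let _ := thetaTopology N m
  have hK := isCompact_hasUniformBounds (N := N) (c := c) hm_equi
  refine hK.of_isClosed_subset isClosed_closure (closure_minimal ?_ hK.isClosed)
  rintro _ ⟨t, rfl⟩
  exact h₀.translate t

theorem mainTheorem5 (N : ℕ) (ν₀ : VecParamBMeasure N) (m : ℕ → Measure ℝ)
    (hm : ∀ j, 1 ≤ j → IsContinuousMeasure (m j))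
    (hm_bound : ∀ j, 1 ≤ j → ∀ i : Fin N, IsMBound (ν₀ i) j (m j))
    (hm_mono : ∀ j k, 1 ≤ j → j ≤ k → m j ≤ m k)
    (hm_equi : ∀ j, 1 ≤ j → EquicontinuousFamily (fun τ : ℝ => translateMeasure (m j) τ)) :
    (∀ ν ∈ hull (thetaTopology N m) ν₀, ∀ y₀ : Euc N, IsWellPosed ν y₀) ∧
    (∃ φ : Flow ℝ (HullSpace (thetaTopology N m) ν₀),
      (∀ (t : ℝ) (ν : HullSpace (thetaTopology N m) ν₀), (φ t ν).1 = ν.1.translate t) ∧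
      IsLocalContinuousSkewProductFlow φ (flowDomain (thetaTopology N m) ν₀)
        (fun p => (φ p.1 p.2.1, solution p.2.1.1 p.2.2 p.1))) ∧
    (∀ l : ℕ → Measure ℝ, (∀ j, 1 ≤ j → IsContinuousMeasure (l j)) →
      (∀ j, 1 ≤ j → ∀ i : Fin N, IsLBound (ν₀ i) j (l j)) →
      (∀ j, 1 ≤ j → BoundedFamily (fun τ : ℝ => translateMeasure (l j) τ)) →
      CompactSpace (HullSpace (thetaTopology N m) ν₀) ∧
      ∀ D : Set (Euc N), D.Countable → Dense D →
        hull (thetaTopology N m) ν₀ = hull (denseTopology N D) ν₀ ∧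
        (thetaTopology N m).induced
            (fun ν : hull (thetaTopology N m) ν₀ => (ν : VecParamBMeasure N)) =
          (denseTopology N D).induced
            (fun ν : hull (thetaTopology N m) ν₀ => (ν : VecParamBMeasure N))) := by
  have h₀ : HasModulusBounds m ν₀ := hasModulusBounds_of_isMBound hm hm_bound hm_equi
  refine ⟨fun ν _ y₀ => isWellPosed ν y₀, ⟨hullFlow hm_equi h₀, fun _ _ => rfl,
    isLocalContinuousSkewProductFlow hm_equi h₀⟩, fun l hl hl_bound hl_bdd => ?_⟩
  have hc : ∀ j : ℕ, ∃ c : ℝ, 1 ≤ j → 0 < c ∧ ∀ t, l j (Icc t (t + 1)) ≤ ENNReal.ofReal c :=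
    fun j => by
      by_cases hj : 1 ≤ j
      · obtain ⟨c, hc, h⟩ := hl_bdd j hj
        refine ⟨c, fun _ => ⟨hc, fun t => ?_⟩⟩
        have := h 0 t
        rwa [translateMeasure_zero_Icc] at this
      · exact ⟨0, fun h => (hj h).elim⟩
  choose c hc using hc
  have h₁ : HasUniformBounds m c ν₀ := ⟨h₀, fun j hj => by
    obtain ⟨L, hL, -, -, hlL⟩ := (hl j hj).exists_cdf
    exact ⟨L, hL, fun s t hst => sub_le_of_boundedFamily (hc j hj).1 (hc j hj).2 hL hlL hst,
      fun i => ⟨hL, fun y z hy hz s t hst => (hl_bound j hj i).abs_le hL hlL hy hz hst⟩⟩⟩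
  have hK := isCompact_hull hm_equi h₁
  refine ⟨(@isCompact_iff_compactSpace _ (thetaTopology N m) _).1 hK, fun D _ hD => ?_⟩
  exact closure_eq_and_induced_eq_of_le (thetaTopology_le_denseTopology m D)
    (t2Space_denseTopology hD) hK
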